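/- **Setting.** Let $\Gamma$ and $\Lambda$ be finitely generated torsion-free nilpotent groups, let $\Gamma\curvearrowright (X,m)$ be an ergodic probability-measure-preserving action, and let $\alpha:\Gamma\times X\to\Lambda$ be an integrable measurable cocycle: $\alpha(\gamma_1\gamma_2,x)=\alpha(\gamma_1,\gamma_2 x)\,\alpha(\gamma_2,x)$ for all $\gamma_1,\gamma_2\in\Gamma$ and $m$-a.e. $x$, and $\int_X|\alpha(\gamma,x)|_\Lambda\,dm(x)<\infty$ for every $\gamma\in\Gamma$, where $|\cdot|_\Lambda$ is the word norm of a finite generating set. (For instance, $\alpha$ is a cocycle of an ergodic integrable measure equivalence between $\Gamma$ and $\Lambda$.) Let $H$ be the Mal'cev completion of $\Lambda$, that is, the simply connected nilpotent Lie group in which $\Lambda$ is a discrete cocompact subgroup, with Lie algebra $\mathfrak h$ and $\log:H\to\mathfrak h$. Write $\mathfrak h^1=\mathfrak h$, $\mathfrak h^{i+1}=[\mathfrak h,\mathfrak h^i]$, and fix a splitting $\mathfrak h=V_1\oplus\cdots\oplus V_r$ into vector subspaces with $\mathfrak h^i=V_i\oplus\cdots\oplus V_r$ for all $i$. Let $\delta_t$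 ($t>0$) be the linear map of $\mathfrak h$ that is multiplication by $t^i$ on $V_i$, and let $\pi_{ab}:\mathfrak h\to V_1$ be the projection along $V_2\oplus\cdots\oplus V_r$. Let $[\cdot,\cdot]_\infty$ be the bracket of the associated graded Lie algebra carried over to $\mathfrak h$: for $v\in V_i$, $w\in V_j$, $[v,w]_\infty$ is the $V_{i+j}$-component of $[v,w]$. Let $H_\infty$ be the simply connected Lie group with Lie algebra $\mathfrak h_\infty=(\mathfrak h,[\cdot,\cdot]_\infty)$. Identify $H$ and $H_\infty$ with $\mathfrak h$ through their exponential maps, so that $\Lambda\subset H\equiv\mathfrak h\equiv H_\infty$. Let $d_\infty$ be a Carnot–Carathéodory metric on $H_\infty$: for a norm on $V_1$, $d_\infty(g,h)$ is the infimum of the lengths of the curves from $g$ to $h$ that are tangent to the left-invariant distribution spanned by $V_1$. Put $$\overline{\alpha_{ab}}(\gamma)=\int_X \pi_{ab}\bigl(\alpha(\gamma,x)\bigr)\,dm(x)\in V_1 .$$ **Proposition.** For every $\gamma\in\Gamma$, $$\delta_{1/n}\,\alpha(\gamma^n,x)\longrightarrow\overline{\alpha_{ab}}(\gamma)\quad\text{in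 } H_\infty\text{, in probability, as } n\to\infty,$$ that is, for every neighbourhood $U$ of $\overline{\alpha_{ab}}(\gamma)$ in $H_\infty$ one has $m\{x:\delta_{1/n}\alpha(\gamma^n,x)\in U\}\to1$. Equivalently, $$d_\infty\bigl(\alpha(\gamma^n,x),\,\delta_n\overline{\alpha_{ab}}(\gamma)\bigr)=o(n)\quad\text{in probability},$$ that is, for every $\epsilon>0$ one has $m\{x: d_\infty(\alpha(\gamma^n,x),\delta_n\overline{\alpha_{ab}}(\gamma))<\epsilon n\}\to1$. -/

import Mathlib

open MeasureTheory Filter Topology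
open scoped ENNReal

noncomputable section

namespace NilCocycle

/-! ### Word norms, cocycles and convergence in probability -/

/-- No nontrivial element has finite order. -/
def TorsionFree (G : Type*) [Group G] : Prop :=
  ∀ g : G, g ≠ 1 → ¬ IsOfFinOrder g

/-- The word norm of `g` with respect to the symmetrization of the finite set `T`. -/
def wordNorm {G : Type*} [Group G] (T : Finset G) (g : G) : ℕ :=
  sInf {n | ∃ l : List G, l.length = n ∧ (∀ a ∈ l, a ∈ T ∨ a⁻¹ ∈ T) ∧ l.prod = g}

/-- An integrable measurable cocycle `α : Γ × X → Λ` over an action of `Γ` on `(X, m)`; the word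
norm on the (countable, discrete) group `Λ` is that of the finite generating set `T`. -/
structure IsIntegrableCocycle {Γ Λ X : Type*} [Group Γ] [Group Λ] [MeasurableSpace X]
    [MulAction Γ X] (m : Measure X) (T : Finset Λ) (α : Γ → X → Λ) : Prop where
  measurable : ∀ γ l, MeasurableSet {x | α γ x = l}
  cocycle : ∀ γ₁ γ₂, ∀ᵐ x ∂m, α (γ₁ * γ₂) x = α γ₁ (γ₂ • x) * α γ₂ x
  integrable : ∀ γ, Integrable (fun x => (wordNorm T (α γ x) : ℝ)) m

/-- `f n → a` in probability. -/
def TendstoInProbability {X E : Type*} [MeasurableSpace X] [TopologicalSpace E] (m : Measure X)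
    (f : ℕ → X → E) (a : E) : Prop :=
  ∀ U ∈ 𝓝 a, Tendsto (fun n => m {x | f n x ∈ U}) atTop (𝓝 1)

/-- `f n = o(n)` in probability. -/
def IsLittleOInProbability {X : Type*} [MeasurableSpace X] (m : Measure X)
    (f : ℕ → X → ℝ≥0∞) : Prop :=
  ∀ ε : ℝ≥0∞, 0 < ε → Tendsto (fun n : ℕ => m {x | f n x / (n : ℝ≥0∞) < ε}) atTop (𝓝 1)

/-! ### The Baker-Campbell-Hausdorff product -/

/-- The right-nested bracket `[v₁, [v₂, [… , vₖ]]]` of a list of vectors. -/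
def nestedBracket {V : Type*} [Zero V] (br : V → V → V) : List V → V
  | [] => 0
  | [v] => v
  | v :: w :: l => br v (nestedBracket br (w :: l))

/-- Dynkin's form of the Baker-Campbell-Hausdorff series `log (exp x * exp y)` for a bracket `br`
all of whose iterated brackets of more than `c` vectors vanish: the sum over `k ≥ 1` and over
pairs `(r₁, s₁), …, (rₖ, sₖ) ≠ (0, 0)` of
`(-1)^(k-1) / k * 1 / (∑ (rᵢ + sᵢ) * ∏ rᵢ! sᵢ!) * [x^r₁ y^s₁ ⋯ x^rₖ y^sₖ]`.
Terms with `k`, some `rᵢ` or some `sᵢ` larger than `c` are zero and are left out. -/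
def bch {V : Type*} [AddCommGroup V] [Module ℝ V] (c : ℕ) (br : V → V → V) (x y : V) : V :=
  ∑ k ∈ Finset.Icc 1 c,
    ∑ p ∈ Fintype.piFinset
        (fun _ : Fin k => (Finset.range (c + 1) ×ˢ Finset.range (c + 1)).erase (0, 0)),
      ((-1 : ℝ) ^ (k - 1) / k *
        (1 / (((∑ i, ((p i).1 + (p i).2) : ℕ) : ℝ) *
          ((∏ i, ((p i).1.factorial * (p i).2.factorial) : ℕ) : ℝ)))) •
        nestedBracket br
          (List.ofFn fun i => List.replicate (p i).1 x ++ List.replicate (p i).2 y).flatten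

section LieAlgebra

variable (𝔥 : Type*) [LieRing 𝔥] [LieAlgebra ℝ 𝔥]

/-- The nilpotency class of `𝔥`. -/
def step : ℕ := LieModule.nilpotencyLength 𝔥 𝔥

variable {𝔥}

/-- The product of the simply connected nilpotent Lie group `H` with Lie algebra `𝔥`, in
logarithmic coordinates: the underlying space of `H` is `𝔥`, and `exp` is the identity. -/
def lieMul (x y : 𝔥) : 𝔥 := bch (step 𝔥) (fun v w => ⁅v, w⁆) x y

/-- `H`, the simply connected nilpotent Lie group with Lie algebra `𝔥`, is a Mal'cev completion of
`Λ` through the embedding `log : Λ → H`, written in logarithmic coordinates: `log` identifies `Λ`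
with a discrete cocompact subgroup of `H`. -/
structure IsMalcevCompletion {Λ : Type*} [Group Λ] [TopologicalSpace 𝔥] (log : Λ → 𝔥) : Prop where
  injective : Function.Injective log
  map_mul : ∀ a b, log (a * b) = lieMul (log a) (log b)
  discrete : DiscreteTopology (Set.range log)
  cocompact : ∃ K : Set 𝔥, IsCompact K ∧ ∀ v, ∃ k ∈ K, ∃ l : Λ, v = lieMul k (log l)

variable (𝔥)

/-- A splitting `𝔥 = V₁ ⊕ V₂ ⊕ ⋯` of vector spaces with `𝔥ⁱ = Vᵢ ⊕ Vᵢ₊₁ ⊕ ⋯` for the terms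
`𝔥¹ = 𝔥`, `𝔥ⁱ⁺¹ = [𝔥, 𝔥ⁱ]` of the lower central series. The summand `Vᵢ₊₁` is `V i`. -/
structure Splitting where
  V : ℕ → Submodule ℝ 𝔥
  isInternal : DirectSum.IsInternal V
  lowerCentralSeries_eq : ∀ i,
    (LieModule.lowerCentralSeries ℝ 𝔥 𝔥 i).toSubmodule = ⨆ j, ⨆ _ : i ≤ j, V j

variable {𝔥}

namespace Splitting

variable (S : Splitting 𝔥)

/-- The projection of `𝔥` onto its summand `V i` along the other summands. -/
def proj (i : ℕ) : 𝔥 →ₗ[ℝ] 𝔥 :=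
  (S.V i).subtype ∘ₗ DirectSum.component ℝ ℕ (fun j => S.V j) i ∘ₗ
    (LinearEquiv.ofBijective (DirectSum.coeLinearMap S.V) S.isInternal).symm.toLinearMap

/-- The projection `π_ab` onto the abelian coordinates, that is, onto `V₁`. -/
def projAb : 𝔥 →ₗ[ℝ] 𝔥 := S.proj 0

/-- The dilation `δ_t`, which is multiplication by `tⁱ` on `Vᵢ`. -/
def dil (t : ℝ) (v : 𝔥) : 𝔥 := ∑ i ∈ Finset.range (step 𝔥), t ^ (i + 1) • S.proj i v

/-- The bracket of the associated graded Lie algebra `𝔥_∞ = ⨁ 𝔥ⁱ / 𝔥ⁱ⁺¹`, transported to `𝔥` by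
the linear identification `Vᵢ ≃ 𝔥ⁱ / 𝔥ⁱ⁺¹`: for `v ∈ Vᵢ` and `w ∈ Vⱼ` it is the component of
`[v, w]` in `Vᵢ₊ⱼ`. -/
def bracketInf (v w : 𝔥) : 𝔥 :=
  ∑ i ∈ Finset.range (step 𝔥), ∑ j ∈ Finset.range (step 𝔥),
    S.proj (i + j + 1) ⁅S.proj i v, S.proj j w⁆

/-- The product `⋆` of the graded group `H_∞ = exp_∞ 𝔥_∞` in logarithmic coordinates. -/
def mulInf (x y : 𝔥) : 𝔥 := bch (step 𝔥) S.bracketInf x y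

section Topology

variable [TopologicalSpace 𝔥] [ContinuousSMul ℝ 𝔥]

/-- `c : [0, T] → H_∞` is a horizontal curve from `g` to `h`: it is continuous and, off a finite
set of times, differentiable with derivative the value at `c t` of the left-invariant vector field
of `u t ∈ V₁`. -/
def IsHorizontal (T : ℝ) (c : ℝ → 𝔥) (u : ℝ → S.V 0) (g h : 𝔥) : Prop :=
  0 ≤ T ∧ c 0 = g ∧ c T = h ∧ ContinuousOn c (Set.Icc 0 T) ∧
    ∃ F : Finset ℝ, ∀ t ∈ Set.Ioo 0 T, t ∉ F →
      ∃ w, HasDerivAt (fun s : ℝ => S.mulInf (c t) (s • (u t : 𝔥))) w 0 ∧ HasDerivAt c w t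

/-- The (sub-Finsler) Carnot-Carathéodory distance `d_∞` on `H_∞` given by a norm `N` on `V₁`: the
infimum of the `N`-lengths of horizontal curves. It is `∞` where there is no such curve. -/
def ccDist (N : Seminorm ℝ (S.V 0)) (g h : 𝔥) : ℝ≥0∞ :=
  ⨅ (T : ℝ) (c : ℝ → 𝔥) (u : ℝ → S.V 0) (_ : S.IsHorizontal T c u g h),
    ∫⁻ t in Set.Ioc 0 T, ENNReal.ofReal (N (u t))

end Topology

/-- The averaged abelianized value `∫ π_ab (log α(γ, x)) dm(x)`, a vector of `V₁ ⊆ 𝔥`, computed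
coordinatewise in a basis of the finite-dimensional space `𝔥`. -/
def averageAb [FiniteDimensional ℝ 𝔥] {Γ Λ X : Type*} [MeasurableSpace X] (m : Measure X)
    (log : Λ → 𝔥) (α : Γ → X → Λ) (γ : Γ) : 𝔥 :=
  ∑ i, (∫ x, (Module.finBasis ℝ 𝔥).repr (S.projAb (log (α γ x))) i ∂m) • Module.finBasis ℝ 𝔥 i

end Splitting

end LieAlgebra

end NilCocycle

end

/-! The abelian coordinate of the product of `H` is additive, so the coordinates of `projAb (log (α
γ x))` are real integrable cocycles. Their means along the powers of an element `g` converge in `L¹`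
to some `f g`. Since `γ` alone need not act ergodically, nilpotency of `Γ` has to make `f γ`
constant. Translation by `δ` sends `f g` to `f (δ⁻¹ * g * δ)`. By induction on the class, `f` is
additive on the subgroup generated by `γ` and the derived subgroup, so subtracting `f` from its
translate gives `f` of a commutator: the translation is unipotent on `f γ`. A unipotent isometry is
trivial, hence `f γ` is invariant, and constant by ergodicity (`limit_invariant`,
`tendsto_integral_mean_cocycle`).

To pass from the abelianization to `H`, cut `γ ^ n` into blocks of a fixed large length `l`. With
`a` the averaged value, a block `b` rescaled by `δ_{1/n}` is `(l / n) a` up to an abelian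
discrepancy, small on average, and components of higher degree, of order `(|b| / n) ^ 2` when `|b| ≤
n`. Block norms are stationary and integrable, so their squares sum to `o(n ^ 2)` in probability
(`eventually_sum_sq_le`). The rescaled product of `H` is polynomial in the scale `s`, with the
product of `H_∞` at `s = 0`; a product of many small factors therefore depends on their errors in a
way controlled uniformly in `s` (`exists_product_estimate`), and the rescaled cocycle is close to
`a`.

For `d_∞`, horizontal vectors generate `H_∞`; the Baire property bounds the length needed near the
identity, and dilation makes it small (`eventually_cost_le`). Left translation and dilation then
turn convergence into the `o(n)` estimate. The associativity this uses is inherited from `Λ`, whose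
rescalings become dense (`scaledMul_zero_assoc`). -/

noncomputable section

namespace NilCocycle

/-! ### Unipotent isometries and cocycles with values in a Banach space -/

section BanachCocycle

open scoped commutatorElement

variable {E : Type*} [NormedAddCommGroup E] [NormedSpace ℝ E]

/-- A linear isometry `U` with `(U - 1)² v = 0` fixes `v`. -/
theorem isometry_fixed_of_sq (U : E →ₗᵢ[ℝ] E) (v : E) (h : U (U v - v) = U v - v) : U v = v := by
  -- The witness is the `n`-th iterate of `v`: it drifts linearly along `U v - v` while its norm
  -- stays that of `v`.
  have key : ∀ n : ℕ, ∃ w : E, ‖w‖ = ‖v‖ ∧ w = v + (n : ℝ) • (U v - v) := by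
    intro n
    induction n with
    | zero => exact ⟨v, rfl, by simp⟩
    | succ n ih =>
      obtain ⟨w, hw, hwe⟩ := ih
      refine ⟨U w, by rw [U.norm_map, hw], ?_⟩
      rw [hwe, map_add, map_smul, h]
      push_cast
      module
  by_contra hne
  have hpos : 0 < ‖U v - v‖ := norm_pos_iff.2 (sub_ne_zero.2 hne)
  obtain ⟨n, hn⟩ := exists_nat_gt (2 * ‖v‖ / ‖U v - v‖)
  obtain ⟨w, hw, hwe⟩ := key n
  have h1 : ‖(n : ℝ) • (U v - v)‖ ≤ ‖w‖ + ‖v‖ := by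
    have : (n : ℝ) • (U v - v) = w - v := by rw [hwe]; abel
    rw [this]; exact norm_sub_le _ _
  rw [norm_smul, hw, Real.norm_natCast] at h1
  rw [div_lt_iff₀ hpos] at hn
  linarith

/-- If `v 0, v 1, …` satisfy `v (i + 1) = U (v i) - v i` for an isometry `U` and some `v c`
vanishes, then `U` fixes `v 0`. -/
theorem isometry_fixed_of_iterate (U : E →ₗᵢ[ℝ] E) (c : ℕ) (v : ℕ → E)
    (hv : ∀ i, v (i + 1) = U (v i) - v i) (hc : v c = 0) : U (v 0) = v 0 := by
  induction c generalizing v with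
  | zero => simp [hc]
  | succ c ih =>
    have h1 := ih (fun i => v (i + 1)) (fun i => hv (i + 1)) hc
    simp only [zero_add] at h1
    apply isometry_fixed_of_sq
    rw [← hv 0]
    exact h1

/-- Commuting with `b` modulo a subgroup normalized by `K` passes to generated subgroups. -/
theorem commutator_mem_of_mem_closure {G : Type*} [Group G] {K N : Subgroup G}
    (hN : K ≤ Subgroup.normalizer (N : Set G)) {s : Set G} {b : G}
    (h : ∀ a ∈ s, a ∈ K ∧ ⁅a, b⁆ ∈ N) : ∀ a ∈ Subgroup.closure s, a ∈ K ∧ ⁅a, b⁆ ∈ N := by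
  intro a ha
  induction ha using Subgroup.closure_induction with
  | mem x hx => exact h x hx
  | one => exact ⟨K.one_mem, by simp [N.one_mem]⟩
  | mul x y _ _ hx hy =>
    refine ⟨K.mul_mem hx.1 hy.1, ?_⟩
    have e : ⁅x * y, b⁆ = x * ⁅y, b⁆ * x⁻¹ * ⁅x, b⁆ := by
      simp only [commutatorElement_def]; group
    rw [e]
    exact N.mul_mem ((Subgroup.mem_normalizer_iff.1 (hN hx.1) _).1 hy.2) hx.2
  | inv x _ hx =>
    refine ⟨K.inv_mem hx.1, ?_⟩
    have e : ⁅x⁻¹, b⁆ = x⁻¹ * ⁅x, b⁆⁻¹ * x⁻¹⁻¹ := by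
      simp only [commutatorElement_def]; group
    rw [e]
    exact (Subgroup.mem_normalizer_iff.1 (hN (K.inv_mem hx.1)) _).1 (N.inv_mem hx.2)

/-- The subgroup generated by an element of `K` and the derived subgroup of `K` has smaller
nilpotency class than `K`. -/
theorem lowerCentralSeries_closure_insert_le {G : Type*} [Group G] (K : Subgroup G) {γ : G}
    (hγ : γ ∈ K) (c : ℕ) :
    (Subgroup.closure (insert γ ((⁅K, K⁆ : Subgroup G) : Set G))).lowerCentralSeries (c + 1) ≤
      K.lowerCentralSeries (c + 2) := by
  have hDK : ⁅K, K⁆ ≤ K := Subgroup.commutator_le_self K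
  have hK₂ : Subgroup.closure (insert γ ((⁅K, K⁆ : Subgroup G) : Set G)) ≤ K := by
    rw [Subgroup.closure_le]
    exact Set.insert_subset hγ hDK
  induction c with
  | zero =>
    have hN := K.self_le_normalizer_lowerCentralSeries 2
    have hd : ∀ d ∈ ⁅K, K⁆, ∀ k ∈ K, ⁅d, k⁆ ∈ K.lowerCentralSeries 2 := fun d hd k hk =>
      Subgroup.commutator_mem_commutator hd hk
    -- Modulo the third term of the lower central series the derived subgroup is central in `K`, so
    -- the generators commute with each other. The passage to the closure is then made one variable
    -- at a time.
    have hgen : ∀ b ∈ insert γ ((⁅K, K⁆ : Subgroup G) : Set G), ∀ a ∈ insert γ ((⁅K, K⁆ : Subgroup G) : Set G),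
        a ∈ K ∧ ⁅a, b⁆ ∈ K.lowerCentralSeries 2 := by
      rintro b (rfl | hb) a (rfl | ha)
      · exact ⟨hγ, by simp⟩
      · exact ⟨hDK ha, hd a ha _ hγ⟩
      · refine ⟨hγ, ?_⟩
        rw [← commutatorElement_inv]
        exact Subgroup.inv_mem _ (hd b hb _ hγ)
      · exact ⟨hDK ha, hd a ha _ (hDK hb)⟩
    change ⁅_, _⁆ ≤ _
    rw [Subgroup.commutator_le]
    intro a ha b hb
    refine (commutator_mem_of_mem_closure hN (fun x hx => ⟨?_, ?_⟩) a ha).2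
    · exact hK₂ (Subgroup.subset_closure hx)
    · rw [← commutatorElement_inv]
      exact Subgroup.inv_mem _ (commutator_mem_of_mem_closure hN (hgen x hx) b hb).2
  | succ c ih => exact Subgroup.commutator_mono ih hK₂

/-- Cocycles `b` with values in a Banach space on which a group acts isometrically from the right,
such that the means of `b` along powers converge and invariant vectors are normed by invariant
functionals. -/
structure IsMeanConvergentCocycle {G : Type*} [Group G] (U : G → E →ₗᵢ[ℝ] E) (b f : G → E) :
    Prop where
  cocycle : ∀ g h, b (g * h) = U h (b g) + b h
  tendsto : ∀ g, Tendsto (fun n : ℕ => (n : ℝ)⁻¹ • b (g ^ n)) atTop (𝓝 (f g))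
  exists_functional : ∀ (K : Subgroup G) (v : E), (∀ k ∈ K, U k v = v) →
    ∃ ψ : E →L[ℝ] ℝ, (∀ k ∈ K, ∀ w, ψ (U k w) = ψ w) ∧ ψ v = ‖v‖

namespace IsMeanConvergentCocycle

variable {G : Type*} [Group G] {U : G → E →ₗᵢ[ℝ] E} {b f : G → E}

theorem apply_one (H : IsMeanConvergentCocycle U b f) : b 1 = 0 := by
  have h := H.cocycle 1 1
  rw [mul_one, right_eq_add] at h
  rwa [← norm_eq_zero, (U 1).norm_map, norm_eq_zero] at h

theorem limit_one (H : IsMeanConvergentCocycle U b f) : f 1 = 0 := by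
  refine tendsto_nhds_unique (H.tendsto 1) ?_
  simp [H.apply_one]

/-- Expanding `b (g ^ n * h) = b (h * (h⁻¹ * g * h) ^ n)` in both ways leaves a discrepancy of norm
at most `2 * ‖b h‖`, which division by `n` kills. -/
theorem limit_conj (H : IsMeanConvergentCocycle U b f) (g h : G) :
    U h (f g) = f (h⁻¹ * g * h) := by
  have h1 : Tendsto (fun n : ℕ => U h ((n : ℝ)⁻¹ • b (g ^ n))) atTop (𝓝 (U h (f g))) :=
    ((U h).continuous.tendsto _).comp (H.tendsto g)
  have h2 : ∀ n : ℕ, U h ((n : ℝ)⁻¹ • b (g ^ n)) = (n : ℝ)⁻¹ • b ((h⁻¹ * g * h) ^ n)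
      + (n : ℝ)⁻¹ • (U ((h⁻¹ * g * h) ^ n) (b h) - b h) := by
    intro n
    have e : g ^ n * h = h * (h⁻¹ * g * h) ^ n := by
      have := conj_pow (i := n) (a := h⁻¹) (b := g)
      rw [inv_inv] at this
      rw [this]; group
    have := H.cocycle (g ^ n) h
    rw [e, H.cocycle] at this
    rw [map_smul, ← smul_add]
    congr 1
    rw [eq_sub_of_add_eq this.symm]
    abel
  have h3 : Tendsto (fun n : ℕ => (n : ℝ)⁻¹ • (U ((h⁻¹ * g * h) ^ n) (b h) - b h)) atTop
      (𝓝 0) := by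
    refine squeeze_zero_norm (a := fun n : ℕ => (n : ℝ)⁻¹ * (2 * ‖b h‖)) (fun n => ?_) ?_
    · rw [norm_smul, norm_inv, Real.norm_natCast]
      gcongr
      refine (norm_sub_le _ _).trans ?_
      rw [LinearIsometry.norm_map]
      linarith
    · simpa using (tendsto_inv_atTop_nhds_zero_nat (𝕜 := ℝ)).mul_const (2 * ‖b h‖)
  have h4 := (H.tendsto (h⁻¹ * g * h)).add h3
  rw [add_zero] at h4
  exact tendsto_nhds_unique (h1.congr h2) h4

/-- An invariant functional turns the cocycle into a homomorphism on `K`; it therefore cannot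
distinguish `b g` from the limit of means `f g`. -/
theorem map_pow_of_invariant (H : IsMeanConvergentCocycle U b f) {K : Subgroup G} {ψ : E →L[ℝ] ℝ}
    (hψ : ∀ k ∈ K, ∀ w, ψ (U k w) = ψ w) {g : G} (hg : g ∈ K) (n : ℕ) :
    ψ (b (g ^ n)) = n * ψ (b g) := by
  induction n with
  | zero => simp [H.apply_one]
  | succ n ih => rw [pow_succ, H.cocycle, map_add, hψ g hg, ih]; push_cast; ring

theorem map_limit_of_invariant (H : IsMeanConvergentCocycle U b f) {K : Subgroup G}
    {ψ : E →L[ℝ] ℝ} (hψ : ∀ k ∈ K, ∀ w, ψ (U k w) = ψ w) {g : G} (hg : g ∈ K) :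
    ψ (f g) = ψ (b g) := by
  refine tendsto_nhds_unique ((ψ.continuous.tendsto _).comp (H.tendsto g)) ?_
  refine tendsto_const_nhds.congr' ?_
  filter_upwards [eventually_ge_atTop 1] with n hn
  have : (n : ℝ) ≠ 0 := by positivity
  simp only [Function.comp, map_smul, H.map_pow_of_invariant hψ hg, smul_eq_mul]
  field_simp

/-- If the limits are invariant under a subgroup, then they are additive on it. -/
theorem limit_mul (H : IsMeanConvergentCocycle U b f) {K : Subgroup G}
    (hK : ∀ g ∈ K, ∀ k ∈ K, U k (f g) = f g) {g h : G} (hg : g ∈ K) (hh : h ∈ K) :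
    f (g * h) = f g + f h := by
  -- The defect of additivity is itself invariant, so an invariant functional computes its norm, and
  -- for that functional the defect is zero.
  obtain ⟨ψ, hψ, hn⟩ := H.exists_functional K (f (g * h) - f g - f h) (fun k hk => by
    rw [map_sub, map_sub, hK _ (K.mul_mem hg hh) k hk, hK _ hg k hk, hK _ hh k hk])
  rw [map_sub, map_sub, H.map_limit_of_invariant hψ (K.mul_mem hg hh),
    H.map_limit_of_invariant hψ hg, H.map_limit_of_invariant hψ hh, H.cocycle, map_add,
    hψ h hh] at hn
  have : f (g * h) - f g - f h = 0 := norm_eq_zero.1 (by rw [← hn]; ring)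
  rw [sub_sub, sub_eq_zero] at this
  exact this

/-- On a nilpotent subgroup, the limits of means are invariant. -/
theorem limit_invariant (H : IsMeanConvergentCocycle U b f) (c : ℕ) :
    ∀ K : Subgroup G, K.lowerCentralSeries (c + 1) = ⊥ → ∀ g ∈ K, ∀ k ∈ K, U k (f g) = f g := by
  induction c with
  | zero =>
    intro K hK g hg k hk
    rw [H.limit_conj]
    have : ⁅g, k⁆ ∈ K.lowerCentralSeries 1 := Subgroup.commutator_mem_commutator hg hk
    rw [hK, Subgroup.mem_bot, commutatorElement_eq_one_iff_mul_comm] at this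
    rw [mul_assoc, this, inv_mul_cancel_left]
  | succ c ih =>
    intro K hK γ hγ δ hδ
    set K' := Subgroup.closure (insert γ ((⁅K, K⁆ : Subgroup G) : Set G)) with hK₂def
    have hK₂ : K'.lowerCentralSeries (c + 1) = ⊥ :=
      le_bot_iff.1 ((lowerCentralSeries_closure_insert_le K hγ c).trans hK.le)
    have hinv := ih K' hK₂
    have hK₂K : K' ≤ K := by
      rw [Subgroup.closure_le]
      exact Set.insert_subset hγ (Subgroup.commutator_le_self K)
    have hDK' : ⁅K, K⁆ ≤ K' := fun x hx => Subgroup.subset_closure (Or.inr hx)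
    -- Iterated commutators of `γ` with `δ`. They stay in `K'`, where `f` is additive, so `f (s (i +
    -- 1))` is the difference of `U δ (f (s i))` and `f (s i)`; they end at `1` because `s i` lies
    -- in the `i`-th term of the lower central series.
    let s : ℕ → G := fun i => Nat.rec γ (fun _ g => g⁻¹ * (δ⁻¹ * g * δ)) i
    have hs : ∀ i, s (i + 1) = (s i)⁻¹ * (δ⁻¹ * s i * δ) := fun i => rfl
    have hcomm : ∀ g : G, g⁻¹ * (δ⁻¹ * g * δ) = ⁅g⁻¹, δ⁻¹⁆ := fun g => by
      simp only [commutatorElement_def]; group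
    have hsL : ∀ i, s i ∈ K.lowerCentralSeries i := by
      intro i
      induction i with
      | zero => exact hγ
      | succ i ihi =>
        rw [hs, hcomm]
        exact Subgroup.commutator_mem_commutator (Subgroup.inv_mem _ ihi) (K.inv_mem hδ)
    have hsK' : ∀ i, s i ∈ K' := by
      intro i
      cases i with
      | zero => exact Subgroup.subset_closure (Or.inl rfl)
      | succ i => exact hDK' (K.lowerCentralSeries_antitone (show 1 ≤ i + 1 by lia) (hsL _))
    have hrec : ∀ i, f (s (i + 1)) = U δ (f (s i)) - f (s i) := by
      intro i
      rw [H.limit_conj]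
      have h1 : s i * s (i + 1) = δ⁻¹ * s i * δ := by rw [hs]; group
      rw [← h1, H.limit_mul hinv (hsK' i) (hsK' (i + 1))]
      abel
    refine isometry_fixed_of_iterate (U δ) (c + 2) (fun i => f (s i)) hrec ?_
    have := hsL (c + 2)
    rw [hK, Subgroup.mem_bot] at this
    simp only [this, H.limit_one]

end IsMeanConvergentCocycle
end BanachCocycle

/-! ### The mean ergodic theorem in `L¹` and real cocycles of nilpotent groups -/

section MeanErgodic

theorem norm_birkhoffAverage_sub_le {E : Type*} [NormedAddCommGroup E] [NormedSpace ℝ E]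
    (U : E →ₗᵢ[ℝ] E) (n : ℕ) (v w : E) :
    ‖birkhoffAverage ℝ U id n v - birkhoffAverage ℝ U id n w‖ ≤ ‖v - w‖ := by
  have hit : ∀ k : ℕ, U^[k] v - U^[k] w = U^[k] (v - w) := fun k =>
    (iterate_map_sub U k v w).symm
  have hn : ∀ k : ℕ, ‖U^[k] (v - w)‖ = ‖v - w‖ := fun k => by
    induction k with
    | zero => rfl
    | succ k ih => rw [Function.iterate_succ_apply', U.norm_map, ih]
  rw [birkhoffAverage, birkhoffAverage, ← smul_sub, birkhoffSum, birkhoffSum,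
    ← Finset.sum_sub_distrib, norm_smul, norm_inv, Real.norm_natCast]
  have : ‖∑ k ∈ Finset.range n, (id (U^[k] v) - id (U^[k] w))‖ ≤ n * ‖v - w‖ := by
    refine (norm_sum_le_of_le _ (f := fun k => id (U^[k] v) - id (U^[k] w))
      (n := fun _ => ‖v - w‖) fun k _ => ?_).trans ?_
    · simp only [id, hit, hn, le_refl]
    · simp
  rcases Nat.eq_zero_or_pos n with rfl | hpos
  · simp
  · have hn0 : (0 : ℝ) < n := by exact_mod_cast hpos
    calc (n : ℝ)⁻¹ * ‖∑ k ∈ Finset.range n, (id (U^[k] v) - id (U^[k] w))‖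
        ≤ (n : ℝ)⁻¹ * (n * ‖v - w‖) := by gcongr
      _ = ‖v - w‖ := by field_simp

variable {X : Type*} [MeasurableSpace X] {m : Measure X} [IsProbabilityMeasure m]

/-- The mean ergodic theorem in `L¹`. -/
theorem exists_tendsto_birkhoffAverage_Lp_one {T : X → X} (hT : MeasurePreserving T m m)
    (v : Lp ℝ 1 m) :
    ∃ w, Tendsto (fun n => birkhoffAverage ℝ (Lp.compMeasurePreservingₗᵢ ℝ T hT) id n v) atTop
      (𝓝 w) := by
  set U : Lp ℝ 1 m →ₗᵢ[ℝ] Lp ℝ 1 m := Lp.compMeasurePreservingₗᵢ ℝ T hT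
  let U₂ : Lp ℝ 2 m →ₗᵢ[ℝ] Lp ℝ 2 m := Lp.compMeasurePreservingₗᵢ ℝ T hT
  -- The Hilbert space theorem is transported through the contraction `J`. Since `L²` is dense in
  -- `L¹` and the averages are contractions, the Cauchy property passes to all of `L¹`.
  have hle : Lp ℝ 2 m ≤ Lp ℝ 1 m := Lp.antitone one_le_two
  let J : Lp ℝ 2 m →+ Lp ℝ 1 m := AddSubgroup.inclusion hle
  have hJ : ∀ g, ‖J g‖ ≤ ‖g‖ := by
    intro g
    rw [Lp.norm_def, Lp.norm_def]
    refine ENNReal.toReal_mono (Lp.eLpNorm_ne_top g) ?_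
    exact eLpNorm_le_eLpNorm_of_exponent_le one_le_two (Lp.aestronglyMeasurable g)
  have hJU : ∀ g, J (U₂ g) = U (J g) := fun g => rfl
  have hJsmul : ∀ (r : ℝ) g, J (r • g) = r • J g := fun r g => rfl
  have hJA : ∀ n g, J (birkhoffAverage ℝ U₂ id n g) = birkhoffAverage ℝ U id n (J g) := by
    intro n g
    rw [birkhoffAverage, birkhoffAverage, hJsmul, birkhoffSum, birkhoffSum, map_sum]
    congr 1
    refine Finset.sum_congr rfl fun k hk => ?_
    clear hk
    change J (U₂^[k] g) = U^[k] (J g)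
    induction k with
    | zero => rfl
    | succ k ih => rw [Function.iterate_succ_apply', Function.iterate_succ_apply', hJU, ih]
  suffices CauchySeq (fun n => birkhoffAverage ℝ U id n v) from cauchySeq_tendsto_of_complete this
  rw [Metric.cauchySeq_iff]
  intro ε hε
  obtain ⟨g, hg⟩ : ∃ g : Lp ℝ 2 m, ‖v - J g‖ < ε / 3 := by
    obtain ⟨s, hs, hsm⟩ := (Lp.memLp v).exists_simpleFunc_eLpNorm_sub_lt ENNReal.one_ne_top
      (ε := ENNReal.ofReal (ε / 3)) (by simpa using by positivity)
    have h2 : MemLp s 2 m := s.memLp_of_isFiniteMeasure 2 m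
    refine ⟨h2.toLp s, ?_⟩
    have : J (h2.toLp s) = hsm.toLp s := rfl
    rw [this, ← Lp.toLp_coeFn v (Lp.memLp v), ← MemLp.toLp_sub, Lp.norm_toLp]
    exact ENNReal.toReal_lt_of_lt_ofReal hs
  have hc : CauchySeq (fun n => birkhoffAverage ℝ U₂ id n g) := by
    have := U₂.toContinuousLinearMap.tendsto_birkhoffAverage_orthogonalProjection
      U₂.norm_toContinuousLinearMap_le g
    exact this.cauchySeq
  obtain ⟨N, hN⟩ := Metric.cauchySeq_iff.1 hc (ε / 3) (by positivity)
  refine ⟨N, fun a ha b hb => ?_⟩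
  have h1 := hN a ha b hb
  rw [dist_eq_norm] at h1 ⊢
  have h2 : ‖birkhoffAverage ℝ U id a (J g) - birkhoffAverage ℝ U id b (J g)‖ < ε / 3 := by
    rw [← hJA, ← hJA, ← map_sub]
    exact (hJ _).trans_lt h1
  have h3 := norm_birkhoffAverage_sub_le U a v (J g)
  have h4 := norm_birkhoffAverage_sub_le U b (J g) v
  rw [norm_sub_rev (J g) v] at h4
  have e : birkhoffAverage ℝ U id a v - birkhoffAverage ℝ U id b v =
      (birkhoffAverage ℝ U id a v - birkhoffAverage ℝ U id a (J g)) +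
      (birkhoffAverage ℝ U id a (J g) - birkhoffAverage ℝ U id b (J g)) +
      (birkhoffAverage ℝ U id b (J g) - birkhoffAverage ℝ U id b v) := by abel
  rw [e]
  have := norm_add₃_le (a := birkhoffAverage ℝ U id a v - birkhoffAverage ℝ U id a (J g))
    (b := birkhoffAverage ℝ U id a (J g) - birkhoffAverage ℝ U id b (J g))
    (c := birkhoffAverage ℝ U id b (J g) - birkhoffAverage ℝ U id b v)
  linarith

end MeanErgodic

/-! ### Real cocycles over ergodic actions of nilpotent groups -/

section RealCocycle

variable {Γ X : Type*} [Group Γ] [MeasurableSpace X] {m : Measure X}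
  [MulAction Γ X] [MeasurableConstSMul Γ X]

/-- The action of a group on `L¹` by composition. -/
def compSMul (m : Measure X) [SMulInvariantMeasure Γ X m] (g : Γ) : Lp ℝ 1 m →ₗᵢ[ℝ] Lp ℝ 1 m :=
  Lp.compMeasurePreservingₗᵢ ℝ (g • ·) (measurePreserving_smul g m)

theorem compSMul_ae [SMulInvariantMeasure Γ X m] (g : Γ) (v : Lp ℝ 1 m) : compSMul m g v =ᵐ[m] fun x => v (g • x) :=
  Lp.coeFn_compMeasurePreserving v (measurePreserving_smul g m)

/-- An invariant vector of `L¹` is normed by an invariant functional. -/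
theorem exists_invariant_functional [SMulInvariantMeasure Γ X m] (K : Subgroup Γ) (v : Lp ℝ 1 m)
    (hv : ∀ k ∈ K, compSMul m k v = v) :
    ∃ ψ : Lp ℝ 1 m →L[ℝ] ℝ, (∀ k ∈ K, ∀ w, ψ (compSMul m k w) = ψ w) ∧ ψ v = ‖v‖ := by
  -- The functional is integration against the sign of `v`, which is invariant almost everywhere
  -- because `v` is.
  let σ : X → ℝ := fun x => if 0 ≤ v x then 1 else -1
  have hσm : Measurable σ := Measurable.ite
    (measurableSet_le measurable_const (Lp.stronglyMeasurable v).measurable)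
    measurable_const measurable_const
  have hσ1 : ∀ x, ‖σ x‖ ≤ 1 := fun x => by
    simp only [σ]; split_ifs <;> simp
  have hinteg : ∀ w : Lp ℝ 1 m, Integrable (fun x => σ x * w x) m := fun w =>
    (L1.integrable_coeFn w).bdd_mul hσm.aestronglyMeasurable (ae_of_all _ hσ1)
  let ψ₀ : Lp ℝ 1 m →ₗ[ℝ] ℝ :=
    { toFun := fun w => ∫ x, σ x * w x ∂m
      map_add' := fun w w' => by
        rw [← integral_add (hinteg w) (hinteg w')]
        refine integral_congr_ae ?_
        filter_upwards [Lp.coeFn_add w w'] with x hx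
        rw [hx, Pi.add_apply]; ring
      map_smul' := fun r w => by
        rw [RingHom.id_apply, smul_eq_mul, ← integral_const_mul]
        refine integral_congr_ae ?_
        filter_upwards [Lp.coeFn_smul r w] with x hx
        rw [hx, Pi.smul_apply, smul_eq_mul]; ring }
  refine ⟨ψ₀.mkContinuous 1 fun w => ?_, fun k hk w => ?_, ?_⟩
  · rw [one_mul, L1.norm_eq_integral_norm]
    refine (norm_integral_le_integral_norm _).trans ?_
    refine integral_mono (hinteg w).norm (L1.integrable_coeFn w).norm fun x => ?_
    rw [norm_mul]
    exact mul_le_of_le_one_left (norm_nonneg _) (hσ1 x)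
  · change ∫ x, σ x * compSMul m k w x ∂m = ∫ x, σ x * w x ∂m
    have h1 : (fun x => σ x * compSMul m k w x) =ᵐ[m] fun x => σ (k • x) * w (k • x) := by
      have h2 := compSMul_ae k v
      rw [hv k hk] at h2
      filter_upwards [h2, compSMul_ae k w] with x hx hx'
      simp only [σ, hx', hx]
    rw [integral_congr_ae h1]
    exact (measurePreserving_smul k m).integral_comp (measurableEmbedding_const_smul k)
      (fun x => σ x * w x)
  · change ∫ x, σ x * v x ∂m = ‖v‖
    rw [L1.norm_eq_integral_norm]
    refine integral_congr_ae (ae_of_all _ fun x => ?_)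
    simp only [σ, Real.norm_eq_abs]
    split_ifs with h
    · rw [abs_of_nonneg h, one_mul]
    · rw [abs_of_neg (not_le.1 h)]; ring

/-- A real integrable cocycle over an ergodic action of a nilpotent group satisfies the mean
ergodic theorem along every cyclic subgroup, with constant limit. -/
theorem tendsto_integral_mean_cocycle [IsProbabilityMeasure m] [Group.IsNilpotent Γ]
    [ErgodicSMul Γ X m] (b : Γ → X → ℝ)
    (hinteg : ∀ g, Integrable (b g) m)
    (hcoc : ∀ g h, ∀ᵐ x ∂m, b (g * h) x = b g (h • x) + b h x) (γ : Γ) :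
    Tendsto (fun n : ℕ => ∫ x, |(n : ℝ)⁻¹ * b (γ ^ n) x - ∫ y, b γ y ∂m| ∂m) atTop (𝓝 0) := by
  let B : Γ → Lp ℝ 1 m := fun g => (memLp_one_iff_integrable.2 (hinteg g)).toLp (b g)
  have hB : ∀ g, B g =ᵐ[m] b g := fun g => MemLp.coeFn_toLp _
  have hBc : ∀ g h, B (g * h) = compSMul m h (B g) + B h := by
    intro g h
    refine Lp.ext ?_
    have h1 : (fun x => B g (h • x)) =ᵐ[m] fun x => b g (h • x) :=
      (measurePreserving_smul h m).quasiMeasurePreserving.ae_eq_comp (hB g)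
    filter_upwards [hB (g * h), Lp.coeFn_add (compSMul m h (B g)) (B h), hB h, h1, hcoc g h,
      compSMul_ae h (B g)] with x h2 h3 h4 h5 h6 h7
    rw [h2, h3, Pi.add_apply, h4, h7, h5, h6]
  have hB1 : B 1 = 0 := by
    have h := hBc 1 1
    rw [mul_one, right_eq_add] at h
    rwa [← norm_eq_zero, LinearIsometry.norm_map, norm_eq_zero] at h
  have hpow : ∀ g (n : ℕ), B (g ^ n) = birkhoffSum (compSMul m g) id n (B g) := by
    intro g n
    induction n with
    | zero => simp [hB1]
    | succ n ih =>
      rw [birkhoffSum_succ', pow_succ, hBc, add_comm, ih]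
      congr 1
      simp only [birkhoffSum, map_sum, id]
      refine Finset.sum_congr rfl fun k _ => ?_
      exact (Function.iterate_succ_apply' (compSMul m g) k (B g)).symm.trans
        (Function.iterate_succ_apply (compSMul m g) k (B g))
  have hlim : ∀ g, ∃ w, Tendsto (fun n : ℕ => (n : ℝ)⁻¹ • B (g ^ n)) atTop (𝓝 w) := by
    intro g
    obtain ⟨w, hw⟩ := exists_tendsto_birkhoffAverage_Lp_one (measurePreserving_smul g m) (B g)
    refine ⟨w, hw.congr fun n => ?_⟩
    rw [hpow]; rfl
  choose f hf using hlim
  have H : IsMeanConvergentCocycle (compSMul (Γ := Γ) m) B f :=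
    ⟨hBc, hf, exists_invariant_functional⟩
  obtain ⟨c, hc⟩ := Subgroup.isNilpotent_iff_lowerCentralSeries (S := (⊤ : Subgroup Γ)).1
    inferInstance
  have hc' : (⊤ : Subgroup Γ).lowerCentralSeries (c + 1) = ⊥ :=
    le_bot_iff.1 ((Subgroup.lowerCentralSeries_antitone _ (Nat.le_succ c)).trans hc.le)
  have hinv : ∀ k, compSMul m k (f γ) = f γ := fun k =>
    H.limit_invariant c ⊤ hc' γ (Subgroup.mem_top _) k (Subgroup.mem_top _)
  -- By ergodicity every measurable preimage under the invariant function `f γ` is null or conull,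
  -- which forces `f γ` to be constant.
  obtain ⟨r, hr⟩ : ∃ r : ℝ, f γ =ᵐ[m] fun _ => r := by
    refine exists_eventuallyEq_const_of_forall_separating MeasurableSet fun V hV => ?_
    refine eventuallyConst_set.1 (aeconst_of_forall_preimage_smul_ae_eq Γ (s := f γ ⁻¹' V)
      ((Lp.stronglyMeasurable (f γ)).measurable hV).nullMeasurableSet fun k => ?_)
    have h1 := compSMul_ae k (f γ)
    rw [hinv k] at h1
    refine (h1.mono fun x hx => ?_).set_eq
    simp only [Set.mem_preimage, hx]
  have hB' : ∀ n : ℕ, ∫ x, b (γ ^ n) x ∂m = n * ∫ x, b γ x ∂m := by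
    intro n
    induction n with
    | zero =>
      rw [Nat.cast_zero, zero_mul, pow_zero, ← integral_congr_ae (hB 1), hB1,
        integral_congr_ae (Lp.coeFn_zero ℝ 1 m)]
      simp
    | succ n ih =>
      rw [pow_succ, integral_congr_ae (hcoc (γ ^ n) γ), integral_add _ (hinteg γ),
        (measurePreserving_smul γ m).integral_comp (measurableEmbedding_const_smul γ), ih]
      · push_cast; ring
      · exact (measurePreserving_smul γ m).integrable_comp_of_integrable (hinteg _)
  have hnorm : Tendsto (fun n : ℕ => ∫ x, |(n : ℝ)⁻¹ * b (γ ^ n) x - r| ∂m) atTop (𝓝 0) := by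
    have h1 := tendsto_iff_norm_sub_tendsto_zero.1 (hf γ)
    refine h1.congr fun n => ?_
    rw [L1.norm_eq_integral_norm]
    refine integral_congr_ae ?_
    filter_upwards [hr, Lp.coeFn_sub ((n : ℝ)⁻¹ • B (γ ^ n)) (f γ),
      Lp.coeFn_smul (n : ℝ)⁻¹ (B (γ ^ n)), hB (γ ^ n)] with x h1 h2 h3 h4
    rw [h2, Pi.sub_apply, h3, Pi.smul_apply, h1, h4, smul_eq_mul, Real.norm_eq_abs]
  -- The integral of `b (γ ^ n)` is `n` times that of `b γ`, so `L¹` convergence identifies the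
  -- constant as the mean.
  have hr' : r = ∫ y, b γ y ∂m := by
    have h2 : ∀ᶠ n : ℕ in atTop, |(∫ y, b γ y ∂m) - r| ≤
        ∫ x, |(n : ℝ)⁻¹ * b (γ ^ n) x - r| ∂m := by
      filter_upwards [eventually_ge_atTop 1] with n hn
      have hn0 : (n : ℝ) ≠ 0 := by positivity
      have : (∫ y, b γ y ∂m) - r = ∫ x, ((n : ℝ)⁻¹ * b (γ ^ n) x - r) ∂m := by
        rw [integral_sub ((hinteg _).const_mul _) (integrable_const r), integral_const_mul, hB']
        simp [hn0]
      rw [this]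
      exact abs_integral_le_integral_abs
    have h3 := ge_of_tendsto hnorm h2
    have h4 := abs_eq_zero.1 (le_antisymm h3 (abs_nonneg _))
    linarith
  rw [← hr']
  exact hnorm

end RealCocycle

/-! ### The Baker-Campbell-Hausdorff product of a nilpotent bracket -/

section Bch

variable {V : Type*} [AddCommGroup V] [Module ℝ V]

/-- The word `x^r₁ y^s₁ ⋯ x^rₖ y^sₖ`. -/
def bchWord {V : Type*} {k : ℕ} (p : Fin k → ℕ × ℕ) (x y : V) : List V :=
  (List.ofFn fun i => List.replicate (p i).1 x ++ List.replicate (p i).2 y).flatten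

/-- The coefficient of the word `x^r₁ y^s₁ ⋯ x^rₖ y^sₖ` in Dynkin's series. -/
def bchCoeff {k : ℕ} (p : Fin k → ℕ × ℕ) : ℝ :=
  (-1 : ℝ) ^ (k - 1) / k *
    (1 / (((∑ i, ((p i).1 + (p i).2) : ℕ) : ℝ) *
      ((∏ i, ((p i).1.factorial * (p i).2.factorial) : ℕ) : ℝ)))

/-- The index set of Dynkin's series. -/
def bchIndex (c k : ℕ) : Finset (Fin k → ℕ × ℕ) :=
  Fintype.piFinset fun _ : Fin k => (Finset.range (c + 1) ×ˢ Finset.range (c + 1)).erase (0, 0)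

theorem bch_def (c : ℕ) (br : V → V → V) (x y : V) :
    bch c br x y = ∑ k ∈ Finset.Icc 1 c, ∑ p ∈ bchIndex c k,
      bchCoeff p • nestedBracket br (bchWord p x y) := rfl

theorem length_bchWord {V : Type*} {k : ℕ} (p : Fin k → ℕ × ℕ) (x y : V) :
    (bchWord p x y).length = ∑ i, ((p i).1 + (p i).2) := by
  simp [bchWord, List.length_flatten, List.map_ofFn, List.sum_ofFn, Function.comp_def]

theorem mem_bchWord {V : Type*} {k : ℕ} {p : Fin k → ℕ × ℕ} {x y v : V}
    (h : v ∈ bchWord p x y) : v = x ∨ v = y := by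
  simp only [bchWord, List.mem_flatten, List.mem_ofFn] at h
  obtain ⟨l, ⟨i, rfl⟩, h⟩ := h
  rw [List.mem_append, List.mem_replicate, List.mem_replicate] at h
  exact h.imp And.right And.right

theorem map_bchWord {V W : Type*} {k : ℕ} (φ : V → W) (p : Fin k → ℕ × ℕ) (x y : V) :
    (bchWord p x y).map φ = bchWord p (φ x) (φ y) := by
  simp [bchWord, List.map_flatten, List.map_ofFn, Function.comp_def]

theorem nestedBracket_map {V W : Type*} [Zero V] [Zero W] {br : V → V → V} {br' : W → W → W}
    {φ : V → W} (h0 : φ 0 = 0) (hφ : ∀ v w, φ (br v w) = br' (φ v) (φ w)) (l : List V) :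
    nestedBracket br' (l.map φ) = φ (nestedBracket br l) := by
  induction l with
  | nil => exact h0.symm
  | cons v l ih =>
    cases l with
    | nil => rfl
    | cons w l =>
      rw [List.map_cons] at ih
      rw [List.map_cons, List.map_cons, nestedBracket, nestedBracket, ih, hφ]

/-- Linear maps that respect the brackets respect the products. -/
theorem bch_map {W : Type*} [AddCommGroup W] [Module ℝ W] (c : ℕ) {br : V → V → V}
    {br' : W → W → W} (φ : V →ₗ[ℝ] W) (hφ : ∀ v w, φ (br v w) = br' (φ v) (φ w)) (x y : V) :
    bch c br' (φ x) (φ y) = φ (bch c br x y) := by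
  simp only [bch_def, map_sum, map_smul, ← map_bchWord, nestedBracket_map (map_zero φ) hφ]

theorem two_le_sum_of_mem_bchIndex {c k : ℕ} {p : Fin k → ℕ × ℕ} (hp : p ∈ bchIndex c k) :
    k ≤ ∑ i, ((p i).1 + (p i).2) := by
  have : ∑ _i : Fin k, 1 ≤ ∑ i, ((p i).1 + (p i).2) := by
    refine Finset.sum_le_sum fun i _ => ?_
    have := Fintype.mem_piFinset.1 hp i
    rw [Finset.mem_erase, Ne, Prod.ext_iff] at this
    simp only [not_and] at this
    by_contra hlt
    exact this.1 (by lia) (by lia)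
  simpa using this

/-- The part of Dynkin's series that consists of words of at least `d` letters. -/
def bchTail (c d : ℕ) (br : V → V → V) (x y : V) : V :=
  ∑ k ∈ Finset.Icc 1 c, ∑ p ∈ bchIndex c k with d ≤ ∑ i, ((p i).1 + (p i).2),
      bchCoeff p • nestedBracket br (bchWord p x y)

/-- The part of Dynkin's series that consists of words of `d` letters. -/
def bchPart (c d : ℕ) (br : V → V → V) (x y : V) : V :=
  ∑ k ∈ Finset.Icc 1 c, ∑ p ∈ bchIndex c k with ∑ i, ((p i).1 + (p i).2) = d,
      bchCoeff p • nestedBracket br (bchWord p x y)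

theorem bchTail_eq (c d : ℕ) (br : V → V → V) (x y : V) :
    bchTail c d br x y = bchPart c d br x y + bchTail c (d + 1) br x y := by
  rw [bchTail, bchPart, bchTail, ← Finset.sum_add_distrib]
  refine Finset.sum_congr rfl fun k _ => ?_
  rw [← Finset.sum_union]
  · refine Finset.sum_congr ?_ fun _ _ => rfl
    ext p
    simp only [Finset.mem_filter, Finset.mem_union, ← and_or_left]
    refine and_congr_right fun _ => ?_
    lia
  · rw [Finset.disjoint_filter]
    intro p _ h1 h2
    lia

theorem bch_eq_bchTail (c : ℕ) (br : V → V → V) (x y : V) :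
    bch c br x y = bchTail c 1 br x y := by
  rw [bch_def, bchTail]
  refine Finset.sum_congr rfl fun k hk => Finset.sum_congr ?_ fun _ _ => rfl
  rw [Finset.filter_true_of_mem]
  intro p hp
  exact (Finset.mem_Icc.1 hk).1.trans (two_le_sum_of_mem_bchIndex hp)

theorem filter_bchIndex_eq_empty {c k d : ℕ} (h : d < k) :
    ((bchIndex c k).filter fun p => ∑ i, ((p i).1 + (p i).2) = d) = ∅ := by
  rw [Finset.filter_eq_empty_iff]
  intro p hp
  have := two_le_sum_of_mem_bchIndex hp
  lia

theorem bchPart_one {c : ℕ} (hc : 1 ≤ c) (br : V → V → V) (x y : V) :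
    bchPart c 1 br x y = x + y := by
  have h1 : ((bchIndex c 1).filter fun p => ∑ i, ((p i).1 + (p i).2) = 1) =
      {![(1, 0)], ![(0, 1)]} := by
    ext p
    obtain ⟨q, rfl⟩ : ∃ q, p = ![q] := ⟨p 0, by ext i <;> fin_cases i <;> rfl⟩
    obtain ⟨r, s⟩ := q
    simp [bchIndex, Fintype.mem_piFinset]
    lia
  rw [bchPart, Finset.sum_eq_single_of_mem 1 (by simpa using hc), h1, Finset.sum_pair]
  · simp [bchCoeff, bchWord, nestedBracket]
  · intro h
    simpa using congrFun h 0
  · intro k hk hk1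
    rw [filter_bchIndex_eq_empty, Finset.sum_empty]
    have := (Finset.mem_Icc.1 hk).1
    lia

/-- The word `xy` has coefficient `1/2` for `k = 1`. For `k = 2` the words `xy` and `yx` share the
coefficient `-1/4` and cancel by antisymmetry. -/
theorem bchPart_two {c : ℕ} (hc : 2 ≤ c) {br : V → V → V} (h0 : ∀ v, br v v = 0)
    (hs : ∀ v w, br w v = - br v w) (x y : V) :
    bchPart c 2 br x y = (1 / 2 : ℝ) • br x y := by
  have h1 : ((bchIndex c 1).filter fun p => ∑ i, ((p i).1 + (p i).2) = 2) =
      {![(2, 0)], ![(1, 1)], ![(0, 2)]} := by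
    ext p
    obtain ⟨q, rfl⟩ : ∃ q, p = ![q] := ⟨p 0, by ext i <;> fin_cases i <;> rfl⟩
    obtain ⟨r, s⟩ := q
    simp [bchIndex, Fintype.mem_piFinset]
    lia
  have h2 : ((bchIndex c 2).filter fun p => ∑ i, ((p i).1 + (p i).2) = 2) =
      {![(1, 0), (1, 0)], ![(1, 0), (0, 1)], ![(0, 1), (1, 0)], ![(0, 1), (0, 1)]} := by
    ext p
    obtain ⟨q, q', rfl⟩ : ∃ q q', p = ![q, q'] :=
      ⟨p 0, p 1, by ext i <;> fin_cases i <;> rfl⟩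
    obtain ⟨r, s⟩ := q
    obtain ⟨r', s'⟩ := q'
    simp [bchIndex, Fintype.mem_piFinset]
    omega
  have h3 : bchPart c 2 br x y = ∑ k ∈ ({1, 2} : Finset ℕ),
      ∑ p ∈ bchIndex c k with ∑ i, ((p i).1 + (p i).2) = 2,
      bchCoeff p • nestedBracket br (bchWord p x y) := by
    rw [bchPart]
    refine (Finset.sum_subset (fun k hk => ?_) fun k _ hk => ?_).symm
    · simp only [Finset.mem_insert, Finset.mem_singleton] at hk
      rw [Finset.mem_Icc]
      lia
    · rw [filter_bchIndex_eq_empty, Finset.sum_empty]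
      simp only [Finset.mem_insert, Finset.mem_singleton] at hk
      rename_i hk'
      rw [Finset.mem_Icc] at hk'
      lia
  rw [h3, Finset.sum_pair (by decide), h1, h2]
  repeat rw [Finset.sum_insert (by decide)]
  rw [Finset.sum_singleton, Finset.sum_singleton]
  simp [bchCoeff, bchWord, nestedBracket, h0, hs x y]

/-- A bracket that is nilpotent through a filtration. -/
structure IsNilpotentBracket (c : ℕ) (F : ℕ → Submodule ℝ V) (B : V →ₗ[ℝ] V →ₗ[ℝ] V) : Prop where
  zero : F 0 = ⊤
  bot : F c = ⊥
  antitone : Antitone F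
  self : ∀ v, B v v = 0
  -- `F i` plays the role of `𝔥ⁱ⁺¹`, whence the shift by one. The Jacobi identity is not required,
  -- so it need not be checked for the rescaled brackets.
  mem : ∀ {a b v w}, v ∈ F a → w ∈ F b → B v w ∈ F (a + b + 1)

namespace IsNilpotentBracket

variable {c : ℕ} {F : ℕ → Submodule ℝ V} {B : V →ₗ[ℝ] V →ₗ[ℝ] V}

theorem mem_zero (H : IsNilpotentBracket c F B) (v : V) : v ∈ F 0 := by
  rw [H.zero]; trivial

theorem eq_zero (H : IsNilpotentBracket c F B) {i : ℕ} (hi : c ≤ i) {v : V} (hv : v ∈ F i) :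
    v = 0 := by
  have := H.antitone hi hv
  rwa [H.bot, Submodule.mem_bot] at this

theorem neg (H : IsNilpotentBracket c F B) (v w : V) : B w v = - B v w := by
  have h := H.self (v + w)
  simp only [map_add, LinearMap.add_apply, H.self, zero_add, add_zero] at h
  rw [eq_neg_iff_add_eq_zero]
  exact h

/-- Each bracket raises the degree by one, and the letter in `F i` contributes a further `i`. -/
theorem nestedBracket_mem (H : IsNilpotentBracket c F B) {i : ℕ} (l : List V)
    (hl : ∃ v ∈ l, v ∈ F i) : nestedBracket (fun v w => B v w) l ∈ F (l.length - 1 + i) := by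
  induction l generalizing i with
  | nil => simp at hl
  | cons v l ih =>
    cases l with
    | nil => simpa [nestedBracket] using hl
    | cons w l =>
      have e : (v :: w :: l).length - 1 + i = (w :: l).length - 1 + i + 1 := by
        simp only [List.length_cons]; lia
      rw [nestedBracket, e]
      obtain ⟨u, hu, hui⟩ := hl
      rcases List.mem_cons.1 hu with rfl | hu
      · have h1 := H.mem hui (ih ⟨w, List.mem_cons_self, H.mem_zero w⟩)
        convert h1 using 2
        lia
      · have h1 := H.mem (H.mem_zero v) (ih ⟨u, hu, hui⟩)
        convert h1 using 2
        lia

/-- By bilinearity the letters can be exchanged one at a time, each exchange leaving a nested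
bracket with one letter in `F i`. -/
theorem nestedBracket_sub_mem (H : IsNilpotentBracket c F B) {i : ℕ} {l l' : List V}
    (hl : List.Forall₂ (fun v w => v - w ∈ F i) l l') :
    nestedBracket (fun v w => B v w) l - nestedBracket (fun v w => B v w) l' ∈
      F (l.length - 1 + i) := by
  induction hl with
  | nil => simp
  | @cons v v' l l' hv hl ih =>
    cases hl with
    | nil => simpa [nestedBracket] using hv
    | @cons w w' l l' hw hl =>
      have e : (v :: w :: l).length - 1 + i = (w :: l).length - 1 + i + 1 := by
        simp only [List.length_cons]; lia
      rw [nestedBracket, nestedBracket, e]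
      have h1 : ∀ P Q : V, B v P - B v' Q = B (v - v') P + B v' (P - Q) := fun P Q => by
        simp only [map_sub, LinearMap.sub_apply]; abel
      rw [h1]
      refine Submodule.add_mem _ ?_ ?_
      · have h2 := H.mem hv (H.nestedBracket_mem (i := 0) (w :: l)
          ⟨w, List.mem_cons_self, H.mem_zero w⟩)
        convert h2 using 2
        lia
      · have h2 := H.mem (H.mem_zero v') ih
        convert h2 using 2
        lia

/-- The innermost bracket is between two parallel vectors. -/
theorem nestedBracket_eq_zero (H : IsNilpotentBracket c F B) (x : V) (l : List V)
    (h2 : 2 ≤ l.length) (hl : ∀ v ∈ l, ∃ r : ℝ, v = r • x) :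
    nestedBracket (fun v w => B v w) l = 0 := by
  induction l with
  | nil => simp at h2
  | cons v l ih =>
    match l with
    | [] => simp at h2
    | [w] =>
      obtain ⟨r, rfl⟩ := hl v (by simp)
      obtain ⟨s, rfl⟩ := hl w (by simp)
      simp [nestedBracket, H.self]
    | w :: u :: l =>
      rw [nestedBracket, ih (by simp) fun v hv => hl v (List.mem_cons_of_mem _ hv), map_zero]

theorem bch_eq_add_bchTail (H : IsNilpotentBracket c F B) (x y : V) :
    bch c (fun v w => B v w) x y = x + y + bchTail c 2 (fun v w => B v w) x y := by
  rcases Nat.eq_zero_or_pos c with rfl | hc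
  -- For `c = 0` the series is empty, but then `V` is trivial.
  · have h : ∀ v : V, v = 0 := fun v => H.eq_zero le_rfl (H.mem_zero v)
    rw [h (x + y + _), h (bch _ _ _ _)]
  · rw [bch_eq_bchTail, bchTail_eq, bchPart_one hc]

theorem bch_smul_smul (H : IsNilpotentBracket c F B) (s t : ℝ) (x : V) :
    bch c (fun v w => B v w) (s • x) (t • x) = (s + t) • x := by
  rw [H.bch_eq_add_bchTail, bchTail, Finset.sum_eq_zero, add_zero, add_smul]
  intro k _
  refine Finset.sum_eq_zero fun p hp => ?_
  rw [H.nestedBracket_eq_zero x, smul_zero]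
  · rw [length_bchWord]
    exact (Finset.mem_filter.1 hp).2
  · intro v hv
    rcases mem_bchWord hv with rfl | rfl
    exacts [⟨s, rfl⟩, ⟨t, rfl⟩]

theorem bch_zero_left (H : IsNilpotentBracket c F B) (y : V) :
    bch c (fun v w => B v w) 0 y = y := by
  simpa using H.bch_smul_smul 0 1 y

theorem bch_zero_right (H : IsNilpotentBracket c F B) (x : V) :
    bch c (fun v w => B v w) x 0 = x := by
  simpa using H.bch_smul_smul 1 0 x

theorem bch_neg_left (H : IsNilpotentBracket c F B) (x : V) :
    bch c (fun v w => B v w) (-x) x = 0 := by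
  simpa using H.bch_smul_smul (-1) 1 x

theorem bch_neg_right (H : IsNilpotentBracket c F B) (x : V) :
    bch c (fun v w => B v w) x (-x) = 0 := by
  simpa using H.bch_smul_smul 1 (-1) x

/-- Words of at least two letters carry a bracket, so a perturbation in `F i` is felt only one
degree deeper. This is what lets a product be solved for a factor degree by degree. -/
theorem bchTail_sub_mem (H : IsNilpotentBracket c F B) {i : ℕ} {x x' y y' : V}
    (hx : x - x' ∈ F i) (hy : y - y' ∈ F i) :
    bchTail c 2 (fun v w => B v w) x y - bchTail c 2 (fun v w => B v w) x' y' ∈ F (i + 1) := by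
  simp only [bchTail, ← Finset.sum_sub_distrib, ← smul_sub]
  refine Submodule.sum_mem _ fun k _ => Submodule.sum_mem _ fun p hp => Submodule.smul_mem _ _ ?_
  have h1 : List.Forall₂ (fun v w => v - w ∈ F i) (bchWord p x y) (bchWord p x' y') := by
    have h2 : bchWord p x y = (bchWord p true false).map fun t => if t then x else y := by
      rw [map_bchWord]; simp
    have h3 : bchWord p x' y' = (bchWord p true false).map fun t => if t then x' else y' := by
      rw [map_bchWord]; simp
    rw [h2, h3, List.forall₂_map_left_iff, List.forall₂_map_right_iff, List.forall₂_same]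
    intro t _
    cases t
    · simpa using hy
    · simpa using hx
  have h4 := H.nestedBracket_sub_mem h1
  refine H.antitone ?_ h4
  rw [length_bchWord]
  have := (Finset.mem_filter.1 hp).2
  lia

/-- A word without a letter in `F i` repeats the other factor only, and its bracket vanishes. Any
other word has such a letter and at least `d` brackets. -/
theorem bchTail_mem (H : IsNilpotentBracket c F B) {d i : ℕ} (hd : 1 ≤ d) {x y : V}
    (h : x ∈ F i ∨ y ∈ F i) :
    bchTail c (d + 1) (fun v w => B v w) x y ∈ F (i + d) := by
  refine Submodule.sum_mem _ fun k _ => Submodule.sum_mem _ fun p hp => Submodule.smul_mem _ _ ?_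
  have hlen := (Finset.mem_filter.1 hp).2
  rw [← length_bchWord p x y] at hlen
  by_cases hex : ∃ v ∈ bchWord p x y, v ∈ F i
  · exact H.antitone (by lia) (H.nestedBracket_mem _ hex)
  · push Not at hex
    have hpar : ∃ u, ∀ v ∈ bchWord p x y, v = u := by
      rcases h with h | h
      · exact ⟨y, fun v hv => (mem_bchWord hv).resolve_left fun e => hex v hv (e ▸ h)⟩
      · exact ⟨x, fun v hv => (mem_bchWord hv).resolve_right fun e => hex v hv (e ▸ h)⟩
    obtain ⟨u, hu⟩ := hpar
    rw [H.nestedBracket_eq_zero u (bchWord p x y) (by lia)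
      fun v hv => ⟨1, by rw [one_smul, hu v hv]⟩]
    exact Submodule.zero_mem _

theorem bch_sub_mem (H : IsNilpotentBracket c F B) {i : ℕ} {x y : V} (h : x ∈ F i ∨ y ∈ F i) :
    bch c (fun v w => B v w) x y - (x + y) ∈ F (i + 1) := by
  rw [H.bch_eq_add_bchTail, add_sub_cancel_left]
  exact H.bchTail_mem le_rfl h

theorem bch_sub_half_mem (H : IsNilpotentBracket c F B) {i : ℕ} {x y : V}
    (h : x ∈ F i ∨ y ∈ F i) :
    bch c (fun v w => B v w) x y - (x + y + (1 / 2 : ℝ) • B x y) ∈ F (i + 2) := by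
  rcases lt_or_ge c 2 with hc | hc
  · have h1 : ∀ v ∈ F 1, v = 0 := fun v hv => H.eq_zero (by lia) hv
    rw [H.bch_eq_add_bchTail, h1 (B x y) (H.mem (H.mem_zero x) (H.mem_zero y)),
      h1 (bchTail _ _ _ _ _) (H.bchTail_mem (i := 0) le_rfl (Or.inl (H.mem_zero x)))]
    simp
  · rw [H.bch_eq_add_bchTail, bchTail_eq, bchPart_two hc H.self H.neg]
    have := H.bchTail_mem one_le_two h
    convert this using 1
    abel

end IsNilpotentBracket

end Bch

/-! ### Splittings, dilations and rescaled brackets -/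

section Splitting

variable {𝔥 : Type*} [LieRing 𝔥] [LieAlgebra ℝ 𝔥]

/-- The bracket of a Lie algebra as a bilinear map. -/
def lieBilin (𝔥 : Type*) [LieRing 𝔥] [LieAlgebra ℝ 𝔥] : 𝔥 →ₗ[ℝ] 𝔥 →ₗ[ℝ] 𝔥 :=
  LinearMap.mk₂ ℝ (fun v w => ⁅v, w⁆) (fun _ _ _ => add_lie _ _ _) (fun _ _ _ => smul_lie _ _ _)
    (fun _ _ _ => lie_add _ _ _) (fun _ _ _ => lie_smul _ _ _)

@[simp]
theorem lieBilin_apply (v w : 𝔥) : lieBilin 𝔥 v w = ⁅v, w⁆ := rfl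

/-- The lower central series as a filtration by subspaces. -/
def lcsFiltration (𝔥 : Type*) [LieRing 𝔥] [LieAlgebra ℝ 𝔥] (i : ℕ) : Submodule ℝ 𝔥 :=
  (LieModule.lowerCentralSeries ℝ 𝔥 𝔥 i).toSubmodule

/-- Induction on `a`: the left entry is a combination of brackets, over which the Jacobi identity
distributes the bracket with `w`. -/
theorem lie_mem_lcsFiltration {a b : ℕ} {v w : 𝔥} (hv : v ∈ lcsFiltration 𝔥 a)
    (hw : w ∈ lcsFiltration 𝔥 b) : ⁅v, w⁆ ∈ lcsFiltration 𝔥 (a + b + 1) := by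
  have h0 : ∀ (x : 𝔥) {k : ℕ} {y : 𝔥}, y ∈ lcsFiltration 𝔥 k → ⁅x, y⁆ ∈ lcsFiltration 𝔥 (k + 1) := by
    intro x k y hy
    change ⁅x, y⁆ ∈ LieModule.lowerCentralSeries ℝ 𝔥 𝔥 (k + 1)
    rw [LieModule.lowerCentralSeries_succ]
    exact LieSubmodule.lie_mem_lie (LieSubmodule.mem_top x) hy
  induction a generalizing b v w with
  | zero => rw [zero_add]; exact h0 v hw
  | succ a ih =>
    have hv' : v ∈ (LieModule.lowerCentralSeries ℝ 𝔥 𝔥 (a + 1)).toSubmodule := hv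
    rw [LieModule.lowerCentralSeries_succ, LieSubmodule.lieIdeal_oper_eq_linear_span'] at hv'
    induction hv' using Submodule.span_induction with
    | mem v hv' =>
      obtain ⟨x, _, y, hy, rfl⟩ := hv'
      rw [lie_lie]
      have h1 := h0 x (ih hy hw)
      have h2 := ih hy (h0 x hw)
      have e1 : a + b + 1 + 1 = a + 1 + b + 1 := by lia
      have e2 : a + (b + 1) + 1 = a + 1 + b + 1 := by lia
      rw [e1] at h1
      rw [e2] at h2
      exact Submodule.sub_mem _ h1 h2
    | zero => rw [zero_lie]; exact Submodule.zero_mem _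
    | add v v' h1 h2 ih1 ih2 =>
      rw [add_lie]
      refine Submodule.add_mem _ (ih1 ?_) (ih2 ?_)
      all_goals
        change _ ∈ (LieModule.lowerCentralSeries ℝ 𝔥 𝔥 (a + 1)).toSubmodule
        rw [LieModule.lowerCentralSeries_succ, LieSubmodule.lieIdeal_oper_eq_linear_span']
        assumption
    | smul r v h1 ih1 =>
      rw [smul_lie]
      refine Submodule.smul_mem _ _ (ih1 ?_)
      change _ ∈ (LieModule.lowerCentralSeries ℝ 𝔥 𝔥 (a + 1)).toSubmodule
      rw [LieModule.lowerCentralSeries_succ, LieSubmodule.lieIdeal_oper_eq_linear_span']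
      assumption

theorem lcsFiltration_zero : lcsFiltration 𝔥 0 = ⊤ := by
  simp [lcsFiltration]

theorem lcsFiltration_antitone : Antitone (lcsFiltration 𝔥) := fun _ _ h =>
  LieModule.antitone_lowerCentralSeries ℝ 𝔥 𝔥 h

theorem lcsFiltration_step [LieRing.IsNilpotent 𝔥] : lcsFiltration 𝔥 (step 𝔥) = ⊥ := by
  rcases h : step 𝔥 with _ | k
  · have : Subsingleton 𝔥 := (LieModule.nilpotencyLength_eq_zero_iff 𝔥 𝔥).1 h
    exact Subsingleton.elim _ _
  · have := ((LieModule.nilpotencyLength_eq_succ_iff ℝ 𝔥 𝔥 k).1 h).1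
    simp only [lcsFiltration, this, LieSubmodule.bot_toSubmodule]

theorem isNilpotentBracket_lieBilin [LieRing.IsNilpotent 𝔥] :
    IsNilpotentBracket (step 𝔥) (lcsFiltration 𝔥) (lieBilin 𝔥) where
  zero := lcsFiltration_zero
  bot := lcsFiltration_step
  antitone := lcsFiltration_antitone
  self := lie_self
  mem := lie_mem_lcsFiltration

namespace Splitting

variable (S : Splitting 𝔥)

theorem proj_mem (i : ℕ) (v : 𝔥) : S.proj i v ∈ S.V i := by
  simp [proj]

theorem symm_of_mem {i : ℕ} {v : 𝔥} (hv : v ∈ S.V i) :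
    (LinearEquiv.ofBijective (DirectSum.coeLinearMap S.V) S.isInternal).symm v =
      DirectSum.lof ℝ ℕ (fun j => S.V j) i ⟨v, hv⟩ := by
  rw [LinearEquiv.symm_apply_eq]
  exact (DirectSum.coeLinearMap_lof S.V i ⟨v, hv⟩).symm

theorem proj_of_mem {i : ℕ} {v : 𝔥} (hv : v ∈ S.V i) : S.proj i v = v := by
  rw [proj, LinearMap.comp_apply, LinearMap.comp_apply, LinearEquiv.coe_coe, S.symm_of_mem hv,
    DirectSum.component.lof_self]
  rfl

theorem proj_of_mem_of_ne {i j : ℕ} (hij : i ≠ j) {v : 𝔥} (hv : v ∈ S.V i) : S.proj j v = 0 := by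
  rw [proj, LinearMap.comp_apply, LinearMap.comp_apply, LinearEquiv.coe_coe, S.symm_of_mem hv,
    DirectSum.component.of, dif_neg hij, map_zero]

theorem proj_proj (i j : ℕ) (v : 𝔥) : S.proj j (S.proj i v) = if i = j then S.proj i v else 0 := by
  split_ifs with h
  · subst h
    exact S.proj_of_mem (S.proj_mem i v)
  · exact S.proj_of_mem_of_ne h (S.proj_mem i v)

theorem lcsFiltration_eq (i : ℕ) : lcsFiltration 𝔥 i = ⨆ j, ⨆ _ : i ≤ j, S.V j :=
  S.lowerCentralSeries_eq i

theorem V_le {i j : ℕ} (h : i ≤ j) : S.V j ≤ lcsFiltration 𝔥 i := by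
  rw [S.lcsFiltration_eq]
  exact le_iSup₂_of_le j h le_rfl

theorem proj_mem_lcsFiltration {i j : ℕ} (h : i ≤ j) (v : 𝔥) :
    S.proj j v ∈ lcsFiltration 𝔥 i := S.V_le h (S.proj_mem j v)

theorem proj_eq_zero_of_lt {i j : ℕ} (h : j < i) {v : 𝔥} (hv : v ∈ lcsFiltration 𝔥 i) :
    S.proj j v = 0 := by
  rw [S.lcsFiltration_eq] at hv
  have : ⨆ k, ⨆ _ : i ≤ k, S.V k ≤ LinearMap.ker (S.proj j) :=
    iSup₂_le fun k hk w hw => S.proj_of_mem_of_ne (by lia) hw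
  exact this hv

/-- The dilation as a linear map. -/
def dilLin (t : ℝ) : 𝔥 →ₗ[ℝ] 𝔥 := ∑ i ∈ Finset.range (step 𝔥), t ^ (i + 1) • S.proj i

theorem dilLin_apply (t : ℝ) (v : 𝔥) : S.dilLin t v = S.dil t v := by
  simp [dilLin, dil]

/-- The bracket `δ_s [δ_{1/s} v, δ_{1/s} w]`, which is a polynomial in `s`. -/
def scaledBracket (s : ℝ) : 𝔥 →ₗ[ℝ] 𝔥 →ₗ[ℝ] 𝔥 :=
  ∑ i ∈ Finset.range (step 𝔥), ∑ j ∈ Finset.range (step 𝔥),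
    ∑ k ∈ Finset.range (step 𝔥) with i + j + 1 ≤ k, s ^ (k - (i + j + 1)) •
      ((lieBilin 𝔥).compl₁₂ (S.proj i) (S.proj j)).compr₂ (S.proj k)

theorem scaledBracket_apply (s : ℝ) (v w : 𝔥) : S.scaledBracket s v w =
    ∑ i ∈ Finset.range (step 𝔥), ∑ j ∈ Finset.range (step 𝔥),
    ∑ k ∈ Finset.range (step 𝔥) with i + j + 1 ≤ k, s ^ (k - (i + j + 1)) •
      S.proj k ⁅S.proj i v, S.proj j w⁆ := by
  simp [scaledBracket, LinearMap.sum_apply]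

variable [LieRing.IsNilpotent 𝔥]

theorem eq_zero_of_mem {i : ℕ} (hi : step 𝔥 ≤ i) {v : 𝔥} (hv : v ∈ S.V i) : v = 0 := by
  have := S.V_le hi hv
  rwa [lcsFiltration_step, Submodule.mem_bot] at this

theorem proj_eq_zero {i : ℕ} (hi : step 𝔥 ≤ i) (v : 𝔥) : S.proj i v = 0 :=
  S.eq_zero_of_mem hi (S.proj_mem i v)

theorem sum_proj (v : 𝔥) : ∑ i ∈ Finset.range (step 𝔥), S.proj i v = v := by
  have hv : v ∈ ⨆ j, S.V j := by
    rw [S.isInternal.submodule_iSup_eq_top]; trivial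
  induction hv using Submodule.iSup_induction' with
  | mem i v hv =>
    rcases lt_or_ge i (step 𝔥) with h | h
    · rw [Finset.sum_eq_single_of_mem i (Finset.mem_range.2 h), S.proj_of_mem hv]
      intro j _ hj
      exact S.proj_of_mem_of_ne hj.symm hv
    · rw [S.eq_zero_of_mem h hv]; simp
  | zero => simp
  | add v w _ _ h1 h2 => simp only [map_add, Finset.sum_add_distrib, h1, h2]

theorem ext_proj {v w : 𝔥} (h : ∀ i < step 𝔥, S.proj i v = S.proj i w) : v = w := by
  rw [← S.sum_proj v, ← S.sum_proj w]
  exact Finset.sum_congr rfl fun i hi => h i (Finset.mem_range.1 hi)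

theorem mem_lcsFiltration {i : ℕ} {v : 𝔥} (h : ∀ j < i, S.proj j v = 0) :
    v ∈ lcsFiltration 𝔥 i := by
  rw [← S.sum_proj v]
  refine Submodule.sum_mem _ fun j _ => ?_
  rcases lt_or_ge j i with hj | hj
  · rw [h j hj]; exact Submodule.zero_mem _
  · exact S.proj_mem_lcsFiltration hj v

theorem proj_dil (t : ℝ) (i : ℕ) (v : 𝔥) : S.proj i (S.dil t v) = t ^ (i + 1) • S.proj i v := by
  rw [dil, map_sum]
  simp only [map_smul, S.proj_proj, smul_ite, smul_zero, Finset.sum_ite_eq', Finset.mem_range]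
  split_ifs with h
  · rfl
  · rw [S.proj_eq_zero (not_lt.1 h), smul_zero]

theorem dil_dil (s t : ℝ) (v : 𝔥) : S.dil s (S.dil t v) = S.dil (s * t) v := by
  refine S.ext_proj fun i _ => ?_
  rw [S.proj_dil, S.proj_dil, S.proj_dil, smul_smul, mul_pow]

theorem dil_one (v : 𝔥) : S.dil 1 v = v := by
  refine S.ext_proj fun i _ => ?_
  rw [S.proj_dil, one_pow, one_smul]

theorem isNilpotentBracket_scaledBracket (s : ℝ) :
    IsNilpotentBracket (step 𝔥) (lcsFiltration 𝔥) (S.scaledBracket s) where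
  zero := lcsFiltration_zero
  bot := lcsFiltration_step
  antitone := lcsFiltration_antitone
  self v := by
    -- Exchanging the two summation indices reverses each inner bracket.
    have h : S.scaledBracket s v v = - S.scaledBracket s v v := by
      conv_lhs => rw [scaledBracket_apply, Finset.sum_comm]
      rw [scaledBracket_apply, ← Finset.sum_neg_distrib]
      refine Finset.sum_congr rfl fun i _ => ?_
      rw [← Finset.sum_neg_distrib]
      refine Finset.sum_congr rfl fun j _ => ?_
      rw [← Finset.sum_neg_distrib, add_comm j i]
      refine Finset.sum_congr rfl fun k _ => ?_
      rw [← lie_skew, map_neg, smul_neg]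
    have h2 : (2 : ℝ) • S.scaledBracket s v v = 0 := by
      rw [two_smul]; nth_rewrite 2 [h]; exact add_neg_cancel _
    exact (smul_eq_zero.1 h2).resolve_left two_ne_zero
  mem {a b v w} hv hw := by
    rw [scaledBracket_apply]
    refine Submodule.sum_mem _ fun i _ => Submodule.sum_mem _ fun j _ =>
      Submodule.sum_mem _ fun k hk => Submodule.smul_mem _ _ ?_
    have hk := (Finset.mem_filter.1 hk).2
    rcases lt_or_ge i a with hi | hi
    · rw [S.proj_eq_zero_of_lt hi hv, zero_lie, map_zero]; exact Submodule.zero_mem _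
    rcases lt_or_ge j b with hj | hj
    · rw [S.proj_eq_zero_of_lt hj hw, lie_zero, map_zero]; exact Submodule.zero_mem _
    exact S.proj_mem_lcsFiltration (by lia) _

/-- At `s = 0` only the terms with `k = i + j + 1` survive, because `0 ^ 0 = 1`. -/
theorem bracketInf_eq (v w : 𝔥) : S.bracketInf v w = S.scaledBracket 0 v w := by
  rw [bracketInf, scaledBracket_apply]
  refine Finset.sum_congr rfl fun i _ => Finset.sum_congr rfl fun j _ => ?_
  rw [Finset.sum_filter]
  rcases lt_or_ge (i + j + 1) (step 𝔥) with h | h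
  · rw [Finset.sum_eq_single_of_mem (i + j + 1) (Finset.mem_range.2 h)]
    · simp
    · intro k _ hk
      split_ifs with hle
      · rw [zero_pow (by lia), zero_smul]
      · rfl
  · rw [S.proj_eq_zero h, Finset.sum_eq_zero]
    intro k hk
    rw [if_neg]
    have := Finset.mem_range.1 hk
    lia

/-- The weights match: `s ^ (k + 1) = s ^ (k - (i + j + 1)) * s ^ (i + 1) * s ^ (j + 1)`, while
components with `k < i + j + 1` vanish. Nothing is divided by `s`, so `s = 0` is allowed. -/
theorem dil_lie (s : ℝ) (v w : 𝔥) :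
    S.dil s ⁅v, w⁆ = S.scaledBracket s (S.dil s v) (S.dil s w) := by
  rw [scaledBracket_apply, dil]
  have h1 : ∀ k, S.proj k ⁅v, w⁆ = ∑ i ∈ Finset.range (step 𝔥), ∑ j ∈ Finset.range (step 𝔥),
      S.proj k ⁅S.proj i v, S.proj j w⁆ := by
    intro k
    conv_lhs => rw [← S.sum_proj v, ← S.sum_proj w]
    simp only [sum_lie, lie_sum, map_sum]
    rw [Finset.sum_comm]
  simp only [h1, Finset.smul_sum]
  rw [Finset.sum_comm]
  refine Finset.sum_congr rfl fun i _ => ?_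
  rw [Finset.sum_comm]
  refine Finset.sum_congr rfl fun j _ => ?_
  rw [Finset.sum_filter]
  refine Finset.sum_congr rfl fun k _ => ?_
  split_ifs with hle
  · rw [S.proj_dil, S.proj_dil, smul_lie, lie_smul, map_smul, map_smul, smul_smul, smul_smul,
      ← pow_add, ← pow_add]
    congr 2
    lia
  · rw [S.proj_eq_zero_of_lt (not_le.1 hle) (lie_mem_lcsFiltration
      (S.proj_mem_lcsFiltration le_rfl v) (S.proj_mem_lcsFiltration le_rfl w)), smul_zero]

theorem dil_scaledBracket_zero (s : ℝ) (v w : 𝔥) :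
    S.dil s (S.scaledBracket 0 v w) = S.scaledBracket 0 (S.dil s v) (S.dil s w) := by
  rw [← bracketInf_eq, ← bracketInf_eq, bracketInf, bracketInf, ← dilLin_apply]
  simp only [map_sum, dilLin_apply]
  refine Finset.sum_congr rfl fun i _ => Finset.sum_congr rfl fun j _ => ?_
  refine S.ext_proj fun k _ => ?_
  rw [S.proj_dil, S.proj_dil, S.proj_dil, S.proj_proj, S.proj_proj]
  split_ifs with h
  · subst h
    rw [smul_lie, lie_smul, map_smul, map_smul, smul_smul, ← pow_add]
    congr 2
    lia
  · rw [smul_zero]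

/-- The product of `H` read through the dilation `δ_s`; for `s = 0` it is the product of `H_∞`. -/
def scaledMul (s : ℝ) (x y : 𝔥) : 𝔥 := bch (step 𝔥) (fun v w => S.scaledBracket s v w) x y

theorem mulInf_eq (x y : 𝔥) : S.mulInf x y = S.scaledMul 0 x y := by
  have : S.bracketInf = fun v w => S.scaledBracket 0 v w := by
    ext v w; exact S.bracketInf_eq v w
  rw [mulInf, this, scaledMul]

theorem dil_lieMul (s : ℝ) (x y : 𝔥) :
    S.dil s (lieMul x y) = S.scaledMul s (S.dil s x) (S.dil s y) := by
  have := bch_map (step 𝔥) (br := fun v w : 𝔥 => ⁅v, w⁆)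
    (br' := fun v w => S.scaledBracket s v w) (S.dilLin s)
    (fun v w => by simp only [dilLin_apply]; exact S.dil_lie s v w) x y
  simp only [dilLin_apply] at this
  exact this.symm

theorem dil_scaledMul_zero (s : ℝ) (x y : 𝔥) :
    S.dil s (S.scaledMul 0 x y) = S.scaledMul 0 (S.dil s x) (S.dil s y) := by
  have := bch_map (step 𝔥) (br := fun v w => S.scaledBracket 0 v w)
    (br' := fun v w => S.scaledBracket 0 v w) (S.dilLin s)
    (fun v w => by simp only [dilLin_apply]; exact S.dil_scaledBracket_zero s v w) x y
  simp only [dilLin_apply] at this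
  exact this.symm

theorem projAb_lieMul (x y : 𝔥) : S.projAb (lieMul x y) = S.projAb x + S.projAb y := by
  have h : lieMul x y - (x + y) ∈ lcsFiltration 𝔥 1 :=
    (isNilpotentBracket_lieBilin (𝔥 := 𝔥)).bch_sub_mem (i := 0) (x := x) (y := y)
      (Or.inl (by rw [lcsFiltration_zero]; trivial))
  have := S.proj_eq_zero_of_lt zero_lt_one h
  rw [map_sub, sub_eq_zero, map_add] at this
  exact this

end Splitting

end Splitting

/-! ### Products of many small factors -/

section Products

/-- The products of a family of bilinear brackets that depends smoothly on a parameter depend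
smoothly on the parameter and the factors. -/
theorem contDiff_bch {E : Type*} [NormedAddCommGroup E] [NormedSpace ℝ E] {n : WithTop ℕ∞} (c : ℕ)
    (br : ℝ → E → E → E)
    (hbr : ContDiff ℝ n (fun z : ℝ × E × E => br z.1 z.2.1 z.2.2)) :
    ContDiff ℝ n (fun z : ℝ × E × E => bch c (br z.1) z.2.1 z.2.2) := by
  simp only [bch_def]
  refine ContDiff.sum fun k _ => ContDiff.sum fun p _ => ContDiff.const_smul _ ?_
  have h2 : ∀ z : ℝ × E × E, bchWord p z.2.1 z.2.2 =
      (bchWord p true false).map fun t => if t then z.2.1 else z.2.2 := by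
    intro z; rw [map_bchWord]; simp
  simp only [h2]
  have hb : ∀ t : Bool, ContDiff ℝ n (fun z : ℝ × E × E => if t then z.2.1 else z.2.2) := by
    intro t
    cases t
    · simpa using contDiff_snd.snd
    · simpa using contDiff_snd.fst
  generalize bchWord p true false = l
  induction l with
  | nil => exact contDiff_const
  | cons t l ih =>
    cases l with
    | nil => exact hb t
    | cons u l =>
      simp only [List.map_cons, nestedBracket] at ih ⊢
      exact hbr.comp (contDiff_fst.prodMk ((hb t).prodMk ih))

variable {E : Type*} [NormedAddCommGroup E] [NormedSpace ℝ E] [FiniteDimensional ℝ E]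

theorem exists_lipschitz_of_contDiff {P F : Type*} [NormedAddCommGroup P] [NormedSpace ℝ P]
    [FiniteDimensional ℝ P] [NormedAddCommGroup F] [NormedSpace ℝ F] {f : P → F}
    (hf : ContDiff ℝ 1 f) (R : ℝ) :
    ∃ C : ℝ, 0 ≤ C ∧ ∀ z z', ‖z‖ ≤ R → ‖z'‖ ≤ R → ‖f z - f z'‖ ≤ C * ‖z - z'‖ := by
  obtain ⟨K, hK⟩ := hf.contDiffOn.exists_lipschitzOnWith (s := Metric.closedBall (0 : P) R)
    one_ne_zero (convex_closedBall _ _) (isCompact_closedBall _ _)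
  refine ⟨K, K.2, fun z z' hz hz' => ?_⟩
  have := hK.dist_le_mul z (by simpa using hz) z' (by simpa using hz')
  simpa [dist_eq_norm] using this

/-- Local Lipschitz estimates for a smooth family of products with left identity `0`. -/
theorem exists_product_lipschitz (G : ℝ → E → E → E)
    (hG : ContDiff ℝ 2 (fun z : ℝ × E × E => G z.1 z.2.1 z.2.2)) (h0 : ∀ s y, G s 0 y = y)
    (R : ℝ) (hR : 1 ≤ R) :
    ∃ C : ℝ, 0 ≤ C ∧ ∀ s ∈ Set.Icc (0 : ℝ) 1, ∀ x x' y y' : E, ‖x‖ ≤ R → ‖x'‖ ≤ R → ‖y‖ ≤ R →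
      ‖y'‖ ≤ R → ‖G s x y - G s x' y‖ ≤ C * ‖x - x'‖ ∧
        ‖(G s x y - y) - (G s x y' - y')‖ ≤ C * ‖x‖ * ‖y - y'‖ := by
  set f : ℝ × E × E → E := fun z => G z.1 z.2.1 z.2.2 with hf
  let ι : E →L[ℝ] ℝ × E × E :=
    (ContinuousLinearMap.inr ℝ ℝ (E × E)).comp (ContinuousLinearMap.inr ℝ E E)
  -- This is the derivative of `y ↦ G s x y - y`. It vanishes for `x = 0`, so its Lipschitz bound
  -- makes it `O(‖x‖)`, and the mean value inequality gives the second estimate.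
  let g : ℝ × E × E → E →L[ℝ] E := fun z => (fderiv ℝ f z).comp ι - ContinuousLinearMap.id ℝ E
  have hg : ContDiff ℝ 1 g :=
    ((hG.fderiv_right (m := 1) (by norm_num)).clm_comp contDiff_const).sub contDiff_const
  obtain ⟨C₁, hC₁, h₁⟩ := exists_lipschitz_of_contDiff (hG.of_le (by norm_num)) R
  obtain ⟨C₂, hC₂, h₂⟩ := exists_lipschitz_of_contDiff hg R
  have hder : ∀ s x y, HasFDerivAt (fun y => G s x y - y) (g (s, x, y)) y := by
    intro s x y
    have h3 : HasFDerivAt f (fderiv ℝ f (s, x, y)) (s, x, y) :=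
      (hG.differentiable (by norm_num) _).hasFDerivAt
    have h4 : HasFDerivAt (fun y : E => ((s, x, y) : ℝ × E × E)) ι y := by
      exact (hasFDerivAt_const (𝕜 := ℝ) s y).prodMk
        ((hasFDerivAt_const (𝕜 := ℝ) x y).prodMk (hasFDerivAt_id (𝕜 := ℝ) y))
    exact (h3.comp y h4).sub (hasFDerivAt_id y)
  have hg0 : ∀ s y, g (s, 0, y) = 0 := by
    intro s y
    have := hder s 0 y
    simp only [h0, sub_self] at this
    exact this.unique (hasFDerivAt_const _ _)
  have hnorm : ∀ s ∈ Set.Icc (0 : ℝ) 1, ∀ x y : E, ‖x‖ ≤ R → ‖y‖ ≤ R → ‖(s, x, y)‖ ≤ R := by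
    intro s hs x y hx hy
    simp only [Prod.norm_mk, sup_le_iff]
    refine ⟨?_, hx, hy⟩
    rw [Real.norm_eq_abs, abs_of_nonneg hs.1]
    exact hs.2.trans hR
  refine ⟨max C₁ C₂, le_max_of_le_left hC₁, fun s hs x x' y y' hx hx' hy hy' => ⟨?_, ?_⟩⟩
  · have h3 := h₁ (s, x, y) (s, x', y) (hnorm s hs x y hx hy) (hnorm s hs x' y hx' hy)
    have h4 : ‖((s, x, y) : ℝ × E × E) - (s, x', y)‖ = ‖x - x'‖ := by
      simp [Prod.norm_mk]
    rw [h4] at h3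
    exact h3.trans (by gcongr; exact le_max_left _ _)
  · have hb : ∀ z ∈ Metric.closedBall (0 : E) R, ‖g (s, x, z)‖ ≤ C₂ * ‖x‖ := by
      intro z hz
      rw [mem_closedBall_zero_iff] at hz
      have h3 := h₂ (s, x, z) (s, 0, z) (hnorm s hs x z hx hz)
        (hnorm s hs 0 z (by rw [norm_zero]; linarith) hz)
      have h4 : ‖((s, x, z) : ℝ × E × E) - (s, 0, z)‖ = ‖x‖ := by
        simp [Prod.norm_mk]
      rwa [h4, hg0, sub_zero] at h3
    have h5 := (convex_closedBall (0 : E) R).norm_image_sub_le_of_norm_hasFDerivWithin_le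
      (f := fun y => G s x y - y) (f' := fun z => g (s, x, z)) (C := C₂ * ‖x‖)
      (fun z _ => (hder s x z).hasFDerivWithinAt) hb
      (mem_closedBall_zero_iff.2 hy') (mem_closedBall_zero_iff.2 hy)
    exact h5.trans (by gcongr; exact le_max_right _ _)

/-- If `y j = τ j • a + e j`, then the product of the `y j` differs from `(∑ τ j) • a` by at most
a multiple of `∑ ‖e j‖`. -/
theorem exists_product_estimate (G : ℝ → E → E → E)
    (hG : ContDiff ℝ 2 (fun z : ℝ × E × E => G z.1 z.2.1 z.2.2)) (h0 : ∀ s y, G s 0 y = y)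
    (a : E) (ha : ∀ s t u : ℝ, G s (t • a) (u • a) = (t + u) • a) :
    ∃ C : ℝ, 0 < C ∧ ∃ η : ℝ, 0 < η ∧ ∀ s ∈ Set.Icc (0 : ℝ) 1, ∀ (τ : ℕ → ℝ) (y p : ℕ → E) (k : ℕ),
      (∀ j, 0 ≤ τ j) → p 0 = 0 → (∀ j < k, p (j + 1) = G s (y j) (p j)) →
      ∑ j ∈ Finset.range k, τ j ≤ 1 → ∑ j ∈ Finset.range k, ‖y j - τ j • a‖ ≤ η →
      ‖p k - (∑ j ∈ Finset.range k, τ j) • a‖ ≤ C * ∑ j ∈ Finset.range k, ‖y j - τ j • a‖ := by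
  obtain ⟨C₀, hC₀, hL⟩ := exists_product_lipschitz G hG h0 (‖a‖ + 1) (by simp)
  set C₁ := C₀ + 1 with hC₁
  set K := C₀ * ‖a‖ with hK
  have hK0 : 0 ≤ K := by positivity
  set C := C₁ * Real.exp K with hC
  have hCpos : 0 < C := by positivity
  -- A total error below `C⁻¹` keeps the partial products within distance `1` of the segment from
  -- `0` to `a`, and one below `1` does so for the factors; all then lie in the ball of radius `‖a‖
  -- + 1` where the Lipschitz bounds hold.
  refine ⟨C, hCpos, min 1 C⁻¹, by positivity, ?_⟩
  intro s hs τ y p k hτ hp0 hp hτ1 hη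
  set t : ℕ → ℝ := fun i => ∑ j ∈ Finset.range i, τ j with ht
  set ε : ℕ → ℝ := fun i => ∑ j ∈ Finset.range i, ‖y j - τ j • a‖ with hε
  have ht0 : ∀ i, 0 ≤ t i := fun i => Finset.sum_nonneg fun j _ => hτ j
  have hε0 : ∀ i, 0 ≤ ε i := fun i => Finset.sum_nonneg fun j _ => norm_nonneg _
  have htk : ∀ i ≤ k, t i ≤ 1 := fun i hi => le_trans
    (Finset.sum_le_sum_of_subset_of_nonneg (Finset.range_mono hi) fun j _ _ => hτ j) hτ1
  have hεk : ∀ i ≤ k, ε i ≤ min 1 C⁻¹ := fun i hi => le_trans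
    (Finset.sum_le_sum_of_subset_of_nonneg (Finset.range_mono hi) fun j _ _ => norm_nonneg _) hη
  have hsmul : ∀ r : ℝ, 0 ≤ r → r ≤ 1 → ‖r • a‖ ≤ ‖a‖ := fun r h1 h2 => by
    rw [norm_smul, Real.norm_eq_abs, abs_of_nonneg h1]
    exact mul_le_of_le_one_left (norm_nonneg _) h2
  -- A discrete Gronwall inequality: each factor multiplies the accumulated error by at most `1 + K
  -- * τ i ≤ exp (K * τ i)` and adds a multiple of its own error.
  have key : ∀ i ≤ k, ‖p i - t i • a‖ ≤ C₁ * Real.exp (K * t i) * ε i := by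
    intro i
    induction i with
    | zero => intro _; simp [hp0, ht, hε]
    | succ i ih =>
      intro hi
      have hi' : i ≤ k := by lia
      have hd := ih hi'
      have hts : t (i + 1) = t i + τ i := Finset.sum_range_succ _ _
      have hεs : ε (i + 1) = ε i + ‖y i - τ i • a‖ := Finset.sum_range_succ _ _
      have hτi : τ i ≤ 1 := by have := htk _ hi; have := ht0 i; linarith
      have hei : ‖y i - τ i • a‖ ≤ 1 := by
        have h1 := (hεk _ hi).trans (min_le_left _ _)
        have h2 := hε0 i
        linarith
      have hd1 : ‖p i - t i • a‖ ≤ 1 := by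
        refine hd.trans ?_
        have h1 : Real.exp (K * t i) ≤ Real.exp K :=
          Real.exp_le_exp.2 (mul_le_of_le_one_right hK0 (htk i hi'))
        calc C₁ * Real.exp (K * t i) * ε i ≤ C * C⁻¹ := by
              gcongr
              · exact (mul_le_mul_of_nonneg_left h1 (by positivity))
              · exact (hεk i hi').trans (min_le_right _ _)
          _ = 1 := mul_inv_cancel₀ hCpos.ne'
      have hpn : ‖p i‖ ≤ ‖a‖ + 1 := by
        have := norm_add_le (t i • a) (p i - t i • a)
        rw [add_sub_cancel] at this
        have := hsmul (t i) (ht0 i) (htk i hi')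
        linarith
      have hyn : ‖y i‖ ≤ ‖a‖ + 1 := by
        have := norm_add_le (τ i • a) (y i - τ i • a)
        rw [add_sub_cancel] at this
        have := hsmul (τ i) (hτ i) hτi
        linarith
      have hτa : ‖τ i • a‖ ≤ ‖a‖ + 1 := by have := hsmul (τ i) (hτ i) hτi; linarith
      have hta : ‖t i • a‖ ≤ ‖a‖ + 1 := by have := hsmul (t i) (ht0 i) (htk i hi'); linarith
      have h1 := (hL s hs (y i) (τ i • a) (p i) (p i) hyn hτa hpn hpn).1
      have h2 := (hL s hs (τ i • a) (τ i • a) (p i) (t i • a) hτa hτa hpn hta).2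
      -- Multiples of `a` multiply additively, so the new error splits into the error of the new
      -- factor, the distortion of the old error by `τ i • a`, and the old error.
      have e : p (i + 1) - t (i + 1) • a = (G s (y i) (p i) - G s (τ i • a) (p i)) +
          ((G s (τ i • a) (p i) - p i) - (G s (τ i • a) (t i • a) - t i • a)) +
          (p i - t i • a) := by
        rw [hp i (by lia), ha, hts]
        module
      have h3 : ‖p (i + 1) - t (i + 1) • a‖ ≤ C₀ * ‖y i - τ i • a‖ +
          C₀ * ‖τ i • a‖ * ‖p i - t i • a‖ + ‖p i - t i • a‖ := by
        rw [e]
        exact (norm_add₃_le).trans (by linarith)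
      rw [norm_smul, Real.norm_eq_abs, abs_of_nonneg (hτ i)] at h3
      have h4 : 1 + K * τ i ≤ Real.exp (K * τ i) := by
        have := Real.add_one_le_exp (K * τ i); linarith
      have h5 : 1 ≤ Real.exp (K * t (i + 1)) :=
        Real.one_le_exp (mul_nonneg hK0 (ht0 _))
      calc ‖p (i + 1) - t (i + 1) • a‖
          ≤ C₀ * ‖y i - τ i • a‖ + (1 + K * τ i) * ‖p i - t i • a‖ := by
            rw [hK]; linarith
        _ ≤ C₁ * Real.exp (K * t (i + 1)) * ‖y i - τ i • a‖ +
            Real.exp (K * τ i) * (C₁ * Real.exp (K * t i) * ε i) := by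
            gcongr
            calc C₀ ≤ C₁ * 1 := by rw [hC₁]; linarith
              _ ≤ C₁ * Real.exp (K * t (i + 1)) := by gcongr
        _ = C₁ * Real.exp (K * t (i + 1)) * ε (i + 1) := by
            rw [hεs, hts, mul_add K, Real.exp_add]; ring
  refine (key k le_rfl).trans ?_
  have h1 : Real.exp (K * t k) ≤ Real.exp K :=
    Real.exp_le_exp.2 (mul_le_of_le_one_right hK0 (htk k le_rfl))
  rw [hC]
  gcongr

end Products

/-! ### Word norms -/

section WordNorm

variable {Λ : Type*} [Group Λ]

theorem exists_list_wordNorm {T : Finset Λ} (hT : Subgroup.closure (T : Set Λ) = ⊤) (g : Λ) :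
    ∃ l : List Λ, l.length = wordNorm T g ∧ (∀ a ∈ l, a ∈ T ∨ a⁻¹ ∈ T) ∧ l.prod = g := by
  have hne : {n | ∃ l : List Λ, l.length = n ∧ (∀ a ∈ l, a ∈ T ∨ a⁻¹ ∈ T) ∧ l.prod = g}.Nonempty := by
    have hg : g ∈ Subgroup.closure (T : Set Λ) := by rw [hT]; trivial
    rw [← Subgroup.mem_toSubmonoid, Subgroup.closure_toSubmonoid] at hg
    obtain ⟨l, hl, hlp⟩ := Submonoid.exists_list_of_mem_closure hg
    exact ⟨l.length, l, rfl, fun a ha => by simpa using hl a ha, hlp⟩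
  exact Nat.sInf_mem hne

theorem wordNorm_one (T : Finset Λ) : wordNorm T (1 : Λ) = 0 :=
  Nat.sInf_eq_zero.2 (Or.inl ⟨[], rfl, by simp, rfl⟩)

theorem log_one {𝔥 : Type*} [LieRing 𝔥] [LieAlgebra ℝ 𝔥] [LieRing.IsNilpotent 𝔥] {log : Λ → 𝔥}
    (hlog : ∀ a b, log (a * b) = lieMul (log a) (log b)) : log 1 = 0 := by
  have h := hlog 1 1
  have h2 : lieMul (log 1) (log 1) = (2 : ℝ) • log 1 := by
    have := (isNilpotentBracket_lieBilin (𝔥 := 𝔥)).bch_smul_smul 1 1 (log 1)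
    rw [one_smul, one_add_one_eq_two] at this
    exact this
  rw [mul_one, h2, two_smul, left_eq_add] at h
  exact h

end WordNorm

/-! ### Coordinates, continuity of the products and growth of the word norm -/

section Coordinates

variable {𝔥 : Type*} [LieRing 𝔥] [LieAlgebra ℝ 𝔥] [FiniteDimensional ℝ 𝔥]

variable (𝔥) in
/-- Coordinates in a basis. -/
def coord : 𝔥 ≃ₗ[ℝ] (Fin (Module.finrank ℝ 𝔥) → ℝ) := (Module.finBasis ℝ 𝔥).equivFun

/-- `𝔥` carries no norm, so sizes are measured in coordinates. -/
theorem exists_norm_coord_le (L : 𝔥 →ₗ[ℝ] 𝔥) :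
    ∃ C : ℝ, 0 ≤ C ∧ ∀ v, ‖coord 𝔥 (L v)‖ ≤ C * ‖coord 𝔥 v‖ := by
  let L' := LinearMap.toContinuousLinearMap
    ((coord 𝔥).toLinearMap ∘ₗ L ∘ₗ (coord 𝔥).symm.toLinearMap)
  refine ⟨‖L'‖, norm_nonneg _, fun v => ?_⟩
  simpa [L'] using L'.le_opNorm (coord 𝔥 v)

/-- The product of `H` rescaled by `δ_s`, in coordinates. -/
def coordMul (S : Splitting 𝔥) (s : ℝ) (x y : Fin (Module.finrank ℝ 𝔥) → ℝ) :
    Fin (Module.finrank ℝ 𝔥) → ℝ :=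
  coord 𝔥 (S.scaledMul s ((coord 𝔥).symm x) ((coord 𝔥).symm y))

theorem coordMul_coord (S : Splitting 𝔥) (s : ℝ) (x y : 𝔥) :
    coordMul S s (coord 𝔥 x) (coord 𝔥 y) = coord 𝔥 (S.scaledMul s x y) := by
  simp [coordMul]

theorem contDiff_coordMul (S : Splitting 𝔥) {n : WithTop ℕ∞} :
    ContDiff ℝ n (fun z : ℝ × (Fin (Module.finrank ℝ 𝔥) → ℝ) × (Fin (Module.finrank ℝ 𝔥) → ℝ) =>
      coordMul S z.1 z.2.1 z.2.2) := by
  let br : ℝ → (Fin (Module.finrank ℝ 𝔥) → ℝ) → (Fin (Module.finrank ℝ 𝔥) → ℝ) →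
      (Fin (Module.finrank ℝ 𝔥) → ℝ) := fun s x y =>
    coord 𝔥 (S.scaledBracket s ((coord 𝔥).symm x) ((coord 𝔥).symm y))
  have h1 : ∀ s x y, coordMul S s x y = bch (step 𝔥) (br s) x y := by
    intro s x y
    have := bch_map (step 𝔥) (br := fun v w => S.scaledBracket s v w) (br' := br s)
      (coord 𝔥).toLinearMap (fun v w => by simp [br]) ((coord 𝔥).symm x) ((coord 𝔥).symm y)
    simpa [coordMul, Splitting.scaledMul] using this.symm
  simp only [h1]
  refine contDiff_bch (step 𝔥) br ?_
  simp only [br, Splitting.scaledBracket_apply, map_sum, map_smul]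
  refine ContDiff.sum fun i _ => ContDiff.sum fun j _ => ContDiff.sum fun k _ => ?_
  refine ContDiff.smul (contDiff_fst.pow _) ?_
  let D := (((lieBilin 𝔥).compl₁₂ (S.proj i ∘ₗ (coord 𝔥).symm.toLinearMap)
    (S.proj j ∘ₗ (coord 𝔥).symm.toLinearMap)).compr₂
      ((coord 𝔥).toLinearMap ∘ₗ S.proj k)).toContinuousBilinearMap
  have hD : ContDiff ℝ n fun z : ℝ × (Fin (Module.finrank ℝ 𝔥) → ℝ) ×
      (Fin (Module.finrank ℝ 𝔥) → ℝ) => D z.2.1 z.2.2 :=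
    (D.contDiff.comp contDiff_snd.fst).clm_apply contDiff_snd.snd
  exact hD

section Topology

variable [TopologicalSpace 𝔥] [IsTopologicalAddGroup 𝔥] [ContinuousSMul ℝ 𝔥]

theorem continuous_coord_symm : Continuous (coord 𝔥).symm :=
  (coord 𝔥).symm.toLinearMap.continuous_of_finiteDimensional

variable [T2Space 𝔥]

theorem continuous_coord : Continuous (coord 𝔥) :=
  (coord 𝔥).toLinearMap.continuous_of_finiteDimensional

theorem continuous_conj_product {A B : Type*} [TopologicalSpace A] [TopologicalSpace B]
    {G : ℝ → B → B → B} (hG : Continuous fun z : ℝ × B × B => G z.1 z.2.1 z.2.2) {φ : A → B}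
    (hφ : Continuous φ) {ψ : B → A} (hψ : Continuous ψ) :
    Continuous fun z : ℝ × A × A => ψ (G z.1 (φ z.2.1) (φ z.2.2)) :=
  hψ.comp (hG.comp (continuous_fst.prodMk ((hφ.comp continuous_snd.fst).prodMk
    (hφ.comp continuous_snd.snd))))

theorem continuous_scaledMul (S : Splitting 𝔥) :
    Continuous (fun z : ℝ × 𝔥 × 𝔥 => S.scaledMul z.1 z.2.1 z.2.2) := by
  have h := continuous_conj_product (contDiff_coordMul S (n := 0)).continuous
    (continuous_coord (𝔥 := 𝔥)) (continuous_coord_symm (𝔥 := 𝔥))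
  simpa only [coordMul_coord, LinearEquiv.symm_apply_apply] using h

end Topology

/-- The sum of the norms of the homogeneous components. -/
def sumNorm (S : Splitting 𝔥) (v : 𝔥) : ℝ := ∑ i ∈ Finset.range (step 𝔥), ‖coord 𝔥 (S.proj i v)‖

theorem norm_coord_dil_le (S : Splitting 𝔥) {r : ℝ} (h0 : 0 ≤ r) (h1 : r ≤ 1)
    (v : 𝔥) :
    ‖coord 𝔥 (S.dil r v)‖ ≤ r * sumNorm S v := by
  rw [Splitting.dil, map_sum, sumNorm, Finset.mul_sum]
  refine norm_sum_le_of_le _ fun i _ => ?_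
  rw [map_smul, norm_smul, Real.norm_eq_abs, abs_of_nonneg (by positivity)]
  gcongr
  exact pow_le_of_le_one h0 h1 (by lia)

variable [LieRing.IsNilpotent 𝔥] (S : Splitting 𝔥)

/-- The product estimate for the rescaled products of `H`. -/
theorem exists_scaledMul_estimate (a : 𝔥) :
    ∃ C : ℝ, 0 < C ∧ ∃ η : ℝ, 0 < η ∧ ∀ s ∈ Set.Icc (0 : ℝ) 1, ∀ (τ : ℕ → ℝ) (y p : ℕ → 𝔥) (k : ℕ),
      (∀ j, 0 ≤ τ j) → p 0 = 0 → (∀ j < k, p (j + 1) = S.scaledMul s (y j) (p j)) →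
      ∑ j ∈ Finset.range k, τ j ≤ 1 → ∑ j ∈ Finset.range k, ‖coord 𝔥 (y j - τ j • a)‖ ≤ η →
      ‖coord 𝔥 (p k - (∑ j ∈ Finset.range k, τ j) • a)‖ ≤
        C * ∑ j ∈ Finset.range k, ‖coord 𝔥 (y j - τ j • a)‖ := by
  obtain ⟨C, hC, η, hη, h⟩ := exists_product_estimate (coordMul S) (contDiff_coordMul S)
    (fun s y => by
      have := (S.isNilpotentBracket_scaledBracket s).bch_zero_left ((coord 𝔥).symm y)
      simp only [coordMul, map_zero, Splitting.scaledMul, this, LinearEquiv.apply_symm_apply])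
    (coord 𝔥 a) (fun s t u => by
      have := (S.isNilpotentBracket_scaledBracket s).bch_smul_smul t u a
      rw [← map_smul, ← map_smul, coordMul_coord, Splitting.scaledMul, this, map_smul])
  refine ⟨C, hC, η, hη, fun s hs τ y p k hτ hp0 hp hτ1 hη' => ?_⟩
  have := h s hs τ (fun j => coord 𝔥 (y j)) (fun j => coord 𝔥 (p j)) k hτ (by simp [hp0])
    (fun j hj => by rw [hp j hj, coordMul_coord]) hτ1 (by simpa using hη')
  simpa using this

/-- The homogeneous components grow at most like powers of the word norm. -/
theorem exists_norm_proj_log_le {Λ : Type*} [Group Λ] {T : Finset Λ}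
    (hT : Subgroup.closure (T : Set Λ) = ⊤) {log : Λ → 𝔥} (hlog : ∀ a b, log (a * b) = lieMul (log a) (log b)) :
    ∃ C : ℝ, 0 ≤ C ∧ ∀ g, ∀ i < step 𝔥,
      ‖coord 𝔥 (S.proj i (log g))‖ ≤ C * (wordNorm T g : ℝ) ^ (i + 1) := by
  classical
  obtain ⟨C, hC, η, hη, hest⟩ := exists_scaledMul_estimate S 0
  obtain ⟨M, hM⟩ : ∃ M : ℝ, ∀ a, a ∈ T ∨ a⁻¹ ∈ T → sumNorm S (log a) ≤ M := by
    obtain ⟨M, hM⟩ := ((T ∪ T.image (·⁻¹)).image fun a => sumNorm S (log a)).exists_le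
    refine ⟨M, fun a ha => hM _ (Finset.mem_image_of_mem _ ?_)⟩
    rw [Finset.mem_union, Finset.mem_image]
    exact ha.imp id fun h => ⟨a⁻¹, h, inv_inv a⟩
  -- Rescaled by `1 / (K * |g|)`, the `|g|` letters of `g` have total norm at most `M / K ≤ η`. The
  -- product estimate with target `0` then bounds the rescaled `log g`.
  obtain ⟨K, hK⟩ := exists_nat_ge (max 1 (M / η))
  have hK1 : (1 : ℝ) ≤ K := (le_max_left _ _).trans hK
  have hKM : M ≤ K * η := by
    have := (le_max_right _ _).trans hK
    rwa [div_le_iff₀ hη] at this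
  have hgrow : ∀ g : Λ, 1 ≤ wordNorm T g →
      ‖coord 𝔥 (S.dil (1 / (K * wordNorm T g : ℝ)) (log g))‖ ≤ C * η := by
    intro g hg
    obtain ⟨l, hl, hlT, hlp⟩ := exists_list_wordNorm hT g
    set w := wordNorm T g with hw
    have hw1 : (1 : ℝ) ≤ w := by exact_mod_cast hg
    set s : ℝ := 1 / (K * w) with hs
    have hs0 : 0 ≤ s := by positivity
    have hs1 : s ≤ 1 := by
      rw [hs, div_le_one (by positivity)]
      nlinarith
    have hsum : ∑ j ∈ Finset.range w, ‖coord 𝔥 (S.dil s (log (l.getD (w - j - 1) 1)) - (0 : ℝ) • (0 : 𝔥))‖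
        ≤ η := by
      calc _ ≤ ∑ j ∈ Finset.range w, s * M := by
            refine Finset.sum_le_sum fun j hj => ?_
            rw [smul_zero, sub_zero]
            refine (norm_coord_dil_le S hs0 hs1 _).trans ?_
            gcongr
            refine hM _ (hlT _ ?_)
            have hj' : w - j - 1 < l.length := by
              have := Finset.mem_range.1 hj
              lia
            rw [List.getD_eq_getElem _ _ hj']
            exact List.getElem_mem hj'
        _ = M / K := by
            rw [Finset.sum_const, Finset.card_range, nsmul_eq_mul, hs]
            field_simp
        _ ≤ η := by rw [div_le_iff₀ (by positivity)]; linarith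
    -- The estimate adds factors on the left, so the word is read from its end: after `j` steps the
    -- last `j` letters have been multiplied.
    have h1 := hest s ⟨hs0, hs1⟩ (fun _ => 0) (fun j => S.dil s (log (l.getD (w - j - 1) 1)))
      (fun j => S.dil s (log ((l.drop (w - j)).prod))) w (fun _ => le_rfl)
      (by simp [← hl, log_one hlog, ← S.dilLin_apply])
      (fun j hj => by
        rw [← S.dil_lieMul, ← hlog]
        congr 2
        have hj' : w - j - 1 < l.length := by lia
        rw [List.getD_eq_getElem _ _ hj', show w - (j + 1) = w - j - 1 by lia,
          List.drop_eq_getElem_cons hj', List.prod_cons, show w - j - 1 + 1 = w - j by lia])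
      (by simp) hsum
    simp only [Nat.sub_self, List.drop_zero, hlp, smul_zero, sub_zero] at h1
    refine h1.trans ?_
    gcongr
    simpa using hsum
  have hproj : ∀ i, ∃ C : ℝ, 0 ≤ C ∧ ∀ v, ‖coord 𝔥 (S.proj i v)‖ ≤ C * ‖coord 𝔥 v‖ := fun i =>
    exists_norm_coord_le (S.proj i)
  choose D hD0 hD using hproj
  refine ⟨∑ i ∈ Finset.range (step 𝔥), (K : ℝ) ^ (i + 1) * (D i * (C * η)),
    Finset.sum_nonneg fun i _ => by have := hD0 i; positivity, fun g i hi => ?_⟩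
  rcases Nat.eq_zero_or_pos (wordNorm T g) with hg | hg
  · obtain ⟨l, hl, _, hlp⟩ := exists_list_wordNorm hT g
    rw [hg, List.length_eq_zero_iff] at hl
    subst hl
    rw [← hlp, List.prod_nil, log_one hlog, map_zero, map_zero, norm_zero, wordNorm_one]
    simp
  · have hw1 : (0 : ℝ) < wordNorm T g := by exact_mod_cast hg
    have h1 := hD i (S.dil (1 / (K * wordNorm T g : ℝ)) (log g))
    rw [S.proj_dil, map_smul, norm_smul, Real.norm_eq_abs, abs_of_nonneg (by positivity),
      one_div, inv_pow, inv_mul_le_iff₀ (by positivity)] at h1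
    have h2 : ‖coord 𝔥 (S.proj i (log g))‖ ≤
        (K : ℝ) ^ (i + 1) * (D i * (C * η)) * (wordNorm T g : ℝ) ^ (i + 1) := by
      refine h1.trans ?_
      have h3 := mul_le_mul_of_nonneg_left (hgrow g hg) (hD0 i)
      rw [mul_pow]
      rw [one_div] at h3
      calc _ ≤ (K : ℝ) ^ (i + 1) * (wordNorm T g : ℝ) ^ (i + 1) * (D i * (C * η)) :=
            mul_le_mul_of_nonneg_left h3 (by positivity)
        _ = _ := by ring
    refine h2.trans ?_
    gcongr
    exact Finset.single_le_sum (f := fun i => (K : ℝ) ^ (i + 1) * (D i * (C * η)))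
      (fun i _ => by have := hD0 i; positivity) (Finset.mem_range.2 hi)

end Coordinates

/-! ### Convergence in probability -/

section Probability

variable {X : Type*} [MeasurableSpace X] {m : Measure X}

/-- The sets `A n` need not be measurable; only the exceptional sets are estimated. -/
theorem tendsto_measure_one [IsProbabilityMeasure m] {A : ℕ → Set X}
    (h : ∀ δ : ℝ, 0 < δ → ∀ᶠ n in atTop, ∃ B : Set X, m.real B ≤ δ ∧ ∀ᵐ x ∂m, x ∉ B → x ∈ A n) :
    Tendsto (fun n => m (A n)) atTop (𝓝 1) := by
  rw [ENNReal.tendsto_nhds ENNReal.one_ne_top]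
  intro ε hε
  rcases eq_or_ne ε ∞ with rfl | hε'
  · exact Eventually.of_forall fun n => by simp
  filter_upwards [h ε.toReal (ENNReal.toReal_pos hε.ne' hε')] with n hn
  obtain ⟨B, hB, hBA⟩ := hn
  refine ⟨?_, prob_le_one.trans le_self_add⟩
  rw [tsub_le_iff_right]
  have h1 : m Set.univ ≤ m (A n ∪ B) := by
    refine measure_mono_ae ?_
    filter_upwards [hBA] with x hx _
    by_cases hxB : x ∈ B
    · exact Or.inr hxB
    · exact Or.inl (hx hxB)
  rw [measure_univ] at h1
  refine h1.trans ((measure_union_le _ _).trans ?_)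
  gcongr
  rw [← ENNReal.ofReal_toReal hε', ← ENNReal.ofReal_toReal (measure_ne_top m B)]
  exact ENNReal.ofReal_le_ofReal hB

theorem measureReal_ge_le {f : X → ℝ} (h0 : ∀ x, 0 ≤ f x) (hf : Integrable f m) {ε : ℝ}
    (hε : 0 < ε) : m.real {x | ε ≤ f x} ≤ (∫ x, f x ∂m) / ε := by
  rw [le_div_iff₀ hε, mul_comm]
  exact mul_meas_ge_le_integral_of_nonneg (ae_of_all _ h0) hf ε

theorem integral_comp_measurePreserving {σ : X → X} (hσ : MeasurePreserving σ m m) {f : X → ℝ}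
    (hf : Integrable f m) : ∫ x, f (σ x) ∂m = ∫ x, f x ∂m := by
  have h := integral_map hσ.aemeasurable (f := f) (by rw [hσ.map_eq]; exact hf.1)
  rw [hσ.map_eq] at h
  exact h.symm

theorem exists_truncation {f : X → ℝ} (h0 : ∀ x, 0 ≤ f x) (hf : Integrable f m) {ε : ℝ}
    (hε : 0 < ε) : ∃ M : ℕ, ∫ x, max (f x - M) 0 ∂m < ε := by
  have h : Tendsto (fun M : ℕ => ∫ x, max (f x - M) 0 ∂m) atTop (𝓝 (∫ _x, (0 : ℝ) ∂m)) := by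
    refine tendsto_integral_of_dominated_convergence f (fun M => ?_) hf (fun M => ?_) ?_
    · exact ((hf.1.sub aestronglyMeasurable_const).sup aestronglyMeasurable_const)
    · refine ae_of_all _ fun x => ?_
      rw [Real.norm_eq_abs, abs_of_nonneg (le_max_right _ _)]
      have : (0 : ℝ) ≤ M := M.cast_nonneg
      exact max_le (by linarith) (h0 x)
    · refine ae_of_all _ fun x => tendsto_const_nhds.congr' ?_
      filter_upwards [eventually_ge_atTop ⌈f x⌉₊] with M hM
      have := Nat.ceil_le.1 hM
      rw [max_eq_right (by linarith)]
  rw [integral_zero] at h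
  exact (h.eventually_lt_const hε).exists

/-- For stationary integrable `f ∘ σ j ≥ 0`, the sum of the first `n` squares is `o(n²)` in
probability. -/
theorem eventually_sum_sq_le [IsProbabilityMeasure m] {f : X → ℝ} (h0 : ∀ x, 0 ≤ f x)
    (hf : Integrable f m) {σ : ℕ → X → X} (hσ : ∀ j, MeasurePreserving (σ j) m m) {η δ : ℝ}
    (hη : 0 < η) (hδ : 0 < δ) :
    ∀ᶠ n : ℕ in atTop, ∃ B : Set X, m.real B ≤ δ ∧
      ∀ x, x ∉ B → ∑ j ∈ Finset.range (n + 1), f (σ j x) ^ 2 ≤ η * (n : ℝ) ^ 2 := by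
  -- Then `2 * ρ ^ 2 = η / 2` is half of the budget; the other half absorbs `2 * (n + 1) * M ^ 2`
  -- once `8 * M ^ 2 ≤ η * n`.
  set ρ := √η / 2 with hρ
  have hρ0 : 0 < ρ := by positivity
  -- The part of `f` below height `M` contributes `O(n)`. The squares of the part above sum to at
  -- most the square of its sum, which Markov's inequality controls.
  obtain ⟨M, hM⟩ := exists_truncation h0 hf (ε := δ * ρ / 2) (by positivity)
  set f₂ : X → ℝ := fun x => max (f x - M) 0 with hf₂
  have hf₂0 : ∀ x, 0 ≤ f₂ x := fun x => le_max_right _ _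
  have hf₂i : Integrable f₂ m := (hf.sub (integrable_const _)).sup (integrable_const _)
  obtain ⟨N, hN⟩ := exists_nat_ge (8 * (M : ℝ) ^ 2 / η)
  filter_upwards [eventually_ge_atTop (max 1 N)] with n hn
  have hn1 : (1 : ℝ) ≤ n := by exact_mod_cast (le_max_left _ _).trans hn
  have hnN : (N : ℝ) ≤ n := by exact_mod_cast (le_max_right _ _).trans hn
  have hinteg : ∀ j ∈ Finset.range (n + 1), Integrable (fun x => f₂ (σ j x)) m := fun j _ =>
    (hσ j).integrable_comp_of_integrable hf₂i
  have hsum : ∫ x, ∑ j ∈ Finset.range (n + 1), f₂ (σ j x) ∂m = (n + 1) * ∫ x, f₂ x ∂m := by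
    rw [integral_finsetSum _ hinteg]
    have : ∀ j ∈ Finset.range (n + 1), ∫ x, f₂ (σ j x) ∂m = ∫ x, f₂ x ∂m := fun j _ =>
      integral_comp_measurePreserving (hσ j) hf₂i
    rw [Finset.sum_congr rfl this]
    simp
  refine ⟨{x | n * ρ ≤ ∑ j ∈ Finset.range (n + 1), f₂ (σ j x)}, ?_, fun x hx => ?_⟩
  · refine (measureReal_ge_le (fun x => Finset.sum_nonneg fun j _ => hf₂0 _)
      (integrable_finsetSum _ hinteg) (by positivity)).trans ?_
    rw [hsum, div_le_iff₀ (by positivity)]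
    have h1 : ((n : ℝ) + 1) ≤ 2 * n := by linarith
    calc ((n : ℝ) + 1) * ∫ x, f₂ x ∂m ≤ (2 * n) * (δ * ρ / 2) := by
          gcongr
      _ = δ * (n * ρ) := by ring
  · rw [Set.mem_ofPred_eq, not_le] at hx
    have hle : ∀ y, f y ^ 2 ≤ 2 * (M : ℝ) ^ 2 + 2 * f₂ y ^ 2 := by
      intro y
      have h1 : f y ≤ M + f₂ y := by have := le_max_left (f y - M) 0; simp only [hf₂]; linarith
      have h2 := h0 y
      nlinarith [sq_nonneg ((M : ℝ) - f₂ y)]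
    have hsq : ∑ j ∈ Finset.range (n + 1), f₂ (σ j x) ^ 2 ≤
        (∑ j ∈ Finset.range (n + 1), f₂ (σ j x)) ^ 2 :=
      Finset.sum_sq_le_sq_sum_of_nonneg fun j _ => hf₂0 _
    have hx2 : (∑ j ∈ Finset.range (n + 1), f₂ (σ j x)) ^ 2 ≤ (n * ρ) ^ 2 :=
      pow_le_pow_left₀ (Finset.sum_nonneg fun j _ => hf₂0 _) hx.le 2
    have hρ2 : ρ ^ 2 = η / 4 := by rw [hρ, div_pow, Real.sq_sqrt hη.le]; norm_num
    have hM2 : 8 * (M : ℝ) ^ 2 ≤ η * n := by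
      rw [div_le_iff₀ hη] at hN
      nlinarith
    calc ∑ j ∈ Finset.range (n + 1), f (σ j x) ^ 2
        ≤ ∑ j ∈ Finset.range (n + 1), (2 * (M : ℝ) ^ 2 + 2 * f₂ (σ j x) ^ 2) :=
          Finset.sum_le_sum fun j _ => hle _
      _ = (n + 1) * (2 * (M : ℝ) ^ 2) + 2 * ∑ j ∈ Finset.range (n + 1), f₂ (σ j x) ^ 2 := by
          rw [Finset.sum_add_distrib, Finset.sum_const, Finset.card_range, nsmul_eq_mul, Finset.mul_sum]
          push_cast
          ring
      _ ≤ (n + 1) * (2 * (M : ℝ) ^ 2) + 2 * (n ^ 2 * (η / 4)) := by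
          rw [← hρ2, ← mul_pow]; linarith
      _ ≤ η * (n : ℝ) ^ 2 := by nlinarith [sq_nonneg (M : ℝ)]

end Probability

/-! ### The convergence of the rescaled cocycle -/

section Main

variable {𝔥 : Type*} [LieRing 𝔥] [LieAlgebra ℝ 𝔥] [FiniteDimensional ℝ 𝔥] [LieRing.IsNilpotent 𝔥]
  (S : Splitting 𝔥) {Λ : Type*} [Group Λ] {T : Finset Λ}

theorem Splitting.dil_eq_add {𝔥 : Type*} [LieRing 𝔥] [LieAlgebra ℝ 𝔥] [LieRing.IsNilpotent 𝔥]
    (S : Splitting 𝔥) (s : ℝ) (v : 𝔥) : S.dil s v = s • S.projAb v +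
      ∑ i ∈ Finset.range (step 𝔥 - 1), s ^ (i + 1 + 1) • S.proj (i + 1) v := by
  rw [Splitting.dil, Splitting.projAb]
  rcases h : step 𝔥 with _ | c
  · rw [S.proj_eq_zero h.le]
    simp
  · rw [Finset.sum_range_succ', add_comm]
    simp

theorem countable_of_closure_eq_top (hT : Subgroup.closure (T : Set Λ) = ⊤) : Countable Λ := by
  classical
  have hfin : {a : Λ | a ∈ T ∨ a⁻¹ ∈ T}.Finite := by
    refine (T ∪ T.image (·⁻¹)).finite_toSet.subset fun a ha => ?_
    rw [Finset.coe_union, Finset.coe_image]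
    exact ha.imp id fun h => ⟨a⁻¹, h, inv_inv a⟩
  have := hfin.countable.to_subtype
  refine Function.Surjective.countable
    (f := fun l : List {a : Λ | a ∈ T ∨ a⁻¹ ∈ T} => (l.map Subtype.val).prod) fun g => ?_
  obtain ⟨l, _, hl, hlp⟩ := exists_list_wordNorm hT g
  refine ⟨l.attachWith _ hl, ?_⟩
  simp only [List.map_attachWith]
  simp [hlp]

/-- A product of `k` elements whose abelianizations are nearly proportional to `a` and whose norms
are small in `ℓ²` is close to `a` after rescaling. -/
theorem exists_block_estimate (hT : Subgroup.closure (T : Set Λ) = ⊤) {log : Λ → 𝔥}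
    (hlog : ∀ a b, log (a * b) = lieMul (log a) (log b)) (a : 𝔥) {ε : ℝ} (hε : 0 < ε) :
    ∃ η : ℝ, 0 < η ∧ η ≤ 1 ∧ ∀ (n k : ℕ) (b P : ℕ → Λ) (τ : ℕ → ℝ), 1 ≤ n → P 0 = 1 →
      (∀ j < k, P (j + 1) = b j * P j) → (∀ j, 0 ≤ τ j) → ∑ j ∈ Finset.range k, τ j = n →
      ∑ j ∈ Finset.range k, ‖coord 𝔥 (S.projAb (log (b j))) - τ j • coord 𝔥 a‖ ≤ η * n →
      ∑ j ∈ Finset.range k, (wordNorm T (b j) : ℝ) ^ 2 ≤ η * (n : ℝ) ^ 2 →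
      ‖coord 𝔥 (S.dil (1 / (n : ℝ)) (log (P k)) - a)‖ < ε := by
  obtain ⟨C, hC, η₀, hη₀, hest⟩ := exists_scaledMul_estimate S a
  obtain ⟨D, hD, hproj⟩ := exists_norm_proj_log_le S hT hlog
  obtain ⟨c, hc⟩ : ∃ c : ℝ, c = ((step 𝔥 : ℕ) : ℝ) := ⟨_, rfl⟩
  have hc0 : 0 ≤ c := hc ▸ Nat.cast_nonneg _
  -- The `1` pays for the abelian discrepancy, `c * D` for the components of higher degree.
  set K : ℝ := 1 + c * D with hK
  have hK1 : 1 ≤ K := by rw [hK]; nlinarith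
  refine ⟨min 1 (min (η₀ / K) (ε / (2 * (C * K)))), by positivity, min_le_left _ _, ?_⟩
  set η := min 1 (min (η₀ / K) (ε / (2 * (C * K)))) with hη
  have hη1 : η ≤ 1 := min_le_left _ _
  have hη0 : 0 < η := by positivity
  have hηη₀ : η * K ≤ η₀ := by
    rw [← le_div_iff₀ (by positivity)]; exact (min_le_right _ _).trans (min_le_left _ _)
  have hηε : C * (η * K) < ε := by
    have : η ≤ ε / (2 * (C * K)) := (min_le_right _ _).trans (min_le_right _ _)
    rw [le_div_iff₀ (by positivity)] at this
    nlinarith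
  intro n k b P τ hn hP0 hP hτ hτn hA hW
  have hn0 : (0 : ℝ) < n := by exact_mod_cast hn
  have hn1 : (1 : ℝ) ≤ n := by exact_mod_cast hn
  set s : ℝ := 1 / n with hs
  have hs0 : 0 ≤ s := by positivity
  have hs1 : s ≤ 1 := by rw [hs, div_le_one hn0]; exact hn1
  -- As `η ≤ 1`, each single norm is at most `n`, so the higher powers of `|b j| / n` are dominated
  -- by its square.
  have hWle : ∀ j < k, (wordNorm T (b j) : ℝ) * s ≤ 1 := by
    intro j hj
    have h1 : (wordNorm T (b j) : ℝ) ^ 2 ≤ (n : ℝ) ^ 2 := by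
      refine (Finset.single_le_sum (f := fun j => (wordNorm T (b j) : ℝ) ^ 2)
        (fun j _ => by positivity) (Finset.mem_range.2 hj)).trans (hW.trans ?_)
      nlinarith [sq_nonneg (n : ℝ)]
    rw [pow_le_pow_iff_left₀ (by positivity) (by positivity) two_ne_zero] at h1
    rw [hs, mul_one_div, div_le_one hn0]
    exact h1
  have hterm : ∀ j < k, ‖coord 𝔥 (S.dil s (log (b j)) - (s * τ j) • a)‖ ≤
      s * ‖coord 𝔥 (S.projAb (log (b j))) - τ j • coord 𝔥 a‖ +
        c * D * (s ^ 2 * (wordNorm T (b j) : ℝ) ^ 2) := by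
    intro j hj
    have e : S.dil s (log (b j)) - (s * τ j) • a = (s • S.projAb (log (b j)) - (s * τ j) • a) +
        ∑ i ∈ Finset.range (step 𝔥 - 1), s ^ (i + 1 + 1) • S.proj (i + 1) (log (b j)) := by
      rw [S.dil_eq_add]
      abel
    rw [e, map_add, map_sum]
    refine (norm_add_le _ _).trans (add_le_add ?_ ?_)
    · rw [map_sub, map_smul, map_smul, mul_smul, ← smul_sub, norm_smul, Real.norm_eq_abs,
        abs_of_nonneg hs0]
    · have hi : ∀ i ∈ Finset.range (step 𝔥 - 1),
          ‖coord 𝔥 (s ^ (i + 1 + 1) • S.proj (i + 1) (log (b j)))‖ ≤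
            D * (s ^ 2 * (wordNorm T (b j) : ℝ) ^ 2) := by
        intro i hi
        have := Finset.mem_range.1 hi
        rw [map_smul, norm_smul, Real.norm_eq_abs, abs_of_nonneg (by positivity)]
        calc s ^ (i + 1 + 1) * ‖coord 𝔥 (S.proj (i + 1) (log (b j)))‖
            ≤ s ^ (i + 1 + 1) * (D * (wordNorm T (b j) : ℝ) ^ (i + 1 + 1)) := by
              gcongr
              exact hproj _ _ (by lia)
          _ = D * ((wordNorm T (b j) : ℝ) * s) ^ (i + 1 + 1) := by rw [mul_pow]; ring
          _ ≤ D * ((wordNorm T (b j) : ℝ) * s) ^ 2 := mul_le_mul_of_nonneg_left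
              (pow_le_pow_of_le_one (by positivity) (hWle j hj) (show 2 ≤ i + 1 + 1 by lia)) hD
          _ = D * (s ^ 2 * (wordNorm T (b j) : ℝ) ^ 2) := by rw [mul_pow]; ring
      refine (norm_sum_le_of_le _ hi).trans ?_
      rw [Finset.sum_const, Finset.card_range, nsmul_eq_mul, mul_assoc]
      gcongr
      rw [hc]
      exact_mod_cast Nat.sub_le _ _
  have hsum : ∑ j ∈ Finset.range k, ‖coord 𝔥 (S.dil s (log (b j)) - (s * τ j) • a)‖ ≤ η * K := by
    calc _ ≤ ∑ j ∈ Finset.range k, (s * ‖coord 𝔥 (S.projAb (log (b j))) - τ j • coord 𝔥 a‖ +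
        c * D * (s ^ 2 * (wordNorm T (b j) : ℝ) ^ 2)) :=
          Finset.sum_le_sum fun j hj => hterm j (Finset.mem_range.1 hj)
      _ = s * ∑ j ∈ Finset.range k, ‖coord 𝔥 (S.projAb (log (b j))) - τ j • coord 𝔥 a‖ +
        c * D * (s ^ 2 * ∑ j ∈ Finset.range k, (wordNorm T (b j) : ℝ) ^ 2) := by
          rw [Finset.sum_add_distrib, Finset.mul_sum, Finset.mul_sum, Finset.mul_sum]
      _ ≤ s * (η * n) + c * D * (s ^ 2 * (η * (n : ℝ) ^ 2)) := by gcongr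
      _ = η * K := by rw [hs, hK]; field_simp
  have hτs : ∑ j ∈ Finset.range k, s * τ j = 1 := by
    rw [← Finset.mul_sum, hτn, hs]; field_simp
  have h := hest s ⟨hs0, hs1⟩ (fun j => s * τ j) (fun j => S.dil s (log (b j)))
    (fun j => S.dil s (log (P j))) k (fun j => mul_nonneg hs0 (hτ j))
    (by simp [hP0, log_one hlog, ← S.dilLin_apply])
    (fun j hj => by rw [hP j hj, hlog, S.dil_lieMul]) hτs.le (hsum.trans hηη₀)
  rw [hτs, one_smul] at h
  refine h.trans_lt (lt_of_le_of_lt ?_ hηε)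
  gcongr

variable {Γ X : Type*} [Group Γ] [MeasurableSpace X] {m : Measure X} [MulAction Γ X]
  {α : Γ → X → Λ}

theorem IsIntegrableCocycle.measurable_comp [Countable Λ] (hα : IsIntegrableCocycle m T α) (g : Γ)
    (φ : Λ → ℝ) : Measurable fun x => φ (α g x) := by
  let _ : MeasurableSpace Λ := ⊤
  have h : Measurable (α g) := measurable_to_countable' fun l => hα.measurable g l
  exact (measurable_from_top (f := φ)).comp h

theorem IsIntegrableCocycle.integrable_comp [IsFiniteMeasure m] [Countable Λ]
    (hα : IsIntegrableCocycle m T α) (g : Γ) {φ : Λ → ℝ} {C D : ℝ}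
    (hφ : ∀ l, |φ l| ≤ C * wordNorm T l + D) : Integrable (fun x => φ (α g x)) m := by
  refine (((hα.integrable g).const_mul C).add (integrable_const D)).mono'
    (hα.measurable_comp g φ).aestronglyMeasurable (ae_of_all _ fun x => ?_)
  rw [Real.norm_eq_abs]
  exact hφ _

theorem IsIntegrableCocycle.apply_one (hα : IsIntegrableCocycle m T α) :
    ∀ᵐ x ∂m, α 1 x = 1 := by
  filter_upwards [hα.cocycle 1 1] with x hx
  rwa [mul_one, one_smul, right_eq_mul] at hx

theorem exists_norm_projAb_log_le (hT : Subgroup.closure (T : Set Λ) = ⊤) {log : Λ → 𝔥}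
    (hlog : ∀ a b, log (a * b) = lieMul (log a) (log b)) :
    ∃ C : ℝ, ∀ l, ‖coord 𝔥 (S.projAb (log l))‖ ≤ C * wordNorm T l := by
  obtain ⟨C, hC, h⟩ := exists_norm_proj_log_le S hT hlog
  refine ⟨C, fun l => ?_⟩
  rcases Nat.eq_zero_or_pos (step 𝔥) with h0 | h0
  · rw [Splitting.projAb, S.proj_eq_zero h0.le, map_zero, norm_zero]
    positivity
  · simpa [Splitting.projAb] using h l 0 h0

/-- The rescaled cocycle converges in probability, in coordinates. -/
theorem eventually_norm_scaled_cocycle_lt [IsProbabilityMeasure m] [Group.IsNilpotent Γ]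
    [MeasurableConstSMul Γ X] [ErgodicSMul Γ X m] (hT : Subgroup.closure (T : Set Λ) = ⊤)
    (hα : IsIntegrableCocycle m T α) {log : Λ → 𝔥}
    (hlog : ∀ a b, log (a * b) = lieMul (log a) (log b)) (γ : Γ) (a : 𝔥)
    (ha : ∀ i, coord 𝔥 a i = ∫ x, coord 𝔥 (S.projAb (log (α γ x))) i ∂m)
    {ε δ : ℝ} (hε : 0 < ε) (hδ : 0 < δ) :
    ∀ᶠ n : ℕ in atTop, ∃ B : Set X, m.real B ≤ δ ∧ ∀ᵐ x ∂m, x ∉ B →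
      ‖coord 𝔥 (S.dil (1 / (n : ℝ)) (log (α (γ ^ n) x)) - a)‖ < ε := by
  have hcount := countable_of_closure_eq_top hT
  obtain ⟨C, hC⟩ := exists_norm_projAb_log_le S hT hlog
  obtain ⟨η, hη, hη1, hblock⟩ := exists_block_estimate S hT hlog a hε
  have hβint : ∀ g i, Integrable (fun x => coord 𝔥 (S.projAb (log (α g x))) i) m := fun g i =>
    hα.integrable_comp g (φ := fun l => coord 𝔥 (S.projAb (log l)) i) (C := C) (D := 0) fun l => by
      rw [add_zero, ← Real.norm_eq_abs]
      exact (norm_le_pi_norm _ i).trans (hC l)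
  have hcoc : ∀ i g h, ∀ᵐ x ∂m, coord 𝔥 (S.projAb (log (α (g * h) x))) i =
      coord 𝔥 (S.projAb (log (α g (h • x)))) i + coord 𝔥 (S.projAb (log (α h x))) i := by
    intro i g h
    filter_upwards [hα.cocycle g h] with x hx
    rw [hx, hlog, S.projAb_lieMul, map_add, Pi.add_apply]
  let A : ℕ → X → ℝ := fun l x => ‖coord 𝔥 (S.projAb (log (α (γ ^ l) x))) - (l : ℝ) • coord 𝔥 a‖
  have hA0 : ∀ l x, 0 ≤ A l x := fun l x => norm_nonneg _
  have hAint : ∀ l, Integrable (A l) m := fun l =>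
    hα.integrable_comp (γ ^ l) (φ := fun g => ‖coord 𝔥 (S.projAb (log g)) - (l : ℝ) • coord 𝔥 a‖)
      (C := C) (D := ‖(l : ℝ) • coord 𝔥 a‖) fun g => by
        rw [abs_of_nonneg (norm_nonneg _)]
        exact (norm_sub_le _ _).trans (by linarith [hC g])
  -- The block length, chosen so that the mean discrepancy of one block is a small fraction of `l`.
  -- Of the mean `η * δ / 2 * n` allowed by Markov's inequality, half goes to the full blocks and
  -- half to the remainder.
  obtain ⟨l, hl1, hl⟩ : ∃ l : ℕ, 1 ≤ l ∧ ∫ x, A l x ∂m ≤ η * δ / 4 * l := by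
    have h1 : Tendsto (fun n : ℕ => ∑ i, ∫ x, |(n : ℝ)⁻¹ * coord 𝔥 (S.projAb (log (α (γ ^ n) x))) i -
        ∫ y, coord 𝔥 (S.projAb (log (α γ y))) i ∂m| ∂m) atTop
        (𝓝 (∑ _i : Fin (Module.finrank ℝ 𝔥), (0 : ℝ))) :=
      tendsto_finsetSum _ fun i _ => tendsto_integral_mean_cocycle
        (fun g x => coord 𝔥 (S.projAb (log (α g x))) i) (fun g => hβint g i) (hcoc i) γ
    rw [Finset.sum_const_zero] at h1
    obtain ⟨l, hl, hl1⟩ := ((h1.eventually_lt_const (show 0 < η * δ / 4 by positivity)).and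
      (eventually_ge_atTop 1)).exists
    refine ⟨l, hl1, ?_⟩
    have hl0 : (0 : ℝ) < l := by exact_mod_cast hl1
    have hi : ∀ i ∈ Finset.univ, Integrable (fun x => |(l : ℝ)⁻¹ *
        coord 𝔥 (S.projAb (log (α (γ ^ l) x))) i -
          ∫ y, coord 𝔥 (S.projAb (log (α γ y))) i ∂m|) m := fun i _ =>
      (((hβint _ i).const_mul _).sub (integrable_const _)).abs
    rw [← integral_finsetSum _ hi] at hl
    have h2 : ∫ x, A l x ∂m ≤ ∫ x, l * ∑ i, |(l : ℝ)⁻¹ *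
        coord 𝔥 (S.projAb (log (α (γ ^ l) x))) i -
          ∫ y, coord 𝔥 (S.projAb (log (α γ y))) i ∂m| ∂m := by
      refine integral_mono (hAint l) ((integrable_finsetSum _ hi).const_mul _) fun x => ?_
      refine (pi_norm_le_iff_of_nonneg (mul_nonneg hl0.le
        (Finset.sum_nonneg fun i _ => abs_nonneg _))).2 fun i => ?_
      rw [Pi.sub_apply, Pi.smul_apply, ha, smul_eq_mul, Real.norm_eq_abs]
      calc |coord 𝔥 (S.projAb (log (α (γ ^ l) x))) i -
            l * ∫ y, coord 𝔥 (S.projAb (log (α γ y))) i ∂m|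
          = l * |(l : ℝ)⁻¹ * coord 𝔥 (S.projAb (log (α (γ ^ l) x))) i -
            ∫ y, coord 𝔥 (S.projAb (log (α γ y))) i ∂m| := by
            conv_rhs => rw [← abs_of_nonneg hl0.le]
            rw [← abs_mul, abs_of_nonneg hl0.le, mul_sub, mul_inv_cancel_left₀ hl0.ne']
        _ ≤ _ := by
            gcongr
            exact Finset.single_le_sum (f := fun i => |(l : ℝ)⁻¹ *
              coord 𝔥 (S.projAb (log (α (γ ^ l) x))) i -
                ∫ y, coord 𝔥 (S.projAb (log (α γ y))) i ∂m|) (fun i _ => abs_nonneg _)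
              (Finset.mem_univ i)
    rw [integral_const_mul] at h2
    rw [mul_comm]
    exact h2.trans (by gcongr)
  have hl0 : (0 : ℝ) < l := by exact_mod_cast hl1
  -- One stationary function dominates the norms of the full blocks and of the last, shorter one.
  let f : X → ℝ := fun x => ∑ r ∈ Finset.range (l + 1), (wordNorm T (α (γ ^ r) x) : ℝ)
  have hf0 : ∀ x, 0 ≤ f x := fun x => Finset.sum_nonneg fun r _ => Nat.cast_nonneg _
  have hf : Integrable f m := integrable_finsetSum _ fun r _ => hα.integrable _
  have hfle : ∀ r ≤ l, ∀ x, (wordNorm T (α (γ ^ r) x) : ℝ) ≤ f x := fun r hr x =>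
    Finset.single_le_sum (f := fun r => (wordNorm T (α (γ ^ r) x) : ℝ))
      (fun r _ => Nat.cast_nonneg _) (Finset.mem_range.2 (by lia))
  -- Dominates the discrepancy of the last block whatever its length; its mean does not depend on
  -- `n`, hence is negligible for `n ≥ N`.
  let g : X → ℝ := fun x => ∑ r ∈ Finset.range l, A r x
  have hg0 : ∀ x, 0 ≤ g x := fun x => Finset.sum_nonneg fun r _ => hA0 r x
  have hg : Integrable g m := integrable_finsetSum _ fun r _ => hAint r
  let σ : ℕ → X → X := fun j x => γ ^ (l * j) • x
  have hσ : ∀ j, MeasurePreserving (σ j) m m := fun j => measurePreserving_smul _ m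
  obtain ⟨N, hN⟩ := exists_nat_ge (4 * (∫ x, g x ∂m) / (η * δ))
  filter_upwards [eventually_sum_sq_le hf0 hf hσ hη (half_pos hδ), eventually_ge_atTop (max 1 N)]
    with n hB₁ hn
  have hn1 : 1 ≤ n := (le_max_left _ _).trans hn
  have hn0 : (0 : ℝ) < n := by exact_mod_cast hn1
  have hnN : (N : ℝ) ≤ n := by exact_mod_cast (le_max_right _ _).trans hn
  obtain ⟨B₁, hB₁δ, hB₁⟩ := hB₁
  set q := n / l with hq
  set r := n % l with hr
  have hqr : l * q + r = n := Nat.div_add_mod n l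
  have hrl : r < l := Nat.mod_lt _ (by lia)
  have hqn : q ≤ n := Nat.div_le_self _ _
  let h : X → ℝ := fun x => ∑ j ∈ Finset.range q, A l (σ j x) + g (σ q x)
  have hAσ : ∀ j ∈ Finset.range q, Integrable (fun x => A l (σ j x)) m := fun j _ =>
    (hσ j).integrable_comp_of_integrable (hAint l)
  have hgσ : Integrable (fun x => g (σ q x)) m := (hσ q).integrable_comp_of_integrable hg
  have hinteg : ∫ x, h x ∂m ≤ η * δ / 2 * n := by
    have h1 : ∫ x, h x ∂m = q * ∫ x, A l x ∂m + ∫ x, g x ∂m := by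
      rw [integral_add (integrable_finsetSum _ hAσ) hgσ, integral_finsetSum _ hAσ,
        integral_comp_measurePreserving (hσ q) hg, Finset.sum_congr rfl fun j _ =>
          integral_comp_measurePreserving (hσ j) (hAint l)]
      simp
    have h2 : (q : ℝ) * l ≤ n := by
      rw [← hqr]; push_cast; nlinarith [Nat.cast_nonneg (α := ℝ) r]
    have h3 : ∫ x, g x ∂m ≤ η * δ / 4 * n := by
      have h4 := hN.trans hnN
      rw [div_le_iff₀ (by positivity)] at h4
      linarith
    have h5 : (q : ℝ) * ∫ x, A l x ∂m ≤ η * δ / 4 * n := by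
      calc (q : ℝ) * ∫ x, A l x ∂m ≤ q * (η * δ / 4 * l) := by gcongr
        _ = η * δ / 4 * (q * l) := by ring
        _ ≤ η * δ / 4 * n := by gcongr
    rw [h1]
    linarith
  refine ⟨B₁ ∪ {x | η * n ≤ h x}, ?_, ?_⟩
  · have h1 := measureReal_ge_le (m := m) (f := h) (ε := η * n)
      (fun x => add_nonneg (Finset.sum_nonneg fun j _ => hA0 _ _) (hg0 _))
      ((integrable_finsetSum _ hAσ).add hgσ) (by positivity)
    have h2 : (∫ x, h x ∂m) / (η * n) ≤ δ / 2 := by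
      rw [div_le_iff₀ (by positivity)]
      linarith
    have h3 := measureReal_union_le (μ := m) B₁ {x | η * n ≤ h x}
    linarith
  · have hall : ∀ᵐ x ∂m, ∀ j : ℕ, α (γ ^ (l * (j + 1))) x = α (γ ^ l) (σ j x) * α (γ ^ (l * j)) x := by
      rw [ae_all_iff]
      intro j
      filter_upwards [hα.cocycle (γ ^ l) (γ ^ (l * j))] with x hx
      rw [← hx, ← pow_add]
      congr 2
      ring
    have hlast : ∀ᵐ x ∂m, α (γ ^ n) x = α (γ ^ r) (σ q x) * α (γ ^ (l * q)) x := by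
      filter_upwards [hα.cocycle (γ ^ r) (γ ^ (l * q))] with x hx
      rw [← hx, ← pow_add, add_comm r, hqr]
    filter_upwards [hall, hlast, hα.apply_one] with x hx hxl hx1 hxB
    rw [Set.mem_union, not_or, Set.mem_ofPred_eq, not_le] at hxB
    -- There are `q` blocks of weight `l` and a last one of weight `r`, so that the weights add up
    -- to `n` and the final partial product is `α (γ ^ n) x`.
    have key := hblock n (q + 1)
      (fun j => if j < q then α (γ ^ l) (σ j x) else α (γ ^ r) (σ q x))
      (fun j => if j ≤ q then α (γ ^ (l * j)) x else α (γ ^ n) x)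
      (fun j => if j < q then (l : ℝ) else r) hn1 (by simpa using hx1) (fun j hj => ?_)
      (fun j => by positivity) ?_ ?_ ?_
    · simpa using key
    · rcases Nat.lt_succ_iff_lt_or_eq.1 hj with hj | rfl
      · simp only [hj, hj.le, if_true, show j + 1 ≤ q from hj, hx]
      · simp [hxl]
    · rw [Finset.sum_range_succ, if_neg (lt_irrefl q), Finset.sum_congr rfl
        fun j hj => if_pos (Finset.mem_range.1 hj), Finset.sum_const, Finset.card_range,
        nsmul_eq_mul, ← hqr]
      push_cast
      ring
    · rw [Finset.sum_range_succ]
      simp only [lt_irrefl, if_false]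
      rw [Finset.sum_congr rfl (g := fun j => A l (σ j x))
        fun j hj => by simp only [Finset.mem_range.1 hj, if_true, A]]
      refine le_trans ?_ hxB.2.le
      simp only [h]
      gcongr
      exact Finset.single_le_sum (f := fun r => A r (σ q x)) (fun r _ => hA0 _ _)
        (Finset.mem_range.2 hrl)
    · refine le_trans ?_ (hB₁ x hxB.1)
      calc _ ≤ ∑ j ∈ Finset.range (q + 1), f (σ j x) ^ 2 := by
            refine Finset.sum_le_sum fun j hj => ?_
            refine pow_le_pow_left₀ (Nat.cast_nonneg _) ?_ 2
            split_ifs with hjq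
            · exact hfle l le_rfl _
            · have : j = q := by have := Finset.mem_range.1 hj; lia
              subst this
              exact hfle r hrl.le _
        _ ≤ ∑ j ∈ Finset.range (n + 1), f (σ j x) ^ 2 :=
            Finset.sum_le_sum_of_subset_of_nonneg (Finset.range_mono (by lia))
              fun j _ _ => sq_nonneg _

end Main

/-! ### The group law of `H_∞` -/

section Algebra

variable {𝔥 : Type*} [LieRing 𝔥] [LieAlgebra ℝ 𝔥] [LieRing.IsNilpotent 𝔥] (S : Splitting 𝔥)

theorem scaledMul_zero_left (s : ℝ) (y : 𝔥) : S.scaledMul s 0 y = y :=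
  (S.isNilpotentBracket_scaledBracket s).bch_zero_left y

theorem scaledMul_zero_right (s : ℝ) (x : 𝔥) : S.scaledMul s x 0 = x :=
  (S.isNilpotentBracket_scaledBracket s).bch_zero_right x

theorem scaledMul_neg_left (s : ℝ) (x : 𝔥) : S.scaledMul s (-x) x = 0 :=
  (S.isNilpotentBracket_scaledBracket s).bch_neg_left x

theorem scaledMul_neg_right (s : ℝ) (x : 𝔥) : S.scaledMul s x (-x) = 0 :=
  (S.isNilpotentBracket_scaledBracket s).bch_neg_right x

theorem scaledMul_smul_smul (s : ℝ) (a b : ℝ) (x : 𝔥) :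
    S.scaledMul s (a • x) (b • x) = (a + b) • x :=
  (S.isNilpotentBracket_scaledBracket s).bch_smul_smul a b x

/-- The `i`-th component of a product determines that of the right factor, given the previous
ones. -/
theorem proj_scaledMul (s : ℝ) (i : ℕ) (x y : 𝔥) :
    S.proj i (S.scaledMul s x y) = S.proj i y + S.proj i
      (S.scaledMul s x (∑ j ∈ Finset.range i, S.proj j y) - ∑ j ∈ Finset.range i, S.proj j y) := by
  have H := S.isNilpotentBracket_scaledBracket s
  set t := ∑ j ∈ Finset.range i, S.proj j y with ht
  have hmem : y - t ∈ lcsFiltration 𝔥 i := by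
    refine S.mem_lcsFiltration fun j hj => ?_
    rw [map_sub, ht, map_sum]
    simp only [S.proj_proj, Finset.sum_ite_eq', Finset.mem_range, hj, if_true, sub_self]
  have h1 := S.proj_eq_zero_of_lt (Nat.lt_succ_self i)
    (H.bchTail_sub_mem (x := x) (x' := x) (by rw [sub_self]; exact Submodule.zero_mem _) hmem)
  rw [Splitting.scaledMul, Splitting.scaledMul, H.bch_eq_add_bchTail x y, H.bch_eq_add_bchTail x t]
  rw [map_sub, sub_eq_zero] at h1
  simp only [map_add, map_sub, h1]
  abel

end Algebra

/-! ### Associativity in `H_∞` as a limit of the group law of `Λ` -/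

section GroupLaw

theorem tendsto_uncurried {A ι : Type*} [TopologicalSpace A] {G : ℝ → A → A → A}
    (hG : Continuous fun z : ℝ × A × A => G z.1 z.2.1 z.2.2) {f : Filter ι} {s : ι → ℝ} {x y : ι → A}
    {s₀ : ℝ} {x₀ y₀ : A} (hs : Tendsto s f (𝓝 s₀)) (hx : Tendsto x f (𝓝 x₀))
    (hy : Tendsto y f (𝓝 y₀)) : Tendsto (fun n => G (s n) (x n) (y n)) f (𝓝 (G s₀ x₀ y₀)) :=
  (hG.tendsto (s₀, x₀, y₀)).comp (hs.prodMk_nhds (hx.prodMk_nhds hy))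

variable {𝔥 : Type*} [LieRing 𝔥] [LieAlgebra ℝ 𝔥] [FiniteDimensional ℝ 𝔥]
  [TopologicalSpace 𝔥] [IsTopologicalAddGroup 𝔥] [ContinuousSMul ℝ 𝔥] [T2Space 𝔥]
  (S : Splitting 𝔥)

theorem tendsto_scaledMul {ι : Type*} {f : Filter ι} {s : ι → ℝ} {x y : ι → 𝔥} {s₀ : ℝ} {x₀ y₀ : 𝔥}
    (hs : Tendsto s f (𝓝 s₀)) (hx : Tendsto x f (𝓝 x₀)) (hy : Tendsto y f (𝓝 y₀)) :
    Tendsto (fun n => S.scaledMul (s n) (x n) (y n)) f (𝓝 (S.scaledMul s₀ x₀ y₀)) :=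
  tendsto_uncurried (G := S.scaledMul) (continuous_scaledMul S) hs hx hy

theorem tendsto_proj {ι : Type*} {f : Filter ι} {x : ι → 𝔥} {x₀ : 𝔥} (i : ℕ)
    (hx : Tendsto x f (𝓝 x₀)) : Tendsto (fun n => S.proj i (x n)) f (𝓝 (S.proj i x₀)) :=
  ((S.proj i).continuous_of_finiteDimensional.tendsto x₀).comp hx

theorem tendsto_dil {ι : Type*} {f : Filter ι} {x : ι → 𝔥} {x₀ : 𝔥} (t : ℝ)
    (hx : Tendsto x f (𝓝 x₀)) : Tendsto (fun n => S.dil t (x n)) f (𝓝 (S.dil t x₀)) := by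
  have := ((S.dilLin t).continuous_of_finiteDimensional.tendsto x₀).comp hx
  simpa only [Function.comp_def, S.dilLin_apply] using this

theorem continuous_sumNorm : Continuous (sumNorm S) :=
  continuous_finsetSum _ fun i _ =>
    ((continuous_coord.comp (S.proj i).continuous_of_finiteDimensional)).norm

variable [LieRing.IsNilpotent 𝔥]

/-- Cancelling `x n` would require associativity, which is not yet available. Instead
`proj_scaledMul` recovers each component of `y n` from the earlier ones; no bound on `y n` is
assumed. -/
theorem tendsto_of_scaledMul_eq {ι : Type*} {f : Filter ι} {s : ι → ℝ} {x y : ι → 𝔥} {z : 𝔥}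
    (hs : Tendsto s f (𝓝 0)) (hx : Tendsto x f (𝓝 0))
    (h : ∀ᶠ n in f, S.scaledMul (s n) (x n) (y n) = z) : Tendsto y f (𝓝 z) := by
  have key : ∀ i, Tendsto (fun n => ∑ j ∈ Finset.range i, S.proj j (y n)) f
      (𝓝 (∑ j ∈ Finset.range i, S.proj j z)) := by
    intro i
    induction i with
    | zero => simp only [Finset.range_zero, Finset.sum_empty]; exact tendsto_const_nhds
    | succ i ih =>
      simp only [Finset.sum_range_succ]
      refine ih.add ?_
      have h1 := tendsto_proj S i ((tendsto_scaledMul S hs hx ih).sub ih)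
      rw [scaledMul_zero_left, sub_self, map_zero] at h1
      have h2 : Tendsto (fun n => S.proj i z - S.proj i (S.scaledMul (s n) (x n)
          (∑ j ∈ Finset.range i, S.proj j (y n)) - ∑ j ∈ Finset.range i, S.proj j (y n))) f
          (𝓝 (S.proj i z)) := by
        simpa using tendsto_const_nhds.sub h1
      refine h2.congr' ?_
      filter_upwards [h] with n hn
      rw [← hn, proj_scaledMul, add_sub_cancel_right]
  simpa only [S.sum_proj] using key (step 𝔥)

/-- The rescalings of a cocompact subgroup become dense. -/
theorem exists_tendsto_dil_log {Λ : Type*} [Group Λ] {log : Λ → 𝔥} (hlog : IsMalcevCompletion log)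
    (x : 𝔥) :
    ∃ l : ℕ → Λ, Tendsto (fun n : ℕ => S.dil (1 / (n : ℝ)) (log (l n))) atTop (𝓝 x) := by
  obtain ⟨K, hK, hKl⟩ := hlog.cocompact
  choose k hk l hl using hKl
  -- Cocompactness writes `δ_n x` as an element of the compact set `K` times a lattice element, and
  -- `δ_{1/n}` contracts the former to `0`.
  refine ⟨fun n => l (S.dil n x), ?_⟩
  have hs : Tendsto (fun n : ℕ => 1 / (n : ℝ)) atTop (𝓝 0) := tendsto_one_div_atTop_nhds_zero_nat
  obtain ⟨M, hM⟩ := hK.exists_bound_of_continuousOn (continuous_sumNorm S).continuousOn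
  refine tendsto_of_scaledMul_eq S (x := fun n : ℕ => S.dil (1 / (n : ℝ)) (k (S.dil n x))) hs ?_ ?_
  · have h1 : Tendsto (fun n : ℕ => coord 𝔥 (S.dil (1 / (n : ℝ)) (k (S.dil n x)))) atTop (𝓝 0) := by
      refine squeeze_zero_norm' (a := fun n : ℕ => 1 / (n : ℝ) * M) ?_ (by simpa using hs.mul_const M)
      filter_upwards [eventually_ge_atTop 1] with n hn
      have hn1 : (1 : ℝ) ≤ n := by exact_mod_cast hn
      refine (norm_coord_dil_le S (by positivity) ((div_le_one (by positivity)).2 hn1) _).trans ?_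
      gcongr
      exact (le_abs_self _).trans (hM _ (hk _))
    have h2 := (continuous_coord_symm.tendsto _).comp h1
    simpa only [Function.comp_def, LinearEquiv.symm_apply_apply, map_zero] using h2
  · filter_upwards [eventually_ge_atTop 1] with n hn
    have hn0 : (n : ℝ) ≠ 0 := by positivity
    rw [← S.dil_lieMul, ← hl, S.dil_dil, one_div_mul_cancel hn0, S.dil_one]

/-- The identity holds on `log Λ` by the group law of `Λ`. The rescalings of `log Λ` approximate
every point, and the rescaled products converge to that of `H_∞`. -/
theorem scaledMul_zero_assoc {Λ : Type*} [Group Λ] {log : Λ → 𝔥} (hlog : IsMalcevCompletion log)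
    (x y z : 𝔥) :
    S.scaledMul 0 (S.scaledMul 0 x y) z = S.scaledMul 0 x (S.scaledMul 0 y z) := by
  obtain ⟨a, ha⟩ := exists_tendsto_dil_log S hlog x
  obtain ⟨b, hb⟩ := exists_tendsto_dil_log S hlog y
  obtain ⟨c, hc⟩ := exists_tendsto_dil_log S hlog z
  have hs : Tendsto (fun n : ℕ => 1 / (n : ℝ)) atTop (𝓝 0) := tendsto_one_div_atTop_nhds_zero_nat
  have h1 := tendsto_scaledMul S hs (tendsto_scaledMul S hs ha hb) hc
  have h2 := tendsto_scaledMul S hs ha (tendsto_scaledMul S hs hb hc)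
  simp only [← S.dil_lieMul, ← hlog.map_mul] at h1 h2
  simp only [mul_assoc] at h1
  exact tendsto_nhds_unique h1 h2

end GroupLaw

/-! ### Horizontal products exhaust `H_∞` -/

section Reachability

variable {𝔥 : Type*} [LieRing 𝔥] [LieAlgebra ℝ 𝔥]

/-- The product in `H_∞` of a list of horizontal vectors. -/
def prodInf (S : Splitting 𝔥) (l : List (S.V 0)) : 𝔥 :=
  l.foldr (fun v p => S.scaledMul 0 v p) 0

/-- The product of `H_∞` is associative. -/
def IsAssocInf (S : Splitting 𝔥) : Prop :=
  ∀ x y z, S.scaledMul 0 (S.scaledMul 0 x y) z = S.scaledMul 0 x (S.scaledMul 0 y z)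

theorem lcsFiltration_succ (i : ℕ) : lcsFiltration 𝔥 (i + 1) =
    Submodule.span ℝ {u | ∃ x y : 𝔥, y ∈ lcsFiltration 𝔥 i ∧ ⁅x, y⁆ = u} := by
  rw [lcsFiltration, LieModule.lowerCentralSeries_succ, LieSubmodule.lieIdeal_oper_eq_linear_span']
  simp [lcsFiltration]

variable [LieRing.IsNilpotent 𝔥] (S : Splitting 𝔥)

theorem scaledBracket_one (v w : 𝔥) : S.scaledBracket 1 v w = ⁅v, w⁆ := by
  have := S.dil_lie 1 v w
  rwa [S.dil_one, S.dil_one, S.dil_one, eq_comm] at this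

/-- The two brackets agree in the lowest degree `k = a + b + 1`; what remains lies deeper. -/
theorem lie_sub_scaledBracket_zero_mem {i : ℕ} (x : 𝔥) {y : 𝔥} (hy : y ∈ lcsFiltration 𝔥 i) :
    ⁅x, y⁆ - S.scaledBracket 0 x y ∈ lcsFiltration 𝔥 (i + 2) := by
  rw [← scaledBracket_one S, S.scaledBracket_apply, S.scaledBracket_apply]
  simp only [← Finset.sum_sub_distrib]
  refine Submodule.sum_mem _ fun a _ => Submodule.sum_mem _ fun b _ =>
    Submodule.sum_mem _ fun k hk => ?_
  have hk := (Finset.mem_filter.1 hk).2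
  rcases lt_or_ge b i with hb | hb
  · simp only [S.proj_eq_zero_of_lt hb hy, lie_zero, map_zero, smul_zero, sub_zero]
    exact Submodule.zero_mem _
  rcases hk.eq_or_lt with rfl | hk
  · simp only [Nat.sub_self, pow_zero, sub_self]
    exact Submodule.zero_mem _
  · exact Submodule.sub_mem _
      (Submodule.smul_mem _ _ (S.proj_mem_lcsFiltration (by lia) _))
      (Submodule.smul_mem _ _ (S.proj_mem_lcsFiltration (by lia) _))

/-- Comparison with the product of `-u` and `u`, whose higher words sum to `0`: replacing `u` by `g`
on the left alters them only in degree `i + 1`. -/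
theorem neg_scaledMul_sub_mem {i : ℕ} {g u : 𝔥} (h : g - u ∈ lcsFiltration 𝔥 i) :
    S.scaledMul 0 (-g) u - (u - g) ∈ lcsFiltration 𝔥 (i + 1) := by
  have H := S.isNilpotentBracket_scaledBracket 0
  have h1 : bchTail (step 𝔥) 2 (fun v w => S.scaledBracket 0 v w) (-u) u = 0 := by
    have := H.bch_eq_add_bchTail (-u) u
    rwa [H.bch_neg_left, neg_add_cancel, zero_add, eq_comm] at this
  have h2 := H.bchTail_sub_mem (i := i) (x := -g) (x' := -u) (y := u) (y' := u)
    (by rw [neg_sub_neg, ← neg_sub]; exact Submodule.neg_mem _ h)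
    (by rw [sub_self]; exact Submodule.zero_mem _)
  rw [h1, sub_zero] at h2
  rw [Splitting.scaledMul, H.bch_eq_add_bchTail,
    show -g + u + bchTail (step 𝔥) 2 (fun v w => S.scaledBracket 0 v w) (-g) u - (u - g) =
      bchTail (step 𝔥) 2 (fun v w => S.scaledBracket 0 v w) (-g) u by abel]
  exact h2

/-- A group commutator is the bracket up to higher order. -/
theorem commutator_sub_mem {i : ℕ} (x : 𝔥) {y : 𝔥} (hy : y ∈ lcsFiltration 𝔥 i) :
    S.scaledMul 0 (-S.scaledMul 0 y x) (S.scaledMul 0 x y) - S.scaledBracket 0 x y ∈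
      lcsFiltration 𝔥 (i + 2) := by
  have H := S.isNilpotentBracket_scaledBracket 0
  have h1 := H.bch_sub_half_mem (x := x) (y := y) (Or.inr hy)
  have h2 := H.bch_sub_half_mem (x := y) (y := x) (Or.inl hy)
  change S.scaledMul 0 x y - _ ∈ _ at h1
  change S.scaledMul 0 y x - _ ∈ _ at h2
  rw [H.neg x y] at h2
  set p := S.scaledMul 0 x y
  set q := S.scaledMul 0 y x
  have hB : S.scaledBracket 0 x y ∈ lcsFiltration 𝔥 (i + 1) := by
    have := H.mem (H.mem_zero x) hy
    rwa [zero_add] at this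
  -- The symmetric terms cancel and the two halves of the bracket add up.
  have h3 : (p - q) - S.scaledBracket 0 x y ∈ lcsFiltration 𝔥 (i + 2) := by
    have := Submodule.sub_mem _ h1 h2
    have e : p - (x + y + (1 / 2 : ℝ) • S.scaledBracket 0 x y) -
        (q - (y + x + (1 / 2 : ℝ) • -S.scaledBracket 0 x y)) = (p - q) - S.scaledBracket 0 x y := by
      module
    rwa [e] at this
  have h4 : q - p ∈ lcsFiltration 𝔥 (i + 1) := by
    have := Submodule.add_mem _ (lcsFiltration_antitone (show i + 1 ≤ i + 2 by lia) h3) hB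
    rw [sub_add_cancel] at this
    rw [← neg_sub]
    exact Submodule.neg_mem _ this
  have h5 := Submodule.add_mem _ (neg_scaledMul_sub_mem S h4) h3
  rwa [show S.scaledMul 0 (-q) p - (p - q) + (p - q - S.scaledBracket 0 x y) =
    S.scaledMul 0 (-q) p - S.scaledBracket 0 x y by abel] at h5

section Associative

variable {S}

theorem scaledMul_neg_cancel (hS : IsAssocInf S) (x y : 𝔥) :
    S.scaledMul 0 x (S.scaledMul 0 (-x) y) = y := by
  rw [← hS, scaledMul_neg_right, scaledMul_zero_left]

theorem neg_scaledMul (hS : IsAssocInf S) (x y : 𝔥) :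
    -S.scaledMul 0 x y = S.scaledMul 0 (-y) (-x) := by
  have h := scaledMul_neg_cancel hS (-S.scaledMul 0 x y) (S.scaledMul 0 (-y) (-x))
  rwa [neg_neg, hS, scaledMul_neg_cancel hS, scaledMul_neg_right, scaledMul_zero_right] at h

theorem prodInf_append (hS : IsAssocInf S) (l l' : List (S.V 0)) :
    prodInf S (l ++ l') = S.scaledMul 0 (prodInf S l) (prodInf S l') := by
  induction l with
  | nil => simp [prodInf, scaledMul_zero_left]
  | cons v l ih =>
    change S.scaledMul 0 v (prodInf S (l ++ l')) = S.scaledMul 0 (S.scaledMul 0 v (prodInf S l)) _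
    rw [ih, hS]

theorem prodInf_singleton (v : S.V 0) : prodInf S [v] = v := scaledMul_zero_right S 0 _

theorem scaledMul_mem_range_prodInf (hS : IsAssocInf S) {x y : 𝔥} (hx : x ∈ Set.range (prodInf S))
    (hy : y ∈ Set.range (prodInf S)) : S.scaledMul 0 x y ∈ Set.range (prodInf S) := by
  obtain ⟨l, rfl⟩ := hx
  obtain ⟨l', rfl⟩ := hy
  exact ⟨l ++ l', prodInf_append hS l l'⟩

theorem neg_mem_range_prodInf (hS : IsAssocInf S) {x : 𝔥} (hx : x ∈ Set.range (prodInf S)) :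
    -x ∈ Set.range (prodInf S) := by
  obtain ⟨l, rfl⟩ := hx
  induction l with
  | nil => exact ⟨[], by simp [prodInf]⟩
  | cons v l ih =>
    change -S.scaledMul 0 v (prodInf S l) ∈ _
    rw [neg_scaledMul hS]
    exact scaledMul_mem_range_prodInf hS ih ⟨[-v], by rw [prodInf_singleton]; rfl⟩

/-- Modulo deeper terms, a bracket is the group commutator of approximations of its entries, and
sums are products; so horizontal products reach every term of the filtration. -/
theorem exists_prodInf_sub_mem (hS : IsAssocInf S) (i : ℕ) {u : 𝔥} (hu : u ∈ lcsFiltration 𝔥 i) :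
    ∃ g ∈ Set.range (prodInf S), g - u ∈ lcsFiltration 𝔥 (i + 1) := by
  have H := S.isNilpotentBracket_scaledBracket 0
  have hbase : ∀ u, ∃ g ∈ Set.range (prodInf S), g - u ∈ lcsFiltration 𝔥 1 := fun u =>
    ⟨S.proj 0 u, ⟨[⟨S.proj 0 u, S.proj_mem 0 u⟩], prodInf_singleton _⟩,
      S.mem_lcsFiltration fun j hj => by
        obtain rfl : j = 0 := by lia
        rw [map_sub, S.proj_proj, if_pos rfl, sub_self]⟩
  induction i generalizing u with
  | zero => exact hbase u
  | succ i ih =>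
    have hgen : ∀ x y : 𝔥, y ∈ lcsFiltration 𝔥 i →
        ∃ g ∈ Set.range (prodInf S), g - ⁅x, y⁆ ∈ lcsFiltration 𝔥 (i + 2) := by
      intro x y hy
      obtain ⟨a, ha, hax⟩ := hbase x
      obtain ⟨b, hb, hby⟩ := ih hy
      have hb' : b ∈ lcsFiltration 𝔥 i := by
        have := Submodule.add_mem _ (lcsFiltration_antitone (Nat.le_succ i) hby) hy
        rwa [sub_add_cancel] at this
      refine ⟨S.scaledMul 0 (-S.scaledMul 0 b a) (S.scaledMul 0 a b),
        scaledMul_mem_range_prodInf hS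
          (neg_mem_range_prodInf hS (scaledMul_mem_range_prodInf hS hb ha))
          (scaledMul_mem_range_prodInf hS ha hb), ?_⟩
      have h1 := commutator_sub_mem S a hb'
      have h2 := H.mem hax hb'
      have h3 := H.mem (H.mem_zero x) hby
      have h4 := lie_sub_scaledBracket_zero_mem S x hy
      rw [show 1 + i + 1 = i + 2 by lia] at h2
      rw [show 0 + (i + 1) + 1 = i + 2 by lia] at h3
      have h5 := Submodule.sub_mem _ (Submodule.add_mem _ (Submodule.add_mem _ h1 h2) h3) h4
      convert h5 using 1
      simp only [map_sub, LinearMap.sub_apply]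
      abel
    -- All multiples of `u` are treated at once, which makes the scalar case of the span induction
    -- immediate; for a bracket the scalar is absorbed in its second entry.
    have hspan : ∀ t : ℝ, ∃ g ∈ Set.range (prodInf S), g - t • u ∈ lcsFiltration 𝔥 (i + 2) := by
      have hu' := hu
      rw [lcsFiltration_succ] at hu'
      induction hu' using Submodule.span_induction with
      | mem u hu' =>
        obtain ⟨x, y, hy, rfl⟩ := hu'
        intro t
        rw [← lie_smul]
        exact hgen x _ (Submodule.smul_mem _ t hy)
      | zero => exact fun t => ⟨0, ⟨[], rfl⟩, by simp⟩
      | add u v h1 h2 ih1 ih2 =>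
        intro t
        rw [← lcsFiltration_succ] at h1 h2
        obtain ⟨g, hg, hgu⟩ := ih1 h1 t
        obtain ⟨g', hg', hgv⟩ := ih2 h2 t
        refine ⟨S.scaledMul 0 g g', scaledMul_mem_range_prodInf hS hg hg', ?_⟩
        have hgF : g ∈ lcsFiltration 𝔥 (i + 1) := by
          have := Submodule.add_mem _ (lcsFiltration_antitone (Nat.le_succ (i + 1)) hgu)
            (Submodule.smul_mem _ t h1)
          rwa [sub_add_cancel] at this
        have h3 := H.bch_sub_mem (x := g) (y := g') (Or.inl hgF)
        have h4 := Submodule.add_mem _ h3 (Submodule.add_mem _ hgu hgv)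
        convert h4 using 1
        rw [smul_add, Splitting.scaledMul]
        abel
      | smul r v h1 ih1 =>
        intro t
        rw [smul_smul]
        exact ih1 (by rw [lcsFiltration_succ]; exact h1) _
    simpa using hspan 1

/-- Every element of `H_∞` is a product of horizontal elements. -/
theorem prodInf_surjective (hS : IsAssocInf S) : Function.Surjective (prodInf S) := by
  -- Dividing `u` by its approximation leaves an element one degree deeper, and the filtration ends
  -- at `0`.
  have key : ∀ k i, step 𝔥 ≤ i + k → ∀ u ∈ lcsFiltration 𝔥 i, u ∈ Set.range (prodInf S) := by
    intro k
    induction k with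
    | zero =>
      intro i hi u hu
      exact ⟨[], ((S.isNilpotentBracket_scaledBracket 0).eq_zero hi hu).symm⟩
    | succ k ih =>
      intro i hi u hu
      obtain ⟨g, hg, hgu⟩ := exists_prodInf_sub_mem hS i hu
      have h1 := lcsFiltration_antitone (Nat.le_succ (i + 1)) (neg_scaledMul_sub_mem S hgu)
      have h2 := Submodule.sub_mem _ h1 hgu
      rw [show S.scaledMul 0 (-g) u - (u - g) - (g - u) = S.scaledMul 0 (-g) u by abel] at h2
      rw [← scaledMul_neg_cancel hS g u]
      exact scaledMul_mem_range_prodInf hS hg (ih (i + 1) (by lia) _ h2)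
  exact fun u => key (step 𝔥) 0 (by lia) u (by rw [lcsFiltration_zero]; trivial)

end Associative

end Reachability

/-! ### Short horizontal products near the identity -/

section ShortProducts

variable {𝔥 : Type*} [LieRing 𝔥] [LieAlgebra ℝ 𝔥]

/-- The length of the horizontal polygon with the given sides. -/
def cost {S : Splitting 𝔥} (N : Seminorm ℝ (S.V 0)) (l : List (S.V 0)) : ℝ := (l.map N).sum

theorem cost_append {S : Splitting 𝔥} (N : Seminorm ℝ (S.V 0)) (l l' : List (S.V 0)) :
    cost N (l ++ l') = cost N l + cost N l' := by
  simp [cost]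

theorem cost_smul {S : Splitting 𝔥} (N : Seminorm ℝ (S.V 0)) (t : ℝ) (l : List (S.V 0)) :
    cost N (l.map (t • ·)) = |t| * cost N l := by
  simp [cost, Function.comp_def, map_smul_eq_mul, List.sum_map_mul_left]

theorem cost_le {S : Splitting 𝔥} {N : Seminorm ℝ (S.V 0)} {l : List (S.V 0)} {M : ℝ}
    (h : ∀ v ∈ l, N v ≤ M) : cost N l ≤ l.length * M := by
  have := List.sum_le_card_nsmul (l.map N) M (by
    intro x hx
    obtain ⟨v, hv, rfl⟩ := List.mem_map.1 hx
    exact h v hv)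
  simpa [cost] using this

theorem cost_nonneg {S : Splitting 𝔥} (N : Seminorm ℝ (S.V 0)) (l : List (S.V 0)) :
    0 ≤ cost N l :=
  List.sum_nonneg fun x hx => by
    obtain ⟨v, _, rfl⟩ := List.mem_map.1 hx
    exact apply_nonneg N v

theorem dil_prodInf [LieRing.IsNilpotent 𝔥] (S : Splitting 𝔥) (t : ℝ) (l : List (S.V 0)) :
    S.dil t (prodInf S l) = prodInf S (l.map (t • ·)) := by
  induction l with
  | nil => simp [prodInf, ← S.dilLin_apply]
  | cons v l ih =>
    change S.dil t (S.scaledMul 0 v (prodInf S l)) =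
      S.scaledMul 0 (t • (v : 𝔥)) (prodInf S (l.map (t • ·)))
    rw [S.dil_scaledMul_zero, ih]
    congr 1
    refine S.ext_proj fun i _ => ?_
    rw [S.proj_dil, map_smul]
    rcases eq_or_ne i 0 with rfl | hi
    · rw [zero_add, pow_one]
    · rw [S.proj_of_mem_of_ne hi.symm v.2, smul_zero, smul_zero]

theorem exists_seminorm_le [FiniteDimensional ℝ 𝔥] (S : Splitting 𝔥) (N : Seminorm ℝ (S.V 0)) :
    ∃ C : ℝ, 0 ≤ C ∧ ∀ v : S.V 0, N v ≤ C * ‖coord 𝔥 (v : 𝔥)‖ := by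
  let P : 𝔥 →ₗ[ℝ] S.V 0 := (S.proj 0).codRestrict (S.V 0) (S.proj_mem 0)
  refine ⟨∑ i, N (P (Module.finBasis ℝ 𝔥 i)), Finset.sum_nonneg fun i _ => apply_nonneg N _,
    fun v => ?_⟩
  have hv : v = ∑ i, coord 𝔥 (v : 𝔥) i • P (Module.finBasis ℝ 𝔥 i) := by
    have h1 : P (v : 𝔥) = v := Subtype.ext (S.proj_of_mem v.2)
    conv_lhs => rw [← h1, ← (Module.finBasis ℝ 𝔥).sum_equivFun (v : 𝔥)]
    rw [map_sum]
    exact Finset.sum_congr rfl fun i _ => map_smul _ _ _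
  calc N v = N (∑ i, coord 𝔥 (v : 𝔥) i • P (Module.finBasis ℝ 𝔥 i)) := by rw [← hv]
    _ ≤ ∑ i, N (coord 𝔥 (v : 𝔥) i • P (Module.finBasis ℝ 𝔥 i)) :=
        Finset.le_sum_of_subadditive N (map_zero N).le (map_add_le_add N) _ _
    _ ≤ ∑ i, N (P (Module.finBasis ℝ 𝔥 i)) * ‖coord 𝔥 (v : 𝔥)‖ := by
        refine Finset.sum_le_sum fun i _ => ?_
        rw [map_smul_eq_mul, mul_comm]
        exact mul_le_mul_of_nonneg_left (norm_le_pi_norm _ i) (apply_nonneg N _)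
    _ = _ := by rw [Finset.sum_mul]

/-- The products of `k` horizontal elements of norm at most `r`. -/
def boundedProducts [FiniteDimensional ℝ 𝔥] (S : Splitting 𝔥) (r : ℝ) : ℕ → Set 𝔥
  | 0 => {0}
  | k + 1 => (fun z : 𝔥 × 𝔥 => S.scaledMul 0 z.1 z.2) ''
      ({v : 𝔥 | v ∈ S.V 0 ∧ ‖coord 𝔥 v‖ ≤ r} ×ˢ boundedProducts S r k)

theorem mem_boundedProducts [FiniteDimensional ℝ 𝔥] (S : Splitting 𝔥) {r : ℝ} {k : ℕ} {z : 𝔥} : z ∈ boundedProducts S r k ↔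
    ∃ l : List (S.V 0), l.length = k ∧ (∀ v ∈ l, ‖coord 𝔥 (v : 𝔥)‖ ≤ r) ∧ prodInf S l = z := by
  induction k generalizing z with
  | zero =>
    refine ⟨fun h => ⟨[], rfl, by simp, h.symm⟩, ?_⟩
    rintro ⟨l, hl, _, rfl⟩
    rw [List.length_eq_zero_iff] at hl
    subst hl
    exact rfl
  | succ k ih =>
    constructor
    · rintro ⟨⟨v, p⟩, ⟨hv, hp⟩, rfl⟩
      obtain ⟨l, hl, hlr, hlp⟩ := ih.1 hp
      refine ⟨⟨v, hv.1⟩ :: l, by simp [hl], ?_, ?_⟩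
      · simpa using ⟨hv.2, by simpa using hlr⟩
      · change S.scaledMul 0 v (prodInf S l) = S.scaledMul 0 v p
        rw [hlp]
    · rintro ⟨l, hl, hlr, rfl⟩
      obtain ⟨v, l, rfl⟩ := List.exists_cons_of_length_eq_add_one hl
      refine ⟨(v, prodInf S l), ⟨⟨v.2, hlr v (by simp)⟩, ih.2 ⟨l, by simpa using hl,
        fun w hw => hlr w (by simp [hw]), rfl⟩⟩, rfl⟩

variable [FiniteDimensional ℝ 𝔥] [TopologicalSpace 𝔥] [IsTopologicalAddGroup 𝔥]
  [ContinuousSMul ℝ 𝔥] [T2Space 𝔥]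

theorem isCompact_setOf_mem_norm_coord_le (W : Submodule ℝ 𝔥) (r : ℝ) :
    IsCompact {v : 𝔥 | v ∈ W ∧ ‖coord 𝔥 v‖ ≤ r} := by
  have h1 : IsCompact ((coord 𝔥).symm '' Metric.closedBall 0 r) :=
    (isCompact_closedBall _ _).image continuous_coord_symm
  refine (h1.inter_left W.closed_of_finiteDimensional).of_isClosed_subset ?_ ?_
  · exact W.closed_of_finiteDimensional.inter
      (isClosed_le continuous_coord.norm continuous_const)
  · exact fun v hv => ⟨hv.1, coord 𝔥 v, by simpa using hv.2, by simp⟩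

theorem baireSpace_of_finiteDimensional : BaireSpace 𝔥 :=
  (Homeomorph.mk (coord 𝔥).symm.toEquiv continuous_coord_symm continuous_coord).baireSpace

variable (S : Splitting 𝔥)

theorem continuous_scaledMul_zero : Continuous fun z : 𝔥 × 𝔥 => S.scaledMul 0 z.1 z.2 :=
  continuous_iff_continuousAt.2 fun _ =>
    tendsto_scaledMul S tendsto_const_nhds continuous_fst.continuousAt continuous_snd.continuousAt

theorem isCompact_boundedProducts (r : ℝ) (k : ℕ) : IsCompact (boundedProducts S r k) := by
  induction k with
  | zero => exact isCompact_singleton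
  | succ k ih =>
    exact ((isCompact_setOf_mem_norm_coord_le _ _).prod ih).image (continuous_scaledMul_zero S)

variable {S} [LieRing.IsNilpotent 𝔥]

/-- `H_∞` is the countable union of the compact sets of products of `k` horizontal factors of norm
at most `r`. By Baire one of them has an interior point, and a fixed polygon translates it to the
identity. -/
theorem exists_eventually_cost_le (hS : IsAssocInf S) (N : Seminorm ℝ (S.V 0)) :
    ∃ L : ℝ, 0 ≤ L ∧ ∀ᶠ z in 𝓝 (0 : 𝔥), ∃ l : List (S.V 0), prodInf S l = z ∧ cost N l ≤ L := by
  have := baireSpace_of_finiteDimensional (𝔥 := 𝔥)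
  obtain ⟨⟨r, k⟩, z₀, hz₀⟩ := nonempty_interior_of_iUnion_of_closed
    (f := fun p : ℕ × ℕ => boundedProducts S p.1 p.2)
    (fun p => (isCompact_boundedProducts S _ _).isClosed)
    (Set.eq_univ_of_forall fun z => by
      obtain ⟨l, rfl⟩ := prodInf_surjective hS z
      obtain ⟨M, hM⟩ := (l.map fun v => ‖coord 𝔥 (v : 𝔥)‖).toFinset.exists_le
      obtain ⟨r, hr⟩ := exists_nat_ge M
      refine Set.mem_iUnion.2 ⟨(r, l.length), (mem_boundedProducts S).2 ⟨l, rfl, fun v hv => ?_, rfl⟩⟩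
      exact (hM _ (by simpa using ⟨v.1, ⟨v.2, hv⟩, rfl⟩)).trans hr)
  obtain ⟨l₀, hl₀⟩ := prodInf_surjective hS (-z₀)
  obtain ⟨C, hC, hCN⟩ := exists_seminorm_le S N
  refine ⟨cost N l₀ + k * (C * r), add_nonneg (cost_nonneg N l₀) (by positivity), ?_⟩
  have hcont : Tendsto (fun z => S.scaledMul 0 z₀ z) (𝓝 0) (𝓝 z₀) := by
    have := tendsto_scaledMul S (tendsto_const_nhds (x := (0 : ℝ)))
      (tendsto_const_nhds (x := z₀)) (tendsto_id (x := 𝓝 (0 : 𝔥)))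
    rwa [scaledMul_zero_right] at this
  filter_upwards [hcont (mem_interior_iff_mem_nhds.1 hz₀)] with z hz
  obtain ⟨l, hl, hlr, hlp⟩ := (mem_boundedProducts S).1 hz
  refine ⟨l₀ ++ l, ?_, ?_⟩
  · rw [prodInf_append hS, hl₀, hlp, ← hS, scaledMul_neg_left, scaledMul_zero_left]
  · rw [cost_append]
    gcongr
    have := cost_le (N := N) (l := l) (M := C * r) fun v hv => (hCN v).trans (by
      gcongr
      exact hlr v hv)
    rwa [hl] at this

/-- Elements near the identity of `H_∞` are products of short horizontal elements. -/
theorem eventually_cost_le (hS : IsAssocInf S) (N : Seminorm ℝ (S.V 0)) {ε : ℝ} (hε : 0 < ε) :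
    ∀ᶠ z in 𝓝 (0 : 𝔥), ∃ l : List (S.V 0), prodInf S l = z ∧ cost N l ≤ ε := by
  obtain ⟨L, hL, h⟩ := exists_eventually_cost_le hS N
  -- Dilation by `t` multiplies lengths by `t`; the `+ 1` covers `L = 0`.
  set t := ε / (L + 1) with ht
  have ht0 : 0 < t := by positivity
  have hcont : Tendsto (fun z => S.dil t⁻¹ z) (𝓝 0) (𝓝 0) := by
    have := tendsto_dil S t⁻¹ (tendsto_id (x := 𝓝 (0 : 𝔥)))
    simpa only [← S.dilLin_apply, map_zero, id] using this
  filter_upwards [hcont.eventually h] with z hz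
  obtain ⟨l, hl, hlc⟩ := hz
  refine ⟨l.map (t • ·), ?_, ?_⟩
  · rw [← dil_prodInf, hl, S.dil_dil, mul_inv_cancel₀ ht0.ne', S.dil_one]
  · rw [cost_smul, abs_of_pos ht0]
    calc t * cost N l ≤ t * (L + 1) := by gcongr; linarith
      _ = ε := by rw [ht]; field_simp

end ShortProducts

/-! ### Polygonal horizontal curves -/

section Curves

/-- The target is only a topological vector space, as `𝔥` is, so the chain rule goes through the
norm-free form of little-o. -/
theorem hasDerivAt_continuousLinearMap_comp {E F : Type*} [NormedAddCommGroup E] [NormedSpace ℝ E]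
    [AddCommGroup F] [Module ℝ F] [TopologicalSpace F] [ContinuousSMul ℝ F] (L : E →L[ℝ] F)
    {f : ℝ → E} {w : E} {t : ℝ} (h : HasDerivAt f w t) :
    HasDerivAt (fun s => L (f s)) (L w) t := by
  refine HasFDerivAtFilter.of_isLittleOTVS ((L.isBigOTVS_fun_comp.trans_isLittleOTVS
    (HasFDerivAtFilter.isLittleOTVS h)).congr_left fun p => ?_)
  simp

theorem differentiableAt_uncurried_smul {E : Type*} [NormedAddCommGroup E] [NormedSpace ℝ E]
    {G : ℝ → E → E → E} (hG : Differentiable ℝ fun z : ℝ × E × E => G z.1 z.2.1 z.2.2) (s : ℝ)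
    (x v : E) (t : ℝ) : DifferentiableAt ℝ (fun τ : ℝ => G s x (τ • v)) t := by
  have h1 : Differentiable ℝ fun τ : ℝ => (s, x, τ • v) := by fun_prop
  exact (hG _).comp t (h1 t)

variable {𝔥 : Type*} [LieRing 𝔥] [LieAlgebra ℝ 𝔥] [FiniteDimensional ℝ 𝔥]

theorem exists_hasDerivAt_coord_segment (S : Splitting 𝔥) (h v : 𝔥) (t : ℝ) :
    ∃ w, HasDerivAt (fun τ : ℝ => coord 𝔥 (S.scaledMul 0 h (τ • v))) w t := by
  have hd : DifferentiableAt ℝ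
      (fun τ : ℝ => coordMul S 0 (coord 𝔥 h) (τ • coord 𝔥 v)) t :=
    differentiableAt_uncurried_smul (G := coordMul S)
      ((contDiff_coordMul S (n := 1)).differentiable one_ne_zero) 0 _ _ t
  refine ⟨_, (hd.hasDerivAt).congr_of_eventuallyEq (Eventually.of_forall fun τ => ?_)⟩
  simp only [← map_smul, coordMul_coord]

variable [TopologicalSpace 𝔥] [IsTopologicalAddGroup 𝔥] [ContinuousSMul ℝ 𝔥]

theorem hasDerivAt_of_coord {f : ℝ → 𝔥} {w : Fin (Module.finrank ℝ 𝔥) → ℝ} {t : ℝ}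
    (h : HasDerivAt (fun s => coord 𝔥 (f s)) w t) : HasDerivAt f ((coord 𝔥).symm w) t := by
  have := hasDerivAt_continuousLinearMap_comp
    ⟨(coord 𝔥).symm.toLinearMap, continuous_coord_symm⟩ h
  simpa using this

variable [T2Space 𝔥] [LieRing.IsNilpotent 𝔥] {S : Splitting 𝔥}

/-- A horizontal curve can be continued by a horizontal segment. -/
theorem IsHorizontal.append_segment (hS : IsAssocInf S) {T : ℝ} {c : ℝ → 𝔥} {u : ℝ → S.V 0} {g h : 𝔥}
    (hc : S.IsHorizontal T c u g h) (v : S.V 0) :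
    S.IsHorizontal (T + 1) (fun t => if t ≤ T then c t else S.scaledMul 0 h ((t - T) • (v : 𝔥)))
      (fun t => if t ≤ T then u t else v) g (S.scaledMul 0 h v) := by
  obtain ⟨hT, h0, h1, hcont, F, hF⟩ := hc
  -- The velocity may jump at the junction time `T`, which joins the exceptional set.
  refine ⟨by linarith, by simp [hT, h0], by simp, ?_, insert T F, ?_⟩
  · have e : Set.Icc 0 (T + 1) = Set.Icc 0 T ∪ Set.Icc T (T + 1) :=
      (Set.Icc_union_Icc_eq_Icc hT (by linarith)).symm
    rw [e]
    refine ContinuousOn.union_of_isClosed ?_ ?_ isClosed_Icc isClosed_Icc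
    · exact hcont.congr fun t ht => if_pos ht.2
    · have h2 : Continuous fun t : ℝ => S.scaledMul 0 h ((t - T) • (v : 𝔥)) :=
        continuous_iff_continuousAt.2 fun t => tendsto_scaledMul S tendsto_const_nhds
          tendsto_const_nhds (((continuous_id.sub continuous_const).smul continuous_const).tendsto t)
      refine h2.continuousOn.congr fun t ht => ?_
      rcases ht.1.eq_or_lt with rfl | ht'
      · simp [h1, scaledMul_zero_right]
      · exact if_neg (not_le.2 ht')
  · intro t ht htF
    rw [Finset.mem_insert, not_or] at htF
    rcases lt_or_gt_of_ne htF.1 with hlt | hgt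
    · obtain ⟨w, hw1, hw2⟩ := hF t ⟨ht.1, hlt⟩ htF.2
      refine ⟨w, by simpa only [hlt.le, if_true] using hw1, ?_⟩
      refine HasFDerivAt.congr_of_eventuallyEq hw2 ?_
      filter_upwards [eventually_lt_nhds hlt] with s hs
      exact if_pos hs.le
    · obtain ⟨w, hw⟩ := exists_hasDerivAt_coord_segment S h v (t - T)
      refine ⟨(coord 𝔥).symm w, ?_, ?_⟩
      -- By associativity the left translate of `s • v` to the point at time `t` is again on the
      -- segment, at time `t + s`; so the segment is an integral curve of the left-invariant field
      -- of `v`.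
      · have e : (fun s : ℝ => S.mulInf (if t ≤ T then c t else S.scaledMul 0 h ((t - T) • (v : 𝔥)))
            (s • ((if t ≤ T then u t else v : S.V 0) : 𝔥))) =
            fun s => S.scaledMul 0 h ((t - T + s) • (v : 𝔥)) := by
          funext s
          rw [if_neg (not_le.2 hgt), if_neg (not_le.2 hgt), S.mulInf_eq, hS, scaledMul_smul_smul]
        rw [e]
        exact hasDerivAt_of_coord (HasDerivAt.comp_const_add (t - T) 0
          (f := fun τ : ℝ => coord 𝔥 (S.scaledMul 0 h (τ • (v : 𝔥)))) (by rwa [add_zero]))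
      · have h2 : HasDerivAt (fun s : ℝ => S.scaledMul 0 h ((s - T) • (v : 𝔥)))
            ((coord 𝔥).symm w) t := hasDerivAt_of_coord (HasDerivAt.comp_sub_const t T hw)
        refine HasFDerivAt.congr_of_eventuallyEq h2 ?_
        filter_upwards [eventually_gt_nhds hgt] with s hs
        exact if_neg (not_le.2 hs)

theorem exists_isHorizontal_prodInf (hS : IsAssocInf S) (N : Seminorm ℝ (S.V 0)) (g : 𝔥)
    (l : List (S.V 0)) :
    ∃ T c u, S.IsHorizontal T c u g (S.scaledMul 0 g (prodInf S l)) ∧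
      ∫⁻ t in Set.Ioc 0 T, ENNReal.ofReal (N (u t)) ≤ ENNReal.ofReal (cost N l) := by
  induction l using List.reverseRecOn with
  | nil =>
    refine ⟨0, fun _ => g, fun _ => 0, ⟨le_rfl, rfl, ?_, continuousOn_const, ∅, ?_⟩, by simp⟩
    · exact (scaledMul_zero_right S 0 g).symm
    · intro t ht
      exact absurd (ht.1.trans ht.2) (lt_irrefl 0)
  | append_singleton l v ih =>
    obtain ⟨T, c, u, hc, hle⟩ := ih
    refine ⟨T + 1, fun t => if t ≤ T then c t else
      S.scaledMul 0 (S.scaledMul 0 g (prodInf S l)) ((t - T) • (v : 𝔥)),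
      fun t => if t ≤ T then u t else v, ?_, ?_⟩
    · rw [prodInf_append hS, prodInf_singleton, ← hS]
      exact IsHorizontal.append_segment hS hc v
    · have hT := hc.1
      rw [← Set.Ioc_union_Ioc_eq_Ioc hT (by linarith : T ≤ T + 1), cost_append,
        ENNReal.ofReal_add (cost_nonneg N l) (cost_nonneg N _)]
      refine (lintegral_union_le _ _ _).trans (add_le_add ?_ ?_)
      · refine le_trans (le_of_eq ?_) hle
        refine setLIntegral_congr_fun measurableSet_Ioc fun t ht => ?_
        simp only [ht.2, if_true]
      · rw [setLIntegral_congr_fun (g := fun _ => ENNReal.ofReal (N v)) measurableSet_Ioc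
          fun t ht => by simp only [not_le.2 ht.1, if_false]]
        simp [cost]

theorem ccDist_scaledMul_prodInf_le (hS : IsAssocInf S) (N : Seminorm ℝ (S.V 0)) (g : 𝔥)
    (l : List (S.V 0)) :
    S.ccDist N g (S.scaledMul 0 g (prodInf S l)) ≤ ENNReal.ofReal (cost N l) := by
  obtain ⟨T, c, u, hc, hle⟩ := exists_isHorizontal_prodInf hS N g l
  rw [Splitting.ccDist]
  exact iInf₂_le_of_le T c <| iInf₂_le_of_le u hc hle

end Curves

/-! ### Convergence in `H_∞` -/

section Convergence

variable {𝔥 : Type*} [LieRing 𝔥] [LieAlgebra ℝ 𝔥] [FiniteDimensional ℝ 𝔥]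

theorem coord_averageAb (S : Splitting 𝔥) {Γ Λ X : Type*} [MeasurableSpace X] (m : Measure X)
    (log : Λ → 𝔥) (α : Γ → X → Λ) (γ : Γ) (i : Fin (Module.finrank ℝ 𝔥)) :
    coord 𝔥 (S.averageAb m log α γ) i = ∫ x, coord 𝔥 (S.projAb (log (α γ x))) i ∂m := by
  simp [coord, Splitting.averageAb, Finsupp.single_apply]

variable [TopologicalSpace 𝔥] [IsTopologicalAddGroup 𝔥] [ContinuousSMul ℝ 𝔥]

theorem exists_norm_coord_sub_lt_subset {a : 𝔥} {U : Set 𝔥} (hU : U ∈ 𝓝 a) :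
    ∃ ε > 0, ∀ v, ‖coord 𝔥 (v - a)‖ < ε → v ∈ U := by
  have h1 : (coord 𝔥).symm ⁻¹' U ∈ 𝓝 (coord 𝔥 a) :=
    continuous_coord_symm.continuousAt.preimage_mem_nhds (by simpa using hU)
  obtain ⟨ε, hε, h⟩ := Metric.mem_nhds_iff.1 h1
  refine ⟨ε, hε, fun v hv => ?_⟩
  have := h (show coord 𝔥 v ∈ Metric.ball _ ε by rwa [mem_ball_iff_norm, ← map_sub])
  simpa using this

variable [T2Space 𝔥] [LieRing.IsNilpotent 𝔥] {S : Splitting 𝔥}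

/-- If `δ_{1/n} g` is near `a`, then `g` is within a small multiple of `n` of `δ_n a`. -/
theorem eventually_ccDist_div_lt (hS : IsAssocInf S) (N : Seminorm ℝ (S.V 0)) (a : 𝔥) {ε : ℝ≥0∞}
    (hε : 0 < ε) :
    ∀ᶠ y in 𝓝 a, ∀ (n : ℕ) (g : 𝔥), 1 ≤ n → S.dil (1 / (n : ℝ)) g = y →
      S.ccDist N g (S.dil n a) / n < ε := by
  obtain ⟨δ, hδ0, hδ⟩ := ENNReal.lt_iff_exists_nnreal_btwn.1 hε
  have hδ0' : (0 : ℝ) < δ := by exact_mod_cast hδ0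
  -- For `y` near `a` a short polygon leads from `y` to `a`. Its dilation by `n` leads from `g = δ_n
  -- y` to `δ_n a`, with length multiplied by `n`.
  have hcont : Tendsto (fun y => S.scaledMul 0 (-y) a) (𝓝 a) (𝓝 0) := by
    have := tendsto_scaledMul S (tendsto_const_nhds (x := (0 : ℝ)))
      (continuous_neg.tendsto a) (tendsto_const_nhds (x := a))
    rwa [scaledMul_neg_left] at this
  filter_upwards [hcont.eventually (eventually_cost_le hS N hδ0')] with y hy n g hn hgy
  obtain ⟨l, hl, hlc⟩ := hy
  have hn0 : (n : ℝ) ≠ 0 := by positivity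
  have hg : S.dil n y = g := by
    rw [← hgy, S.dil_dil, mul_one_div_cancel hn0, S.dil_one]
  have h1 := ccDist_scaledMul_prodInf_le hS N g (l.map ((n : ℝ) • ·))
  rw [← dil_prodInf, hl, ← hg, ← S.dil_scaledMul_zero, scaledMul_neg_cancel hS, hg, cost_smul,
    Nat.abs_cast] at h1
  refine lt_of_le_of_lt ?_ hδ
  refine ENNReal.div_le_of_le_mul (h1.trans ?_)
  rw [ENNReal.ofReal_mul (Nat.cast_nonneg n), ENNReal.ofReal_natCast, mul_comm]
  gcongr
  rw [← ENNReal.ofReal_coe_nnreal]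
  exact ENNReal.ofReal_le_ofReal hlc

end Convergence

end NilCocycle
end

theorem propositionp
    {Γ Λ X 𝔥 : Type*}
    [Group Γ] [Group.FG Γ] [Group.IsNilpotent Γ] (hΓ : NilCocycle.TorsionFree Γ)
    [Group Λ] [Group.FG Λ] [Group.IsNilpotent Λ] (hΛ : NilCocycle.TorsionFree Λ)
    (T : Finset Λ) (hT : Subgroup.closure (T : Set Λ) = ⊤)
    [MeasurableSpace X] (m : MeasureTheory.Measure X) [MeasureTheory.IsProbabilityMeasure m]
    [MulAction Γ X] [MeasurableConstSMul Γ X] [ErgodicSMul Γ X m]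
    (α : Γ → X → Λ) (hα : NilCocycle.IsIntegrableCocycle m T α)
    [LieRing 𝔥] [LieAlgebra ℝ 𝔥] [FiniteDimensional ℝ 𝔥] [LieRing.IsNilpotent 𝔥]
    [TopologicalSpace 𝔥] [IsTopologicalAddGroup 𝔥] [ContinuousSMul ℝ 𝔥] [T2Space 𝔥]
    (log : Λ → 𝔥) (hlog : NilCocycle.IsMalcevCompletion log)
    (S : NilCocycle.Splitting 𝔥)
    (N : Seminorm ℝ (S.V 0)) (hN : ∀ v, N v = 0 → v = 0)
    (γ : Γ) :
    NilCocycle.TendstoInProbability m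
        (fun n x => S.dil (1 / (n : ℝ)) (log (α (γ ^ n) x))) (S.averageAb m log α γ) ∧
      NilCocycle.IsLittleOInProbability m
        (fun n x => S.ccDist N (log (α (γ ^ n) x)) (S.dil (n : ℝ) (S.averageAb m log α γ))) := by
  have hprob : NilCocycle.TendstoInProbability m
      (fun n x => S.dil (1 / (n : ℝ)) (log (α (γ ^ n) x))) (S.averageAb m log α γ) := by
    intro U hU
    obtain ⟨ε, hε, hεU⟩ := NilCocycle.exists_norm_coord_sub_lt_subset hU
    refine NilCocycle.tendsto_measure_one fun δ hδ => ?_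
    filter_upwards [NilCocycle.eventually_norm_scaled_cocycle_lt S hT hα hlog.map_mul γ
      (S.averageAb m log α γ) (NilCocycle.coord_averageAb S m log α γ) hε hδ] with n hn
    obtain ⟨B, hB, hBU⟩ := hn
    refine ⟨B, hB, ?_⟩
    filter_upwards [hBU] with x hx hxB
    exact hεU _ (hx hxB)
  -- The points `y` for which the distance estimate holds for all `n ≥ 1` at once form a
  -- neighbourhood of the limit, so the first assertion applies to it.
  refine ⟨hprob, fun ε hε => ?_⟩
  refine tendsto_of_tendsto_of_tendsto_of_le_of_le'
    (hprob _ (NilCocycle.eventually_ccDist_div_lt (NilCocycle.scaledMul_zero_assoc S hlog) N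
      (S.averageAb m log α γ) hε)) tendsto_const_nhds ?_ (Eventually.of_forall fun n => prob_le_one)
  filter_upwards [eventually_ge_atTop 1] with n hn
  exact measure_mono fun x hx => hx n _ hn rfl
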